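/- All cohomology is étale cohomology. For an abelian group $A$ the same letter denotes the constant étale sheaf with value the discrete group $A$, and $A^\vee = \operatorname{Hom}(A,\mathbb{Q}/\mathbb{Z})$. For $g \in G$ let $\mathrm{ev}_g \colon G^\vee \to \mathbb{Q}/\mathbb{Z}$ denote evaluation at $g$. Let $G$ be a finitely generated abelian group. 1. For any scheme $T$ the homomorphism $$\mathrm{H}^1(T, G^\vee) \to \operatorname{Hom}(G, \mathrm{H}^1(T,\mathbb{Q}/\mathbb{Z})), \qquad x \mapsto \bigl(g \mapsto (\mathrm{ev}_g)_* x\bigr)$$ is an isomorphism, and it is natural in $T$ (for pullback along arbitrary morphisms of schemes) and in $G$. Suppose moreover that $T$ is connected, and let $x \in \mathrm{H}^1(T, G^\vee)$. If $x$ is represented by a $G^\vee$-torsor $Y \to T$ with $Y$ connected, then the corresponding homomorphism $G \to \mathrm{H}^1(T,\mathbb{Q}/\mathbb{Z})$ is injective. Conversely, if $G$ is finite, or $T$ is quasi-compact and quasi-separated, or the group $\mathrm{H}^1(T,\mathbb{Q}/\mathbb{Z})$ is torsion, and the homomorphism corresponding to $x$ is injective, then $x$ is represented by a connected $G^\vee$-torsor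 $Y \to T$. 2. For every morphism of schemes $f \colon S \to T$ there is an isomorphism of étale sheaves on $T$ $$\mathrm{R}^1 f_* G^\vee \to \mathcal{H}om_{\mathrm{Sh}(T)}(G, \mathrm{R}^1 f_*(\mathbb{Q}/\mathbb{Z})),$$ natural in $G$, which sends a section $s$ over an étale $U \to T$ to the homomorphism of sheaves on $U$ taking the constant section $g \in G$ over an étale $V \to U$ to $\mathrm{R}^1 f_*(\mathrm{ev}_g)(s|_V)$. -/

import Mathlib

universe u

open CategoryTheory Limits AlgebraicGeometry Opposite Abelian

noncomputable section

namespace EtaleTorsor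

/-! ## Abelian sheaves on the small étale site -/

/-- The category of abelian sheaves on the small étale site of `T`. -/
abbrev EtSh (T : Scheme.{u}) := Sheaf T.smallEtaleTopology AddCommGrpCat.{u}

/-- The constant étale sheaf on `T` with value the (discrete) abelian group `A`. -/
abbrev constSh (T : Scheme.{u}) (A : Type u) [AddCommGroup A] : EtSh T :=
  (constantSheaf T.smallEtaleTopology AddCommGrpCat.{u}).obj (AddCommGrpCat.of A)

/-- The map of constant sheaves induced by a homomorphism of abelian groups. -/
abbrev constMap (T : Scheme.{u}) {A B : Type u} [AddCommGroup A] [AddCommGroup B] (φ : A →+ B) :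
    constSh T A ⟶ constSh T B :=
  (constantSheaf T.smallEtaleTopology AddCommGrpCat.{u}).map (AddCommGrpCat.ofHom φ)

/-- The section over `U` of the constant sheaf given by an element `a` of `A`. -/
def constSec (T : Scheme.{u}) (A : Type u) [AddCommGroup A] (U : T.Etale) (a : A) :
    (constSh T A).obj.obj (op U) :=
  (toSheafify T.smallEtaleTopology
    ((Functor.const (T.Etale)ᵒᵖ).obj (AddCommGrpCat.of A))).app (op U) a

lemma constMap_add (T : Scheme.{u}) {A B : Type u} [AddCommGroup A] [AddCommGroup B]
    (φ ψ : A →+ B) : constMap T (φ + ψ) = constMap T φ + constMap T ψ := by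
  have : (constantSheaf T.smallEtaleTopology AddCommGrpCat.{u}).Additive := by
    unfold constantSheaf
    have : (Functor.const (T.Etale)ᵒᵖ : AddCommGrpCat.{u} ⥤ _).Additive := ⟨rfl⟩
    infer_instance
  exact (constantSheaf T.smallEtaleTopology AddCommGrpCat.{u}).map_add
    (f := AddCommGrpCat.ofHom φ) (g := AddCommGrpCat.ofHom ψ)

/-- The étale cohomology group `H¹(T, A)` with coefficients in a (discrete) abelian group `A`. -/
abbrev H1 (T : Scheme.{u}) (A : Type u) [AddCommGroup A] : Type u :=
  Sheaf.H.{u} (constSh T A) 1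

/-! ## Dual groups and the canonical map in degree one -/

/-- The abelian group `ℚ/ℤ`, placed in the universe `u`. -/
abbrev QZ : Type u := ULift.{u} (AddCircle (1 : ℚ))

/-- The dual `G^∨ = Hom(G, ℚ/ℤ)` of an abelian group. -/
abbrev Dual (G : Type u) [AddCommGroup G] : Type u := G →+ QZ.{u}

/-- The transpose `G'^∨ → G^∨` of a homomorphism `G → G'`. -/
abbrev dualMap {G G' : Type u} [AddCommGroup G] [AddCommGroup G'] (φ : G →+ G') :
    Dual G' →+ Dual G := AddMonoidHom.compHom' φ

/-- Evaluation `G^∨ → ℚ/ℤ` at an element of `G`. -/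
abbrev evalAt {G : Type u} [AddCommGroup G] (g : G) : Dual G →+ QZ.{u} := AddMonoidHom.eval g

/-- The canonical homomorphism `H¹(T, G^∨) → Hom(G, H¹(T, ℚ/ℤ))`, which sends a class `x` to
the homomorphism taking `g` to the image of `x` under evaluation at `g`. -/
def evalHom (T : Scheme.{u}) (G : Type u) [AddCommGroup G] :
    H1 T (Dual G) →+ (G →+ H1 T QZ.{u}) where
  toFun x := AddMonoidHom.mk' (fun g => Sheaf.H.map (constMap T (evalAt g)) 1 x) (fun g h => by
    rw [show evalAt (g + h) = evalAt g + evalAt h from map_add AddMonoidHom.eval g h,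
      constMap_add, Sheaf.H.map_add_apply])
  map_zero' := by ext; simp
  map_add' x y := by ext; simp

/-! ## Functoriality of the small étale site -/

/-- Lift a functor through a fully faithful functor, given lifts of the objects. -/
@[simps]
def liftFF {C D E : Type*} [Category* C] [Category* D] [Category* E] {F : D ⥤ E}
    (hF : F.FullyFaithful) (K : C ⥤ E) (obj : C → D) (e : ∀ X, F.obj (obj X) ≅ K.obj X) :
    C ⥤ D where
  obj := obj
  map {X Y} g := hF.preimage ((e X).hom ≫ K.map g ≫ (e Y).inv)
  map_id X := hF.map_injective (by simp)
  map_comp g h := hF.map_injective (by simp)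

/-- The defining isomorphism of `liftFF`. -/
@[simps!]
def liftFFIso {C D E : Type*} [Category* C] [Category* D] [Category* E] {F : D ⥤ E}
    (hF : F.FullyFaithful) (K : C ⥤ E) (obj : C → D) (e : ∀ X, F.obj (obj X) ≅ K.obj X) :
    liftFF hF K obj e ⋙ F ≅ K :=
  NatIso.ofComponents e (fun {X Y} g =>
    (congrArg (· ≫ (e Y).hom) (hF.map_preimage ((e X).hom ≫ K.map g ≫ (e Y).inv))).trans
      (by rw [Category.assoc, Category.assoc, Iso.inv_hom_id, Category.comp_id]; rfl))

/-- The base change functor `U ↦ U ×_T S` from étale `T`-schemes to étale `S`-schemes. -/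
def bc {S T : Scheme.{u}} (f : S ⟶ T) : T.Etale ⥤ S.Etale :=
  liftFF (Scheme.Etale.forgetFullyFaithful S) (Scheme.Etale.forget T ⋙ Over.pullback f)
    (fun U => Scheme.Etale.mk (pullback.snd U.hom f))
    (fun U => Iso.refl ((Over.pullback f).obj ((Scheme.Etale.forget T).obj U)))

/-- `bc` is the restriction of the base change functor on all schemes over `T`. -/
def bcForgetIso {S T : Scheme.{u}} (f : S ⟶ T) :
    bc f ⋙ Scheme.Etale.forget S ≅ Scheme.Etale.forget T ⋙ Over.pullback f :=
  liftFFIso _ _ _ _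

instance {S T : Scheme.{u}} (f : S ⟶ T) : PreservesFiniteLimits (bc f) := by
  have : PreservesFiniteLimits (bc f ⋙ Scheme.Etale.forget S) := by
    have : PreservesFiniteLimits (Over.pullback f) := inferInstance
    exact preservesFiniteLimits_of_natIso (bcForgetIso f).symm
  exact preservesFiniteLimits_of_reflects_of_preserves (bc f) (Scheme.Etale.forget S)

instance {S T : Scheme.{u}} (f : S ⟶ T) : RepresentablyFlat (bc f) :=
  flat_of_preservesFiniteLimits _

lemma exists_of_isPullback {P X Y Z : Scheme.{u}} {p : P ⟶ X} {q : P ⟶ Y} {f : X ⟶ Z} {g : Y ⟶ Z}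
    (sq : IsPullback p q f g) (x : X) (y : Y) (h : f x = g y) : ∃ w : P, p w = x ∧ q w = y := by
  obtain ⟨w, rfl, rfl⟩ := Scheme.Pullback.exists_preimage_pullback x y h
  refine ⟨sq.isoPullback.inv w, ?_, ?_⟩
  · rw [← Scheme.Hom.comp_apply, sq.isoPullback_inv_fst]
  · rw [← Scheme.Hom.comp_apply, sq.isoPullback_inv_snd]

lemma bc_map_left {S T : Scheme.{u}} (f : S ⟶ T) {U V : T.Etale} (g : U ⟶ V) :
    ((bc f).map g).left = ((Over.pullback f).map ((Scheme.Etale.forget T).map g)).left := by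
  have h := (bcForgetIso f).hom.naturality g
  have h1 : (Scheme.Etale.forget S).map ((bc f).map g) =
      (Over.pullback f).map ((Scheme.Etale.forget T).map g) := by
    refine (Category.comp_id _).symm.trans (h.trans (Category.id_comp _))
  exact congr_arg CommaMorphism.left h1

lemma bc_sq {S T : Scheme.{u}} (f : S ⟶ T) {U V : T.Etale} (g : U ⟶ V) :
    IsPullback (pullback.fst U.hom f) ((bc f).map g).left g.left (pullback.fst V.hom f) := by
  have h2 : IsPullback (pullback.fst V.hom f) (pullback.snd V.hom f) V.hom f := .of_hasPullback _ _
  have h1 : IsPullback (pullback.fst U.hom f) (pullback.snd U.hom f) U.hom f := .of_hasPullback _ _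
  have e : g.left ≫ V.hom = U.hom := Over.w ((Scheme.Etale.forget T).map g)
  rw [bc_map_left]
  refine IsPullback.of_bot (h₂₁ := pullback.fst V.hom f) (v₂₁ := pullback.snd V.hom f)
    (v₂₂ := V.hom) (h₃₁ := f) ?_ ?_ h2
  · convert! h1 using 1
    · exact pullback.lift_snd _ _ _
  · exact (pullback.lift_fst _ _ _).symm

lemma bc_coverPreserving {S T : Scheme.{u}} (f : S ⟶ T) :
    CoverPreserving T.smallEtaleTopology S.smallEtaleTopology (bc f) := by
  constructor
  intro U R hR
  obtain ⟨ι, Z, g, rfl⟩ := R.exists_eq_ofArrows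
  rw [Scheme.ofArrows_mem_smallEtaleTopology_iff] at hR
  rw [Sieve.ofArrows, ← Sieve.generate_map_eq_functorPushforward, Presieve.map_ofArrows]
  change Sieve.ofArrows _ _ ∈ _
  rw [Scheme.ofArrows_mem_smallEtaleTopology_iff]
  refine Set.eq_univ_of_forall fun y => ?_
  obtain ⟨_, ⟨i, rfl⟩, z, hz⟩ : pullback.fst U.hom f y ∈ ⋃ i, Set.range (g i).left := by
    rw [hR]; trivial
  obtain ⟨w, _, hw⟩ := exists_of_isPullback (bc_sq f (g i)) z y hz
  exact Set.mem_iUnion.2 ⟨i, w, hw⟩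

instance {S T : Scheme.{u}} (f : S ⟶ T) :
    (bc f).IsContinuous T.smallEtaleTopology S.smallEtaleTopology := by
  rw [Functor.isContinuous_iff_coverPreserving]
  exact bc_coverPreserving f

/-- The pushforward `f_*` of étale abelian sheaves, `(f_* F)(U) = F(U ×_T S)`. -/
abbrev pushforward {S T : Scheme.{u}} (f : S ⟶ T) : EtSh S ⥤ EtSh T :=
  (bc f).sheafPushforwardContinuous AddCommGrpCat.{u} T.smallEtaleTopology S.smallEtaleTopology

instance {S T : Scheme.{u}} (f : S ⟶ T) : (pushforward f).Additive where
  map_add := rfl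

/-- The first higher direct image `R¹f_*`, the first right derived functor of `f_*`. -/
def R1 {S T : Scheme.{u}} (f : S ⟶ T) : EtSh S ⥤ EtSh T := (pushforward f).rightDerived 1

instance {S T : Scheme.{u}} (f : S ⟶ T) : (pushforward f).IsRightAdjoint := by
  let E := (Scheme.AffineEtale.Spec T).sheafPushforwardContinuous AddCommGrpCat.{u}
      (Scheme.AffineEtale.topology T) T.smallEtaleTopology
  have : (pushforward f ⋙ E).IsRightAdjoint := by
    have (X : S.Etaleᵒᵖ) : HasColimitsOfShape
        (CostructuredArrow (Scheme.AffineEtale.Spec T ⋙ bc f).op X) AddCommGrpCat.{u} :=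
      hasColimitsOfShape_of_essentiallySmall.{u} _ _
    have : (Scheme.AffineEtale.Spec T ⋙ bc f).IsContinuous (Scheme.AffineEtale.topology T)
      S.smallEtaleTopology := Functor.isContinuous_comp _ _ _ T.smallEtaleTopology _
    exact inferInstanceAs ((Scheme.AffineEtale.Spec T ⋙ bc f).sheafPushforwardContinuous
      AddCommGrpCat.{u} (Scheme.AffineEtale.topology T) S.smallEtaleTopology).IsRightAdjoint
  have e : (pushforward f ⋙ E) ⋙ E.inv ≅ pushforward f :=
    Functor.associator _ _ _ ≪≫ Functor.isoWhiskerLeft _ E.asEquivalence.unitIso.symm ≪≫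
      Functor.rightUnitor _
  exact Functor.isRightAdjoint_of_iso e

/-- The pullback `f^*` of étale abelian sheaves, the left adjoint of `f_*`. -/
abbrev pb {S T : Scheme.{u}} (f : S ⟶ T) : EtSh T ⥤ EtSh S :=
  (bc f).sheafPullback AddCommGrpCat.{u} T.smallEtaleTopology S.smallEtaleTopology

/-- The adjunction between `f^*` and `f_*`. -/
def pbAdj {S T : Scheme.{u}} (f : S ⟶ T) : pb f ⊣ pushforward f :=
  (bc f).sheafAdjunctionContinuous AddCommGrpCat.{u} T.smallEtaleTopology S.smallEtaleTopology

instance {S T : Scheme.{u}} (f : S ⟶ T) : (pb f).IsLeftAdjoint := (pbAdj f).isLeftAdjoint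

instance {S T : Scheme.{u}} (f : S ⟶ T) : (pb f).Additive := (pbAdj f).left_adjoint_additive

/-- The fibre functor of a geometric point `s` of `S` composed with base change along `f` is the
fibre functor of the image of `s` in `T`. -/
def fiberIso {S T : Scheme.{u}} (f : S ⟶ T) {Ω : Type u} [Field Ω] [IsSepClosed Ω]
    (s : Spec (CommRingCat.of Ω) ⟶ S) :
    bc f ⋙ (Scheme.pointSmallEtale s).fiber ≅ (Scheme.pointSmallEtale (s ≫ f)).fiber :=
  Functor.isoWhiskerRight (bcForgetIso f) (coyoneda.obj (op (Over.mk s))) ≪≫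
    NatIso.ofComponents (fun U => (((Over.mapPullbackAdj f).homEquiv (Over.mk s)
      ((Scheme.Etale.forget T).obj U)).symm).toIso) (by
      intro U V g
      ext x
      exact (Over.mapPullbackAdj f).homEquiv_naturality_right_symm _ _)

lemma mono_fiber {S T : Scheme.{u}} (f : S ⟶ T) {Ω : Type u} [Field Ω] [IsSepClosed Ω]
    (s : Spec (CommRingCat.of Ω) ⟶ S) {F G : EtSh T} (i : F ⟶ G) [Mono i] :
    Mono ((Scheme.pointSmallEtale s).sheafFiber.map ((pb f).map i)) := by
  have : InitiallySmall.{u} (bc f ⋙ (Scheme.pointSmallEtale s).fiber).Elements :=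
    let E := (CategoryOfElements.structuredArrowEquivalence
        (Scheme.pointSmallEtale (s ≫ f)).fiber).trans
      ((StructuredArrow.mapNatIso (fiberIso f s).symm).trans
        (CategoryOfElements.structuredArrowEquivalence _).symm)
    initiallySmall_of_initial_of_initiallySmall E.functor
  let e := (Scheme.pointSmallEtale s).sheafFiberComapIso (bc f) (bc_coverPreserving f)
    AddCommGrpCat.{u}
  exact ((MorphismProperty.monomorphisms _).arrow_mk_iso_iff
      (((Functor.mapArrowFunctor _ _).mapIso e).app (Arrow.mk i))).1
        (inferInstanceAs (Mono ((((Scheme.pointSmallEtale s).comap (bc f)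
          (bc_coverPreserving f)).sheafFiber).map i)))

instance {S T : Scheme.{u}} (f : S ⟶ T) : (pb f).PreservesMonomorphisms where
  preserves {F G} i _ := by
    have hP := Scheme.isConservativeFamilyOfPoints_pointSmallEtale' S
    rw [(hP.jointlyReflectMonomorphisms AddCommGrpCat.{u}).mono_iff]
    rintro ⟨_, ⟨s⟩⟩
    exact mono_fiber f _ i

instance {S T : Scheme.{u}} (f : S ⟶ T) : PreservesFiniteLimits (pb f) := by
  refine (((pb f).preservesFiniteLimits_tfae).out 0 3).1 fun S hS => ?_
  have := hS.mono_f
  have := hS.epi_g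
  exact ⟨(((pb f).preservesFiniteColimits_tfae.out 3 0 rfl rfl).1
    (inferInstance : PreservesFiniteColimits (pb f)) S hS).1, inferInstance⟩

/-- `T` is a terminal object of its small étale site. -/
def isTerminalSelf (T : Scheme.{u}) : IsTerminal (Scheme.Etale.mk (𝟙 T)) :=
  IsTerminal.isTerminalOfObj (Scheme.Etale.forget T) _ Over.mkIdTerminal

/-- The canonical isomorphism between the pullback of a constant sheaf on `T` and the constant
sheaf on `S`: both are left adjoint to taking sections over `S ≅ T ×_T S`. -/
def constPullIso {S T : Scheme.{u}} (f : S ⟶ T) :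
    constantSheaf T.smallEtaleTopology AddCommGrpCat.{u} ⋙ pb f ≅
      constantSheaf S.smallEtaleTopology AddCommGrpCat.{u} :=
  ((constantSheafAdj T.smallEtaleTopology AddCommGrpCat.{u} (isTerminalSelf T)).comp
    (pbAdj f)).leftAdjointUniq
    (constantSheafAdj S.smallEtaleTopology AddCommGrpCat.{u}
      ((isTerminalSelf T).isTerminalObj (bc f)))

/-- The pullback `f^* : H¹(T, A) → H¹(S, A)` on étale cohomology with constant coefficients. -/
def H1pull {S T : Scheme.{u}} (f : S ⟶ T) (A : Type u) [AddCommGroup A] (x : H1 T A) : H1 S A :=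
  (Ext.mk₀ ((constPullIso f).inv.app (AddCommGrpCat.of (ULift.{u} ℤ)))).comp
    ((x.mapExactFunctor (pb f)).comp
      (Ext.mk₀ ((constPullIso f).hom.app (AddCommGrpCat.of A))) (add_zero 1)) (zero_add 1)

/-! ## Torsors -/

/-- A torsor over `T` under the constant group `A`: an étale surjective `T`-scheme `Y` with an
action of `A` over `T` such that `A × Y → Y ×_T Y`, `(a, y) ↦ (y, a y)`, is an isomorphism. -/
structure Torsor (T : Scheme.{u}) (A : Type u) [AddCommGroup A] where
  /-- The underlying étale `T`-scheme. -/
  Y : T.Etale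
  /-- The action of `A`. -/
  act : A → (Y ⟶ Y)
  act_zero : act 0 = 𝟙 Y
  act_add (a b : A) : act (a + b) = act a ≫ act b
  surjective : Surjective Y.hom
  isIso : IsIso (Sigma.desc (fun a : A => pullback.lift (f := Y.hom) (g := Y.hom)
    (𝟙 Y.left) (act a).left
    ((Category.id_comp _).trans (Over.w ((Scheme.Etale.forget T).map (act a))).symm)) :
      ∐ (fun _ : A => Y.left) ⟶ pullback Y.hom Y.hom)

/-- The torsor `P` represents the class `x` in `H¹(T, A) = Ext¹(ℤ, A)`: there is an extension
`0 → A → E → ℤ → 0` of étale sheaves with class `x` such that the `A`-torsor of local sections of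
`E` lying over `1` is isomorphic to `P`. -/
def Torsor.HasClass {T : Scheme.{u}} {A : Type u} [AddCommGroup A] (P : Torsor T A)
    (x : H1 T A) : Prop :=
  ∃ (E : EtSh T) (i : constSh T A ⟶ E) (p : E ⟶ constSh T (ULift.{u} ℤ)) (w : i ≫ p = 0)
    (h : (ShortComplex.mk i p w).ShortExact)
    (φ : yoneda.obj P.Y ⟶ E.obj ⋙ forget AddCommGrpCat.{u}),
    h.extClass = x ∧
    (∀ (U : T.Etale) (y : U ⟶ P.Y) (a : A),
      (φ.app (op U) (y ≫ P.act a) : E.obj.obj (op U)) =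
        i.hom.app (op U) (constSec T A U a) + (φ.app (op U) y : E.obj.obj (op U))) ∧
    (∀ U : T.Etale, Function.Injective (φ.app (op U))) ∧
    (∀ (U : T.Etale) (s : E.obj.obj (op U)),
      p.hom.app (op U) s = constSec T (ULift.{u} ℤ) U ⟨1⟩ ↔
        ∃ y : U ⟶ P.Y, φ.app (op U) y = s)

/-! ## The internal Hom of étale sheaves -/

/-- The presheaf of abelian groups `X ↦ Hom(F|_X, G|_X)`, where `F|_X` and `G|_X` are the
restrictions to the slice category over `X`. -/
def internalHomPresheaf {C : Type*} [Category* C] (F G : Cᵒᵖ ⥤ AddCommGrpCat.{u}) :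
    Cᵒᵖ ⥤ AddCommGrpCat where
  obj X := AddCommGrpCat.of ((Over.forget X.unop).op ⋙ F ⟶ (Over.forget X.unop).op ⋙ G)
  map f := AddCommGrpCat.ofHom
    { toFun α := (presheafHom F G).map f α
      map_zero' := rfl
      map_add' _ _ := rfl }
  map_id X := AddCommGrpCat.hom_ext (AddMonoidHom.ext fun α =>
    congr($((presheafHom F G).map_id X) α))
  map_comp f g := AddCommGrpCat.hom_ext (AddMonoidHom.ext fun α =>
    congr($((presheafHom F G).map_comp f g) α))

/-- The sheaf `ℋom(F, G)` of homomorphisms between two étale abelian sheaves. For size reasons its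
values are a priori in the next universe. -/
def internalHom {T : Scheme.{u}} (F G : EtSh T) :
    Sheaf T.smallEtaleTopology AddCommGrpCat.{u + 1} where
  obj := internalHomPresheaf F.obj G.obj
  property := Presheaf.isSheaf_of_isSheaf_comp _ _ (forget AddCommGrpCat.{u + 1})
    (Presheaf.IsSheaf.hom F.obj G.obj G.property)

/-- An étale abelian sheaf regarded as a sheaf with values in the next universe. -/
abbrev ulift {T : Scheme.{u}} (F : EtSh T) : Sheaf T.smallEtaleTopology AddCommGrpCat.{u + 1} :=
  (sheafCompose T.smallEtaleTopology AddCommGrpCat.uliftFunctor.{u + 1, u}).obj F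

/-- The homomorphism `F|_U → G|_U` given by a section over `U` of the sheaf `ℋom(F, G)`. -/
def homOfSection {T : Scheme.{u}} {F G : EtSh T} {U : T.Etale}
    (α : (internalHom F G).obj.obj (op U)) :
    (Over.forget U).op ⋙ F.obj ⟶ (Over.forget U).op ⋙ G.obj := α

/-- Apply a section over `U` of `ℋom(F, G)` to a section of `F` over some `p : V → U`. -/
def applySection {T : Scheme.{u}} {F G : EtSh T} {U V : T.Etale}
    (α : (internalHom F G).obj.obj (op U)) (p : V ⟶ U) (t : F.obj.obj (op V)) :
    G.obj.obj (op V) := (homOfSection α).app (op (Over.mk p)) t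

end EtaleTorsor

end

noncomputable section

namespace EtaleTorsor

/-! Both isomorphisms are instances of one statement about an additive functor Ψ on abelian groups
and the evaluation map Ψ(G^∨) → Hom(G, Ψ(ℚ/ℤ)). For G = ℤⁿ the map is bijective by additivity. In
general a presentation 0 → K → ℤⁿ → G → 0 dualizes to a short exact sequence because ℚ/ℤ is
divisible, and if Ψ is left exact on short exact sequences of groups, a diagram chase transfers
bijectivity to G (`evalFunctor_bijective`). The functors used are A ↦ H¹(T, A) and A ↦ (R¹f_*A)(U).
They are left exact although they have degree one: a surjection of groups induces a surjection on
sections of constant sheaves (`constMap_surjective`), since the values of a locally constant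
function can be lifted one by one, so the connecting map out of degree zero vanishes.

A class x is treated as an extension E of ℤ by the constant sheaf G^∨, its torsor Y being the fibre
of E over 1. If ev_g kills x, then ev_g extends to E → ℚ/ℤ. Evaluated on the tautological section
over Y this is a function that translation by a changes by a(g). On a connected Y it is constant, so
all a(g) vanish and g = 0 (`evalHom_injective_of_connected`).

For the converse, each of the three alternatives forces G to be finite: an injective homomorphism
into a torsion group makes a finitely generated G finite, and over a quasi-compact quasi-separated T
the group H¹(T, ℚ/ℤ) is torsion (`isOfFinAddOrder_H1`). For finite G the fibre over 1 is
representable by étale descent over affines and gluing (`exists_representable`, `exists_torsor`). If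
Y had a nontrivial clopen subset Z, the sets {a | a y ∈ Z} would all be translates of one set, whose
stabilizer is a proper subgroup of G^∨ and hence kills some g ≠ 0. The translation parameter,
evaluated at g, is then a locally constant equivariant function on Y, which trivializes ev_g x and
contradicts injectivity (`Torsor.HasClass.connectedSpace`). -/

/-- Glue locally existing, locally unique sections of a sheaf of types. -/
lemma exists_glue {C : Type*} [Category* C] {J : GrothendieckTopology C} {P : Cᵒᵖ ⥤ Type*}
    (hP : Presieve.IsSheaf J P) {W : C} {S : Sieve W} (hS : S ∈ J W)
    (q : ∀ ⦃V : C⦄ (_ : V ⟶ W), P.obj (op V) → Prop)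
    (stable : ∀ ⦃V V' : C⦄ (f : V ⟶ W) (g : V' ⟶ V) (x), q f x → q (g ≫ f) (P.map g.op x))
    (uniq : ∀ ⦃V : C⦄ (f : V ⟶ W), S f → ∀ x y, q f x → q f y → x = y)
    (ex : ∀ ⦃V : C⦄ (f : V ⟶ W), S f → ∃ x, q f x) :
    ∃ x : P.obj (op W), ∀ ⦃V : C⦄ (f : V ⟶ W), S f → q f (P.map f.op x) := by
  choose x hx using ex
  let x' : Presieve.FamilyOfElements P S.arrows := fun V f hf => x f hf
  obtain ⟨t, ht, -⟩ := hP S hS x' ((Presieve.compatible_iff_sieveCompatible x').2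
    fun V V' f g hf =>
      uniq _ (S.downward_closed hf g) _ _ (hx _ _) (stable _ _ _ (hx _ _)))
  exact ⟨t, fun V f hf => (ht f hf).symm ▸ hx f hf⟩

/-! ### Sections of abelian sheaves -/

section AbSheaf
variable {C : Type*} [Category* C] {J : GrothendieckTopology C} (E : Sheaf J AddCommGrpCat.{u})

lemma isSheaf_forget : Presieve.IsSheaf J (E.obj ⋙ forget AddCommGrpCat.{u}) :=
  (isSheaf_iff_isSheaf_of_type _ _).1
    ((sheafCompose J (forget AddCommGrpCat.{u})).obj E).property

lemma sheaf_ext {W : C} {S : Sieve W} (hS : S ∈ J W) {x y : E.obj.obj (op W)}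
    (h : ∀ ⦃V : C⦄ (f : V ⟶ W), S f → E.obj.map f.op x = E.obj.map f.op y) : x = y :=
  (isSheaf_forget E S hS).isSeparatedFor.ext (fun _ f hf => h f hf)

lemma sheaf_glue {W : C} {S : Sieve W} (hS : S ∈ J W)
    (q : ∀ ⦃V : C⦄ (_ : V ⟶ W), E.obj.obj (op V) → Prop)
    (stable : ∀ ⦃V V' : C⦄ (f : V ⟶ W) (g : V' ⟶ V) (x), q f x → q (g ≫ f) (E.obj.map g.op x))
    (uniq : ∀ ⦃V : C⦄ (f : V ⟶ W), S f → ∀ x y, q f x → q f y → x = y)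
    (ex : ∀ ⦃V : C⦄ (f : V ⟶ W), S f → ∃ x, q f x) :
    ∃ x : E.obj.obj (op W), ∀ ⦃V : C⦄ (f : V ⟶ W), S f → q f (E.obj.map f.op x) :=
  exists_glue (isSheaf_forget E) hS q stable uniq ex

lemma map_comp_elt {U V W : C} (f : V ⟶ U) (g : W ⟶ V) (x : E.obj.obj (op U)) :
    E.obj.map (g ≫ f).op x = E.obj.map g.op (E.obj.map f.op x) := by
  rw [op_comp, Functor.map_comp]; rfl

@[simp] lemma map_id_elt {U : C} (x : E.obj.obj (op U)) :
    E.obj.map (𝟙 U).op x = x := by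
  rw [op_id, CategoryTheory.Functor.map_id]; rfl

lemma app_map_elt {E E' : Sheaf J AddCommGrpCat.{u}} (φ : E ⟶ E') {U V : C} (f : V ⟶ U)
    (x : E.obj.obj (op U)) :
    φ.hom.app (op V) (E.obj.map f.op x) = E'.obj.map f.op (φ.hom.app (op U) x) :=
  ConcreteCategory.congr_hom (φ.hom.naturality f.op) x

end AbSheaf

/-! ### Constant sheaves and their sections -/

section Const
variable (T : Scheme.{u}) (A : Type u) [AddCommGroup A]

@[simp] lemma constSec_map {U V : T.Etale} (f : V ⟶ U) (a : A) :
    (constSh T A).obj.map f.op (constSec T A U a) = constSec T A V a :=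
  (ConcreteCategory.congr_hom ((toSheafify T.smallEtaleTopology
    ((Functor.const (T.Etale)ᵒᵖ).obj (AddCommGrpCat.of A))).naturality f.op) a).symm

@[simp] lemma constSec_add (U : T.Etale) (a b : A) :
    constSec T A U (a + b) = constSec T A U a + constSec T A U b := map_add _ _ _

@[simp] lemma constSec_zero (U : T.Etale) : constSec T A U 0 = 0 := map_zero _

@[simp] lemma constSec_nsmul (U : T.Etale) (n : ℕ) (a : A) :
    constSec T A U (n • a) = n • constSec T A U a := map_nsmul _ _ _

@[simp] lemma constSec_zsmul (U : T.Etale) (n : ℤ) (a : A) :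
    constSec T A U (n • a) = n • constSec T A U a := map_zsmul _ _ _

variable {T A}

lemma exists_constSec_local {U : T.Etale} (c : (constSh T A).obj.obj (op U)) :
    ∃ S ∈ T.smallEtaleTopology U, ∀ ⦃V : T.Etale⦄ (f : V ⟶ U), S f →
      ∃ a, (constSh T A).obj.map f.op c = constSec T A V a := by
  refine ⟨_, Presheaf.imageSieve_mem T.smallEtaleTopology (toSheafify T.smallEtaleTopology
    ((Functor.const (T.Etale)ᵒᵖ).obj (AddCommGrpCat.of A))) c, ?_⟩
  rintro V f ⟨a, ha⟩
  exact ⟨a, ha.symm⟩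

lemma constSec_eq_local {U : T.Etale} {a b : A} (h : constSec T A U a = constSec T A U b) :
    ∃ S ∈ T.smallEtaleTopology U, ∀ ⦃V : T.Etale⦄ (f : V ⟶ U), S f → a = b := by
  refine ⟨_, Presheaf.equalizerSieve_mem T.smallEtaleTopology (toSheafify T.smallEtaleTopology
    ((Functor.const (T.Etale)ᵒᵖ).obj (AddCommGrpCat.of A))) (X := op U) a b h, ?_⟩
  intro V f hf
  exact hf

@[simp] lemma constMap_constSec {B : Type u} [AddCommGroup B] (φ : A →+ B) (U : T.Etale) (a : A) :
    (constMap T φ).hom.app (op U) (constSec T A U a) = constSec T B U (φ a) :=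
  ConcreteCategory.congr_hom (NatTrans.congr_app (toSheafify_naturality T.smallEtaleTopology
    ((Functor.const (T.Etale)ᵒᵖ).map (AddCommGrpCat.ofHom φ))) (op U)).symm a

/-- Two morphisms out of a constant sheaf agree if they agree on constant sections. -/
lemma constSh_hom_ext {E : EtSh T} {φ ψ : constSh T A ⟶ E}
    (h : ∀ U a, φ.hom.app (op U) (constSec T A U a) = ψ.hom.app (op U) (constSec T A U a)) :
    φ = ψ := by
  ext U c
  obtain ⟨S, hS, hc⟩ := exists_constSec_local (U := U.unop) c
  refine sheaf_ext E hS fun V f hf => ?_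
  obtain ⟨a, ha⟩ := hc f hf
  have h1 := app_map_elt φ f c
  have h2 := app_map_elt ψ f c
  rw [ha] at h1 h2
  exact h1.symm.trans ((h _ _).trans h2)

lemma constMap_comp {B D : Type u} [AddCommGroup B] [AddCommGroup D] (φ : A →+ B) (ψ : B →+ D) :
    constMap T (ψ.comp φ) = constMap T φ ≫ constMap T ψ :=
  (constantSheaf T.smallEtaleTopology AddCommGrpCat.{u}).map_comp
    (AddCommGrpCat.ofHom φ) (AddCommGrpCat.ofHom ψ)

/-- Only a set-theoretic section σ of φ is needed: a section of the target is locally constant, and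
applying σ to its local values gives sections that agree on overlaps. This surjectivity on all
sections, not merely locally, is what makes degree one cohomology left exact on groups. -/
lemma constMap_surjective {B : Type u} [AddCommGroup B] (φ : A →+ B)
    (hφ : Function.Surjective φ) (U : T.Etale) :
    Function.Surjective ((constMap T φ).hom.app (op U)) := by
  obtain ⟨σ, hσ⟩ := hφ.hasRightInverse
  intro c
  obtain ⟨S, hS, hc⟩ := exists_constSec_local c
  -- The predicate asks x to take the value σ b, locally, where c takes the value b; it determines x
  -- because b is locally determined by c.
  obtain ⟨x, hx⟩ := sheaf_glue (constSh T A) hS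
    (fun V f x => ∃ R ∈ T.smallEtaleTopology V, ∀ ⦃V' : T.Etale⦄ (g : V' ⟶ V), R g →
      ∃ b, (constSh T B).obj.map (g ≫ f).op c = constSec T B V' b ∧
        (constSh T A).obj.map g.op x = constSec T A V' (σ b))
    (by
      rintro V V' f g x ⟨R, hR, h⟩
      refine ⟨R.pullback g, GrothendieckTopology.pullback_stable _ _ hR, fun V'' k hk => ?_⟩
      obtain ⟨b, h1, h2⟩ := h _ hk
      refine ⟨b, by rw [← h1, Category.assoc], by rw [← h2, map_comp_elt]⟩)
    (by
      rintro V f - x y ⟨R, hR, h⟩ ⟨R', hR', h'⟩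
      refine sheaf_ext _ (GrothendieckTopology.intersection_covering _ hR hR') fun V' g hg => ?_
      obtain ⟨b, h1, h2⟩ := h g hg.1
      obtain ⟨b', h1', h2'⟩ := h' g hg.2
      obtain ⟨Q, hQ, hb⟩ := constSec_eq_local (h1.symm.trans h1')
      refine sheaf_ext _ hQ fun V'' k hk => ?_
      rw [h2, h2', hb k hk])
    (by
      intro V f hf
      obtain ⟨b, hb⟩ := hc f hf
      refine ⟨constSec T A V (σ b), ⊤, GrothendieckTopology.top_mem _ _, fun V' g _ => ⟨b, ?_, ?_⟩⟩
      · rw [map_comp_elt, hb, constSec_map]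
      · rw [constSec_map])
  refine ⟨x, sheaf_ext _ hS fun V f hf => ?_⟩
  obtain ⟨R, hR, h⟩ := hx f hf
  refine sheaf_ext _ hR fun V' g hg => ?_
  obtain ⟨b, h1, h2⟩ := h g hg
  rw [← map_comp_elt, ← map_comp_elt, h1, ← app_map_elt, map_comp_elt, h2, constMap_constSec, hσ]

end Const

/-! ### The evaluation map for an additive functor on abelian groups -/

section EvalFunctor
variable (Ψ : AddCommGrpCat.{u} ⥤ AddCommGrpCat.{u}) [Ψ.Additive]

/-- The canonical map `Ψ(G^∨) → Hom(G, Ψ(ℚ/ℤ))` for an additive functor `Ψ`. -/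
def evalFunctor (G : Type u) [AddCommGroup G] :
    Ψ.obj (AddCommGrpCat.of (Dual G)) →+ (G →+ Ψ.obj (AddCommGrpCat.of QZ.{u})) where
  toFun x := AddMonoidHom.mk' (fun g => Ψ.map (AddCommGrpCat.ofHom (evalAt g)) x) (fun g h => by
    have : AddCommGrpCat.ofHom (evalAt (g + h)) =
      AddCommGrpCat.ofHom (evalAt g) + AddCommGrpCat.ofHom (evalAt h) := by
        ext; simp
    rw [this, Ψ.map_add]; rfl)
  map_zero' := by ext; simp
  map_add' x y := by ext; simp

lemma evalFunctor_apply (G : Type u) [AddCommGroup G] (x : Ψ.obj (AddCommGrpCat.of (Dual G)))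
    (g : G) : evalFunctor Ψ G x g = Ψ.map (AddCommGrpCat.ofHom (evalAt g)) x := rfl

omit [Ψ.Additive] in
lemma map_comp_ofHom_apply {A B C : Type u} [AddCommGroup A] [AddCommGroup B] [AddCommGroup C]
    (f : A →+ B) (g : B →+ C) (x : Ψ.obj (AddCommGrpCat.of A)) :
    Ψ.map (AddCommGrpCat.ofHom g) (Ψ.map (AddCommGrpCat.ofHom f) x) =
      Ψ.map (AddCommGrpCat.ofHom (g.comp f)) x := by
  rw [AddCommGrpCat.ofHom_comp, Ψ.map_comp]; rfl

lemma evalFunctor_dualMap {G G' : Type u} [AddCommGroup G] [AddCommGroup G'] (φ : G →+ G')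
    (x : Ψ.obj (AddCommGrpCat.of (Dual G'))) :
    evalFunctor Ψ G (Ψ.map (AddCommGrpCat.ofHom (dualMap φ)) x) = (evalFunctor Ψ G' x).comp φ := by
  ext g
  simp only [evalFunctor_apply, AddMonoidHom.comp_apply]
  rw [map_comp_ofHom_apply]
  rfl

lemma map_sum_ofHom_apply {A B ι : Type u} [AddCommGroup A] [AddCommGroup B] (s : Finset ι)
    (f : ι → A →+ B) (x : Ψ.obj (AddCommGrpCat.of A)) :
    Ψ.map (AddCommGrpCat.ofHom (∑ i ∈ s, f i)) x =
      ∑ i ∈ s, Ψ.map (AddCommGrpCat.ofHom (f i)) x := by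
  classical
  let Φ : (A →+ B) →+ Ψ.obj (AddCommGrpCat.of B) :=
    AddMonoidHom.mk' (fun h => Ψ.map (AddCommGrpCat.ofHom h) x) (fun h k => by
      have : AddCommGrpCat.ofHom (h + k) = AddCommGrpCat.ofHom h + AddCommGrpCat.ofHom k := rfl
      rw [this, Ψ.map_add]; rfl)
  exact map_sum Φ f s

/-- The homomorphism `ℚ/ℤ → (ℤⁿ)^∨` onto the factor given by an index. -/
def dualSingle {ι : Type u} (i : ι) : QZ.{u} →+ Dual (ι → ℤ) where
  toFun q := (zmultiplesHom QZ.{u} q).comp (Pi.evalAddMonoidHom (fun _ : ι => ℤ) i)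
  map_zero' := by ext; simp
  map_add' p q := by ext; simp

lemma dualSingle_apply {ι : Type u} (i : ι) (q : QZ.{u}) (v : ι → ℤ) :
    dualSingle i q v = v i • q := rfl

lemma map_zsmul_ofHom_apply (n : ℤ) (x : Ψ.obj (AddCommGrpCat.of QZ.{u})) :
    Ψ.map (AddCommGrpCat.ofHom (zsmulAddGroupHom n)) x = n • x := by
  have : AddCommGrpCat.ofHom (zsmulAddGroupHom n : QZ.{u} →+ QZ.{u}) =
    n • 𝟙 (AddCommGrpCat.of QZ.{u}) := rfl
  rw [this, Functor.map_zsmul, Ψ.map_id]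
  rfl

/-- The dual of ℤⁿ is a finite sum of copies of ℚ/ℤ, with projections the evaluations at basis
vectors and inclusions `dualSingle`; an additive functor preserves this decomposition. -/
lemma evalFunctor_bijective_free (ι : Type u) [Fintype ι] :
    Function.Bijective (evalFunctor Ψ (ι → ℤ)) := by
  classical
  have key : AddMonoidHom.id (Dual (ι → ℤ)) =
      ∑ i, (dualSingle i).comp (evalAt (Pi.single i (1 : ℤ))) := by
    refine AddMonoidHom.ext fun χ => AddMonoidHom.ext fun v => ?_
    have : v = ∑ i, v i • (Pi.single i (1 : ℤ) : ι → ℤ) := by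
      ext j; simp [Finset.sum_apply, Pi.single_apply]
    simp only [AddMonoidHom.finsetSum_apply, AddMonoidHom.comp_apply, dualSingle_apply]
    conv_lhs => rw [this, map_sum]
    exact Finset.sum_congr rfl fun i _ => map_zsmul χ _ _
  constructor
  · rw [injective_iff_map_eq_zero]
    intro x hx
    have h : Ψ.map (AddCommGrpCat.ofHom (AddMonoidHom.id (Dual (ι → ℤ)))) x = x := by
      rw [AddCommGrpCat.ofHom_id, Ψ.map_id]; rfl
    rw [← h, key, map_sum_ofHom_apply]
    refine Finset.sum_eq_zero fun i _ => ?_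
    rw [← map_comp_ofHom_apply, ← evalFunctor_apply, hx]
    simp
  · intro φ
    refine ⟨∑ i, Ψ.map (AddCommGrpCat.ofHom (dualSingle i)) (φ (Pi.single i 1)), ?_⟩
    refine AddMonoidHom.ext fun v => ?_
    rw [evalFunctor_apply, map_sum]
    have : v = ∑ i, v i • (Pi.single i (1 : ℤ) : ι → ℤ) := by
      ext j; simp [Finset.sum_apply, Pi.single_apply]
    conv_rhs => rw [this, map_sum]
    refine Finset.sum_congr rfl fun i _ => ?_
    rw [map_comp_ofHom_apply, map_zsmul, ← map_zsmul_ofHom_apply]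
    rfl

/-- Left exactness of a functor on short exact sequences of abelian groups. -/
def LeftExactOnGroups : Prop :=
  ∀ (A B C : Type u) [AddCommGroup A] [AddCommGroup B] [AddCommGroup C] (i : A →+ B) (p : B →+ C),
    Function.Injective i → Function.Surjective p → Function.Exact i p →
    Function.Injective (Ψ.map (AddCommGrpCat.ofHom i)) ∧
      ∀ x, Ψ.map (AddCommGrpCat.ofHom p) x = 0 → ∃ y, Ψ.map (AddCommGrpCat.ofHom i) y = x

/-- Divisibility of ℚ/ℤ lets characters extend from subgroups. -/
lemma qz_extend {K F : Type u} [AddCommGroup K] [AddCommGroup F] (i : K →+ F)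
    (hi : Function.Injective i) : Function.Surjective (dualMap i) := by
  intro χ
  obtain ⟨ψ, hψ⟩ := CharacterModule.dual_surjective_of_injective i.toIntLinearMap hi
    (AddEquiv.ulift.toAddMonoidHom.comp χ)
  refine ⟨AddEquiv.ulift.symm.toAddMonoidHom.comp ψ, AddMonoidHom.ext fun k => ?_⟩
  exact congrArg ULift.up (DFunLike.congr_fun hψ k)

lemma exists_presentation (G : Type u) [AddCommGroup G] [AddGroup.FG G] :
    ∃ (ι : Type u) (_ : Fintype ι) (π : (ι → ℤ) →+ G), Function.Surjective π := by
  have : Module.Finite ℤ G := Module.Finite.iff_addGroup_fg.2 ‹_›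
  obtain ⟨n, f, hf⟩ := Module.Finite.exists_fin' ℤ G
  refine ⟨ULift (Fin n), inferInstance,
    f.toAddMonoidHom.comp
      (LinearMap.funLeft ℤ ℤ (ULift.up.{u} : Fin n → ULift (Fin n))).toAddMonoidHom, ?_⟩
  exact hf.comp (LinearMap.funLeft_surjective_of_injective ℤ ℤ _ ULift.up_injective)

lemma dualMap_injective {F G : Type u} [AddCommGroup F] [AddCommGroup G] {π : F →+ G}
    (hπ : Function.Surjective π) : Function.Injective (dualMap π) := fun χ ψ e =>
  AddMonoidHom.ext fun g => by
    obtain ⟨v, rfl⟩ := hπ g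
    exact DFunLike.congr_fun e v

lemma dualMap_exact {F G : Type u} [AddCommGroup F] [AddCommGroup G] {π : F →+ G}
    (hπ : Function.Surjective π) : Function.Exact (dualMap π) (dualMap π.ker.subtype) := by
  intro χ
  constructor
  · intro hχ
    have hk : π.ker ≤ χ.ker := fun v hv =>
      (DFunLike.congr_fun hχ ⟨v, hv⟩ : (dualMap π.ker.subtype χ) ⟨v, hv⟩ = 0)
    refine ⟨(QuotientAddGroup.lift π.ker χ hk).comp
      (QuotientAddGroup.quotientKerEquivOfSurjective π hπ).symm.toAddMonoidHom, ?_⟩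
    ext1 v
    have h : (QuotientAddGroup.quotientKerEquivOfSurjective π hπ).symm (π v) =
        (v : F ⧸ π.ker) :=
      (QuotientAddGroup.quotientKerEquivOfSurjective π hπ).symm_apply_apply (v : F ⧸ π.ker)
    exact congrArg (QuotientAddGroup.lift π.ker χ hk) h
  · rintro ⟨ψ, rfl⟩
    ext1 ⟨v, hv⟩
    change ψ (π v) = 0
    rw [show π v = 0 from hv, map_zero]

-- Dualizing a surjection ℤⁿ → G gives an injection of duals, which Ψ keeps injective, so the free
-- case detects vanishing.
variable {Ψ} in
lemma evalFunctor_injective (h : LeftExactOnGroups Ψ) (G : Type u) [AddCommGroup G]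
    [AddGroup.FG G] : Function.Injective (evalFunctor Ψ G) := by
  obtain ⟨ι, _, π, hπ⟩ := exists_presentation G
  obtain ⟨h1, h2⟩ := h _ _ _ (dualMap π) (dualMap π.ker.subtype)
    (dualMap_injective hπ) (qz_extend _ Subtype.val_injective) (dualMap_exact hπ)
  rw [injective_iff_map_eq_zero]
  intro x hx
  refine (injective_iff_map_eq_zero (Ψ.map (AddCommGrpCat.ofHom (dualMap π))).hom).1 h1 x ?_
  apply (evalFunctor_bijective_free Ψ ι).1
  refine (evalFunctor_dualMap Ψ π x).trans ?_
  rw [hx, map_zero, AddMonoidHom.zero_comp]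

-- A homomorphism on G pulls back to ℤⁿ and comes there from some y. The image of y in Ψ(K^∨), for K
-- the kernel of the presentation, evaluates to zero on K, so it vanishes by injectivity for the
-- finitely generated group K; exactness then brings y back to Ψ(G^∨).
variable {Ψ} in
lemma evalFunctor_bijective (h : LeftExactOnGroups Ψ) (G : Type u) [AddCommGroup G]
    [AddGroup.FG G] : Function.Bijective (evalFunctor Ψ G) := by
  refine ⟨evalFunctor_injective h G, fun φ => ?_⟩
  obtain ⟨ι, _, π, hπ⟩ := exists_presentation G
  obtain ⟨h1, h2⟩ := h _ _ _ (dualMap π) (dualMap π.ker.subtype)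
    (dualMap_injective hπ) (qz_extend _ Subtype.val_injective) (dualMap_exact hπ)
  have : AddGroup.FG π.ker := Module.Finite.iff_addGroup_fg.1
    (inferInstanceAs (Module.Finite ℤ (AddSubgroup.toIntSubmodule π.ker)))
  obtain ⟨y, hy⟩ := (evalFunctor_bijective_free Ψ ι).2 (φ.comp π)
  obtain ⟨x, hx⟩ := h2 y (evalFunctor_injective h π.ker (by
    rw [evalFunctor_dualMap, hy, map_zero]
    ext1 v
    change φ (π v) = 0
    rw [show π v = 0 from v.2, map_zero]))
  refine ⟨x, AddMonoidHom.ext fun g => ?_⟩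
  obtain ⟨v, rfl⟩ := hπ g
  rw [← hx, evalFunctor_dualMap] at hy
  exact DFunLike.congr_fun hy v

end EvalFunctor

/-! ### Degree one cohomology of constant sheaves -/

section CohomologyOfConstant
variable (T : Scheme.{u})

/-- The constant sheaves of a short exact sequence of groups. -/
abbrev constSC {T : Scheme.{u}} {A B C : Type u} [AddCommGroup A] [AddCommGroup B] [AddCommGroup C]
    (i : A →+ B) (p : B →+ C) (h : Function.Exact i p) : ShortComplex (EtSh T) :=
  ShortComplex.mk (constMap T i) (constMap T p) (by
    rw [← constMap_comp, h.addMonoidHom_comp_eq_zero]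
    exact constSh_hom_ext fun U a => by rw [constMap_constSec]; exact constSec_zero _ _ _)

/-- The morphism of presheaves out of a constant presheaf given by a homomorphism to the global
sections. -/
def constPresheafLift {T : Scheme.{u}} {A : Type u} [AddCommGroup A] (E : EtSh T)
    (φ : A →+ E.obj.obj (op (Scheme.Etale.mk (𝟙 T)))) :
    (Functor.const (T.Etale)ᵒᵖ).obj (AddCommGrpCat.of A) ⟶ E.obj where
  app U := AddCommGrpCat.ofHom ((E.obj.map ((isTerminalSelf T).from U.unop).op).hom.comp φ)
  naturality U V f := by
    ext a
    change E.obj.map _ (φ a) = E.obj.map f (E.obj.map _ (φ a))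
    rw [← ConcreteCategory.comp_apply, ← E.obj.map_comp, ← Quiver.Hom.op_unop f, ← op_comp,
      (isTerminalSelf T).hom_ext (f.unop ≫ (isTerminalSelf T).from U.unop)]

/-- The morphism out of a constant sheaf given by a homomorphism to the global sections. -/
def constLift {T : Scheme.{u}} {A : Type u} [AddCommGroup A] (E : EtSh T)
    (φ : A →+ E.obj.obj (op (Scheme.Etale.mk (𝟙 T)))) : constSh T A ⟶ E :=
  ⟨sheafifyLift T.smallEtaleTopology (constPresheafLift E φ) E.property⟩

lemma constLift_constSec {T : Scheme.{u}} {A : Type u} [AddCommGroup A] (E : EtSh T)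
    (φ : A →+ E.obj.obj (op (Scheme.Etale.mk (𝟙 T)))) (U : T.Etale) (a : A) :
    (constLift E φ).hom.app (op U) (constSec T A U a) =
      E.obj.map ((isTerminalSelf T).from U).op (φ a) := by
  have h := toSheafify_sheafifyLift T.smallEtaleTopology (constPresheafLift E φ) E.property
  exact ConcreteCategory.congr_hom (NatTrans.congr_app h (op U)) a

/-- A morphism out of the constant sheaf ℤ amounts to a global section, the image of 1, so lifting
that one section suffices. -/
lemma exists_lift_of_globalSection {T : Scheme.{u}} {E F : EtSh T} (p : E ⟶ F)
    (γ : constSh T (ULift.{u} ℤ) ⟶ F) (s : E.obj.obj (op (Scheme.Etale.mk (𝟙 T))))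
    (hs : p.hom.app _ s = γ.hom.app _ (constSec T (ULift.{u} ℤ) _ ⟨1⟩)) :
    ∃ σ : constSh T (ULift.{u} ℤ) ⟶ E, σ ≫ p = γ := by
  refine ⟨constLift E ((zmultiplesHom _ s).comp AddEquiv.ulift.toAddMonoidHom), ?_⟩
  refine constSh_hom_ext fun U ⟨n⟩ => ?_
  have h1 : constSec T (ULift.{u} ℤ) U ⟨n⟩ = n • constSec T (ULift.{u} ℤ) U ⟨1⟩ := by
    rw [← constSec_zsmul]
    congr 1
    ext; simp
  have h2 : (constLift E ((zmultiplesHom _ s).comp AddEquiv.ulift.toAddMonoidHom)).hom.app (op U)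
      (constSec T (ULift.{u} ℤ) U ⟨1⟩) = E.obj.map ((isTerminalSelf T).from U).op s := by
    rw [constLift_constSec]
    congr 1
    exact one_zsmul s
  rw [h1, map_zsmul, map_zsmul]
  congr 1
  refine (congrArg (p.hom.app (op U)) h2).trans ?_
  rw [app_map_elt, hs, ← app_map_elt, constSec_map]

instance : (constantSheaf T.smallEtaleTopology AddCommGrpCat.{u}).Additive where
  map_add {_ _ f g} := constMap_add T f.hom g.hom

/-- The constant sheaf functor is exact: sheafification keeps it left exact, and it is a left
adjoint. -/
lemma constSC_shortExact {A B C : Type u} [AddCommGroup A] [AddCommGroup B] [AddCommGroup C]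
    (i : A →+ B) (p : B →+ C) (hi : Function.Injective i) (hp : Function.Surjective p)
    (h : Function.Exact i p) : (constSC (T := T) i p h).ShortExact := by
  have : PreservesFiniteLimits (constantSheaf T.smallEtaleTopology AddCommGrpCat.{u}) := by
    unfold constantSheaf
    infer_instance
  have : (constantSheaf T.smallEtaleTopology AddCommGrpCat.{u}).IsLeftAdjoint :=
    (constantSheafAdj T.smallEtaleTopology AddCommGrpCat.{u} (isTerminalSelf T)).isLeftAdjoint
  have hS : (ShortComplex.mk (AddCommGrpCat.ofHom i) (AddCommGrpCat.ofHom p)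
      (AddCommGrpCat.hom_ext h.addMonoidHom_comp_eq_zero)).ShortExact :=
    ShortComplex.ShortExact.mk' ((ShortComplex.ab_exact_iff _).2 fun x hx => (h x).1 hx)
      ((AddCommGrpCat.mono_iff_injective _).2 hi) ((AddCommGrpCat.epi_iff_surjective _).2 hp)
  exact hS.map_of_exact (constantSheaf T.smallEtaleTopology AddCommGrpCat.{u})

/-- In the long exact Ext sequence the connecting map H⁰(C) → H¹(A) vanishes because H⁰(B) → H⁰(C)
is surjective. -/
lemma leftExactOnGroups_H1 : LeftExactOnGroups
    (constantSheaf T.smallEtaleTopology AddCommGrpCat.{u} ⋙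
      Sheaf.functorH T.smallEtaleTopology 1) := by
  intro A B C _ _ _ i p hi hp h
  have hS := constSC_shortExact T i p hi hp h
  constructor
  · refine (injective_iff_map_eq_zero ((constantSheaf T.smallEtaleTopology AddCommGrpCat.{u} ⋙
      Sheaf.functorH T.smallEtaleTopology 1).map (AddCommGrpCat.ofHom i)).hom).2 fun x hx => ?_
    obtain ⟨y, rfl⟩ := Ext.covariant_sequence_exact₁ _ hS x hx (zero_add 1)
    obtain ⟨γ, rfl⟩ := (Ext.mk₀_bijective _ _).2 y
    obtain ⟨b, hb⟩ := constMap_surjective p hp _ (γ.hom.app _ (constSec T (ULift.{u} ℤ) _ ⟨1⟩))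
    obtain ⟨σ, rfl⟩ := exists_lift_of_globalSection (constMap T p) γ b hb
    -- The class is the boundary of a morphism that factors through the middle sheaf, so it is zero.
    rw [← Ext.mk₀_comp_mk₀_assoc]
    erw [hS.comp_extClass]
    rw [Ext.comp_zero]
    rfl
  · intro x hx
    obtain ⟨y, hy⟩ := Ext.covariant_sequence_exact₂ _ hS x hx
    exact ⟨y, hy⟩

theorem evalHom_bijective (G : Type u) [AddCommGroup G] [AddGroup.FG G] :
    Function.Bijective (evalHom T G) :=
  evalFunctor_bijective (leftExactOnGroups_H1 T) G

/-- Pullback conjugates by the identification of f^*A with the constant sheaf A, which is natural in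
A and hence compatible with evaluation. -/
lemma evalHom_naturality {S T : Scheme.{u}} (f : S ⟶ T) (G : Type u) [AddCommGroup G]
    (x : H1 T (Dual G)) (g : G) :
    evalHom S G (H1pull f (Dual G) x) g = H1pull f QZ.{u} (evalHom T G x g) := by
  change (H1pull f (Dual G) x).comp (Ext.mk₀ (constMap S (evalAt g))) (add_zero 1) =
    H1pull f QZ.{u} (x.comp (Ext.mk₀ (constMap T (evalAt g))) (add_zero 1))
  have h := (constPullIso f).hom.naturality (AddCommGrpCat.ofHom (evalAt g))
  simp only [H1pull, Ext.mapExactFunctor_comp, Ext.mapExactFunctor_mk₀]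
  rw [Ext.comp_assoc_of_third_deg_zero, Ext.comp_assoc_of_third_deg_zero,
    Ext.comp_assoc_of_third_deg_zero, Ext.mk₀_comp_mk₀, Ext.mk₀_comp_mk₀]
  congr 3
  exact h.symm

lemma evalHom_dualMap (T : Scheme.{u}) (G G' : Type u) [AddCommGroup G] [AddCommGroup G']
    (φ : G →+ G') (x : H1 T (Dual G')) :
    evalHom T G (Sheaf.H.map (constMap T (dualMap φ)) 1 x) = (evalHom T G' x).comp φ :=
  evalFunctor_dualMap (constantSheaf T.smallEtaleTopology AddCommGrpCat.{u} ⋙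
      Sheaf.functorH T.smallEtaleTopology 1) φ x

end CohomologyOfConstant

/-! ### Exactness of the first right derived functor at its first two terms -/

section DerivedExact
variable {C D : Type*} [Category* C] [Category* D] [Abelian C] [Abelian D]
  (F : C ⥤ D) [F.Additive] [PreservesFiniteLimits F]

lemma exists_lift_map {X₁ X₂ X₃ : C} {f : X₁ ⟶ X₂} {g : X₂ ⟶ X₃} {w : f ≫ g = 0}
    (hS : (ShortComplex.mk f g w).Exact) [Mono f] {X : D} (z : X ⟶ F.obj X₂)
    (hz : z ≫ F.map g = 0) : ∃ y, y ≫ F.map f = z := by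
  have h := hS.map_of_mono_of_preservesKernel F ‹_› inferInstance
  have : Mono ((ShortComplex.mk f g w).map F).f := inferInstanceAs (Mono (F.map f))
  exact ⟨h.lift z hz, h.lift_f z hz⟩

lemma mono_cokernel_desc_of_exact {X₁ X₂ X₃ : C} {f : X₁ ⟶ X₂} {g : X₂ ⟶ X₃} {w : f ≫ g = 0}
    (hS : (ShortComplex.mk f g w).Exact) : Mono (cokernel.desc f g w) :=
  (ShortComplex.exact_iff_mono_cokernel_desc _).1 hS

lemma exact_cokernel_desc {X₁ X₂ X₃ X₄ : C} {f : X₁ ⟶ X₂} {g : X₂ ⟶ X₃} {h : X₃ ⟶ X₄}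
    {w : f ≫ g = 0} {w' : g ≫ h = 0} (hS : (ShortComplex.mk g h w').Exact) :
    (ShortComplex.mk (cokernel.desc f g w) h (by
      rw [← cancel_epi (cokernel.π f), cokernel.π_desc_assoc, w', comp_zero])).Exact := by
  let φ : ShortComplex.mk g h w' ⟶ ShortComplex.mk (cokernel.desc f g w) h (by
      rw [← cancel_epi (cokernel.π f), cokernel.π_desc_assoc, w', comp_zero]) :=
    { τ₁ := cokernel.π f, τ₂ := 𝟙 _, τ₃ := 𝟙 _ }
  have : Epi φ.τ₁ := inferInstanceAs (Epi (cokernel.π f))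
  have : IsIso φ.τ₂ := inferInstanceAs (IsIso (𝟙 _))
  have : Mono φ.τ₃ := inferInstanceAs (Mono (𝟙 _))
  exact (ShortComplex.exact_iff_of_epi_of_isIso_of_mono φ).1 hS

variable {A B E I₀ I₁ I₂ J₀ J₁ J₂ K₀ K₁ : C} {u : A ⟶ B} {v : B ⟶ E} {w : u ≫ v = 0}
  {a : A ⟶ I₀} {dI : I₀ ⟶ I₁} {dI' : I₁ ⟶ I₂} {wa : a ≫ dI = 0} {wI : dI ≫ dI' = 0}
  {b : B ⟶ J₀} {dJ : J₀ ⟶ J₁} {dJ' : J₁ ⟶ J₂} {wb : b ≫ dJ = 0} {wJ : dJ ≫ dJ' = 0}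
  {e : E ⟶ K₀} {dK : K₀ ⟶ K₁} {we : e ≫ dK = 0}
  {f₀ : I₀ ⟶ J₀} {f₁ : I₁ ⟶ J₁} {g₀ : J₀ ⟶ K₀} {g₁ : J₁ ⟶ K₁}

/-- The map `E → J₀ / A` for `E = B / A` and `B → J₀`. -/
lemma exists_quotient_map (hS : (ShortComplex.mk u v w).ShortExact)
    (eb : (ShortComplex.mk b dJ wb).Exact) [Mono b] :
    ∃ (c : E ⟶ cokernel (u ≫ b)) (q' : cokernel (u ≫ b) ⟶ J₁) (wc : c ≫ q' = 0),
      v ≫ c = b ≫ cokernel.π (u ≫ b) ∧ cokernel.π (u ≫ b) ≫ q' = dJ ∧ Mono c ∧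
      (ShortComplex.mk c q' wc).Exact := by
  have := hS.epi_g
  have hub : (u ≫ b) ≫ dJ = 0 := by rw [Category.assoc, wb, comp_zero]
  let c : E ⟶ cokernel (u ≫ b) := hS.exact.desc (b ≫ cokernel.π (u ≫ b)) (by
    dsimp
    rw [← Category.assoc, cokernel.condition])
  have hc : v ≫ c = b ≫ cokernel.π (u ≫ b) := hS.exact.g_desc _ _
  have wc : c ≫ cokernel.desc (u ≫ b) dJ hub = 0 := by
    have : Epi v := hS.epi_g
    rw [← cancel_epi v, ← Category.assoc, hc, Category.assoc, cokernel.π_desc, wb, comp_zero]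
  refine ⟨c, cokernel.desc (u ≫ b) dJ hub, wc, hc, cokernel.π_desc _ _ _, ?_, ?_⟩
  · rw [Preadditive.mono_iff_cancel_zero]
    intro X x hx
    have : Epi v := hS.epi_g
    obtain ⟨X', π, _, x', hx'⟩ := surjective_up_to_refinements_of_epi v x
    have h1 : (x' ≫ b) ≫ cokernel.π (u ≫ b) = 0 := by
      rw [Category.assoc, ← hc, ← Category.assoc, ← hx', Category.assoc, hx, comp_zero]
    have h2 : (ShortComplex.mk _ _ (cokernel.condition (u ≫ b))).Exact :=
      ShortComplex.exact_cokernel (u ≫ b)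
    obtain ⟨X'', π', _, x'', hx''⟩ := h2.exact_up_to_refinements _ h1
    dsimp at hx''
    have h3 : π' ≫ x' = x'' ≫ u := by
      rw [← cancel_mono b, Category.assoc, hx'', Category.assoc]
    rw [← cancel_epi π, ← cancel_epi π', hx', ← Category.assoc, h3, Category.assoc, w]
    simp
  · rw [ShortComplex.exact_iff_exact_up_to_refinements]
    intro X x hx
    dsimp at x hx
    obtain ⟨X', π, _, x', hx'⟩ := surjective_up_to_refinements_of_epi (cokernel.π (u ≫ b)) x
    have h1 : x' ≫ dJ = 0 := by
      rw [← cokernel.π_desc (u ≫ b) dJ hub, ← Category.assoc, ← hx', Category.assoc, hx, comp_zero]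
    have : Mono (ShortComplex.mk b dJ wb).f := ‹Mono b›
    refine ⟨X', π, inferInstance, eb.lift x' h1 ≫ v, ?_⟩
    dsimp
    rw [hx', Category.assoc, hc, ← Category.assoc]
    congr 1
    exact (eb.lift_f x' h1).symm

/-- Injectivity of R¹F(A) → R¹F(B), in terms of cocycles. Besides P = I₀/A, the quotient J₀/A also
computes R¹F(A), and the two are compared by maps f' and k' that are inverse up to maps through I₀.
If x becomes the boundary of y in J₁, then f' of its lift to F(P) differs from the class of y by an
element of F(E), with E = B/A. That element lifts locally to F(B) since F(v) is an epimorphism;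
correcting y and applying k' exhibits x as a boundary. -/
lemma exists_boundary_of_mono (hS : (ShortComplex.mk u v w).ShortExact)
    (ea : (ShortComplex.mk a dI wa).Exact) (eI : (ShortComplex.mk dI dI' wI).Exact)
    (eb : (ShortComplex.mk b dJ wb).Exact) [Mono b] [Injective I₀]
    (h₀ : a ≫ f₀ = u ≫ b) (h₁ : f₀ ≫ dJ = dI ≫ f₁) [Epi (F.map v)]
    {X : D} (x : X ⟶ F.obj I₁) (hx : x ≫ F.map dI' = 0) (y : X ⟶ F.obj J₀)
    (hxy : x ≫ F.map f₁ = y ≫ F.map dJ) :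
    ∃ (X' : D) (π : X' ⟶ X) (_ : Epi π) (x₁ : X' ⟶ F.obj I₀), π ≫ x = x₁ ≫ F.map dI := by
  obtain ⟨c, q', wc, hc, hq', _, ec⟩ := exists_quotient_map hS eb
  have : Mono u := hS.mono_f
  let P := cokernel a
  let p : I₀ ⟶ P := cokernel.π a
  let p' : P ⟶ I₁ := cokernel.desc a dI wa
  have hp : p ≫ p' = dI := cokernel.π_desc _ _ _
  have : Mono p' := mono_cokernel_desc_of_exact ea
  let k : J₀ ⟶ I₀ := Injective.factorThru a (u ≫ b)
  have hk : (u ≫ b) ≫ k = a := Injective.comp_factorThru _ _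
  let k' : cokernel (u ≫ b) ⟶ P := cokernel.desc _ (k ≫ p) (by
    rw [← Category.assoc, hk]; exact cokernel.condition a)
  have hk' : cokernel.π (u ≫ b) ≫ k' = k ≫ p := cokernel.π_desc _ _ _
  let f' : P ⟶ cokernel (u ≫ b) := cokernel.desc _ (f₀ ≫ cokernel.π (u ≫ b)) (by
    rw [← Category.assoc, h₀, cokernel.condition])
  have hf' : p ≫ f' = f₀ ≫ cokernel.π (u ≫ b) := cokernel.π_desc _ _ _
  -- The round trip I₀ → J₀ → I₀ is the identity on A, so its difference from the identity factors
  -- through P.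
  let m : P ⟶ I₀ := cokernel.desc _ (f₀ ≫ k - 𝟙 _) (by
    rw [Preadditive.comp_sub, ← Category.assoc, h₀, hk, Category.comp_id, sub_self])
  have hm : p ≫ m = f₀ ≫ k - 𝟙 _ := cokernel.π_desc _ _ _
  have hfk : f' ≫ k' = 𝟙 _ + m ≫ p := by
    rw [← cancel_epi p, ← Category.assoc, hf', Category.assoc, hk', Preadditive.comp_add,
      ← Category.assoc p m p, hm]
    simp
  have hfq : f' ≫ q' = p' ≫ f₁ := by
    rw [← cancel_epi p, ← Category.assoc, hf', Category.assoc, hq', ← Category.assoc, hp, h₁]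
  obtain ⟨z, hz⟩ := exists_lift_map F (exact_cokernel_desc (w := wa) eI) x hx
  change z ≫ F.map p' = x at hz
  obtain ⟨t, ht⟩ := exists_lift_map F ec
    (z ≫ F.map f' - y ≫ F.map (cokernel.π (u ≫ b))) (by
      rw [Preadditive.sub_comp, Category.assoc, Category.assoc, ← F.map_comp, ← F.map_comp, hfq,
        hq', F.map_comp, ← Category.assoc, hz, hxy, sub_self])
  obtain ⟨X', π, _, s, hs⟩ := surjective_up_to_refinements_of_epi (F.map v) t
  have h2 : π ≫ z ≫ F.map f' = (π ≫ y + s ≫ F.map b) ≫ F.map (cokernel.π (u ≫ b)) := by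
    rw [Preadditive.add_comp, Category.assoc s, ← F.map_comp, ← hc, F.map_comp, ← Category.assoc s,
      ← hs, Category.assoc π t, ht]
    simp
  have h3 : π ≫ z = ((π ≫ y + s ≫ F.map b) ≫ F.map k - π ≫ z ≫ F.map m) ≫ F.map p := by
    have h4 := congrArg (· ≫ F.map k') h2
    simp only [Category.assoc, ← F.map_comp, hfk, hk'] at h4
    rw [F.map_add, F.map_id] at h4
    simp only [Preadditive.comp_add, Category.comp_id, F.map_comp] at h4
    rw [Preadditive.sub_comp, Category.assoc _ (F.map k), Category.assoc, Category.assoc, ← h4,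
      add_sub_cancel_right]
  refine ⟨X', π, inferInstance, (π ≫ y + s ≫ F.map b) ≫ F.map k - π ≫ z ≫ F.map m, ?_⟩
  rw [← hp, F.map_comp, ← Category.assoc _ (F.map p), ← h3, Category.assoc, hz]

/-- Exactness of R¹F at B, in terms of cocycles. The fibre of J → K resolves A, so 0 → J₀/A → K₀ ⊞
J₁ → K₁ ⊞ J₂ is exact. The pair (y, z) is a cocycle there and therefore comes from F(J₀/A); the
comparison map k' : J₀/A → I₀/A turns it into a cocycle of I whose image is z up to a boundary. -/
lemma exists_preimage_of_boundary (hS : (ShortComplex.mk u v w).ShortExact)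
    (wa : a ≫ dI = 0) (wI : dI ≫ dI' = 0)
    (eb : (ShortComplex.mk b dJ wb).Exact) (eJ : (ShortComplex.mk dJ dJ' wJ).Exact)
    (ee : (ShortComplex.mk e dK we).Exact) [Mono a] [Mono b] [Mono e] [Injective I₀] [Injective J₀]
    (h₀ : a ≫ f₀ = u ≫ b) (h₁ : f₀ ≫ dJ = dI ≫ f₁)
    (i₀ : b ≫ g₀ = v ≫ e) (i₁ : g₀ ≫ dK = dJ ≫ g₁)
    {X : D} (z : X ⟶ F.obj J₁) (hz : z ≫ F.map dJ' = 0) (y : X ⟶ F.obj K₀)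
    (hzy : z ≫ F.map g₁ = y ≫ F.map dK) :
    ∃ (x : X ⟶ F.obj I₁) (_ : x ≫ F.map dI' = 0) (t : X ⟶ F.obj J₀),
      x ≫ F.map f₁ = z + t ≫ F.map dJ := by
  obtain ⟨c, q', wc, hc, hq', _, ec⟩ := exists_quotient_map hS eb
  have : Mono u := hS.mono_f
  have : Epi v := hS.epi_g
  let P := cokernel a
  let p : I₀ ⟶ P := cokernel.π a
  let p' : P ⟶ I₁ := cokernel.desc a dI wa
  have hp : p ≫ p' = dI := cokernel.π_desc _ _ _
  let k : J₀ ⟶ I₀ := Injective.factorThru a (u ≫ b)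
  have hk : (u ≫ b) ≫ k = a := Injective.comp_factorThru _ _
  let k' : cokernel (u ≫ b) ⟶ P := cokernel.desc _ (k ≫ p) (by
    rw [← Category.assoc, hk]; exact cokernel.condition a)
  have hk' : cokernel.π (u ≫ b) ≫ k' = k ≫ p := cokernel.π_desc _ _ _
  let f' : P ⟶ cokernel (u ≫ b) := cokernel.desc _ (f₀ ≫ cokernel.π (u ≫ b)) (by
    rw [← Category.assoc, h₀, cokernel.condition])
  have hf' : p ≫ f' = f₀ ≫ cokernel.π (u ≫ b) := cokernel.π_desc _ _ _
  have hfq : f' ≫ q' = p' ≫ f₁ := by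
    rw [← cancel_epi p, ← Category.assoc, hf', Category.assoc, hq', ← Category.assoc, hp, h₁]
  let n : cokernel (u ≫ b) ⟶ J₀ := cokernel.desc _ (k ≫ f₀ - 𝟙 _) (by
    rw [Preadditive.comp_sub, ← Category.assoc, hk, h₀, Category.comp_id, sub_self])
  have hn : cokernel.π (u ≫ b) ≫ n = k ≫ f₀ - 𝟙 _ := cokernel.π_desc _ _ _
  have hkf : k' ≫ f' = 𝟙 _ + n ≫ cokernel.π (u ≫ b) := by
    rw [← cancel_epi (cokernel.π (u ≫ b)), ← Category.assoc, hk', Category.assoc, hf',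
      Preadditive.comp_add, ← Category.assoc _ n, hn]
    simp
  let g' : cokernel (u ≫ b) ⟶ K₀ := cokernel.desc _ g₀ (by
    rw [Category.assoc, i₀, ← Category.assoc, w, zero_comp])
  have hg' : cokernel.π (u ≫ b) ≫ g' = g₀ := cokernel.π_desc _ _ _
  have hcg : c ≫ g' = e := by
    rw [← cancel_epi v, ← Category.assoc, hc, Category.assoc, hg', i₀]
  have hgd : g' ≫ dK = q' ≫ g₁ := by
    rw [← cancel_epi (cokernel.π (u ≫ b)), ← Category.assoc, hg', i₁, ← hq', Category.assoc]
  have hqd : q' ≫ dJ' = 0 := by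
    rw [← cancel_epi (cokernel.π (u ≫ b)), ← Category.assoc, hq', wJ, comp_zero]
  -- These are the first two maps of the fibre of J → K, after dividing J₀ by A.
  let α : cokernel (u ≫ b) ⟶ K₀ ⊞ J₁ := biprod.lift g' q'
  let β : K₀ ⊞ J₁ ⟶ K₁ ⊞ J₂ := biprod.lift (biprod.fst ≫ dK - biprod.snd ≫ g₁) (biprod.snd ≫ dJ')
  have wαβ : α ≫ β = 0 := by
    ext <;> simp [α, β, hgd, hqd]
  have : Mono α := by
    rw [Preadditive.mono_iff_cancel_zero]
    intro X x hx
    have h1 : x ≫ g' = 0 := by simpa [α] using congrArg (· ≫ biprod.fst) hx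
    have h2 : x ≫ q' = 0 := by simpa [α] using congrArg (· ≫ biprod.snd) hx
    have : Mono (ShortComplex.mk c q' wc).f := ‹Mono c›
    have h3 : ec.lift x h2 ≫ c = x := ec.lift_f x h2
    have h4 : ec.lift x h2 = 0 := by
      rw [← cancel_mono e, ← hcg, ← Category.assoc, h3, h1, zero_comp]
    rw [← h3, h4, zero_comp]
  have hαβ : (ShortComplex.mk α β wαβ).Exact := by
    rw [ShortComplex.exact_iff_exact_up_to_refinements]
    intro X x hx
    dsimp at x hx
    have h1 : (x ≫ biprod.fst) ≫ dK = (x ≫ biprod.snd) ≫ g₁ := by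
      have := congrArg (· ≫ biprod.fst) hx
      simpa [β, sub_eq_zero] using this
    have h2 : (x ≫ biprod.snd) ≫ dJ' = 0 := by
      have := congrArg (· ≫ biprod.snd) hx
      simpa [β] using this
    obtain ⟨X', π, _, j, hj⟩ := eJ.exact_up_to_refinements _ h2
    dsimp at hj
    have : Mono (ShortComplex.mk e dK we).f := ‹Mono e›
    have h3 : (π ≫ x ≫ biprod.fst - j ≫ g₀) ≫ dK = 0 := by
      rw [Preadditive.sub_comp, Category.assoc, h1, Category.assoc j, i₁, ← Category.assoc, hj]
      simp
    have h4 : ee.lift _ h3 ≫ e = π ≫ x ≫ biprod.fst - j ≫ g₀ := ee.lift_f _ h3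
    refine ⟨X', π, inferInstance, j ≫ cokernel.π (u ≫ b) + ee.lift _ h3 ≫ c, ?_⟩
    dsimp
    ext
    · simp only [α, Category.assoc, biprod.lift_fst, Preadditive.add_comp, hg', hcg, h4]
      simp
    · simp only [α, Category.assoc, biprod.lift_snd, Preadditive.add_comp, hq', wc, comp_zero,
        add_zero, hj]
  obtain ⟨x, hx⟩ := exists_lift_map F hαβ (y ≫ F.map biprod.inl + z ≫ F.map biprod.inr) (by
    rw [Preadditive.add_comp, Category.assoc, Category.assoc, ← F.map_comp, ← F.map_comp]
    have h1 : biprod.inl ≫ β = dK ≫ biprod.inl := by ext <;> simp [β]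
    have h2 : biprod.inr ≫ β = - g₁ ≫ biprod.inl + dJ' ≫ biprod.inr := by ext <;> simp [β]
    rw [h1, h2, F.map_add, F.map_neg]
    simp only [F.map_comp, Preadditive.comp_add, Preadditive.comp_neg]
    rw [← Category.assoc, ← Category.assoc, ← Category.assoc, hz, hzy]
    simp)
  have hxq : x ≫ F.map q' = z := by
    have := congrArg (· ≫ F.map biprod.snd) hx
    simp only [Category.assoc, Preadditive.add_comp, ← F.map_comp, biprod.inl_snd,
      biprod.inr_snd, F.map_id, F.map_zero, comp_zero, zero_add, Category.comp_id] at this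
    rwa [show α ≫ biprod.snd = q' from biprod.lift_snd _ _] at this
  refine ⟨x ≫ F.map (k' ≫ p'), ?_, x ≫ F.map n, ?_⟩
  · rw [Category.assoc, ← F.map_comp]
    have : (k' ≫ p') ≫ dI' = 0 := by
      rw [← cancel_epi (cokernel.π (u ≫ b)), ← Category.assoc, ← Category.assoc, hk',
        Category.assoc k, hp, Category.assoc, wI, comp_zero, comp_zero]
    rw [this, F.map_zero, comp_zero]
  · rw [Category.assoc, ← F.map_comp, Category.assoc, ← hfq, ← Category.assoc k', hkf,
      Preadditive.add_comp, Category.id_comp, F.map_add, Preadditive.comp_add, hxq,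
      Category.assoc n, hq', F.map_comp, Category.assoc]

instance rightDerived_additive [HasInjectiveResolutions C] (G : C ⥤ D) [G.Additive] (n : ℕ) :
    (G.rightDerived n).Additive where
  map_add {X Y f g} := by
    let P := injectiveResolution X
    let Q := injectiveResolution Y
    rw [G.rightDerived_map_eq n f _ (InjectiveResolution.desc_commutes f Q P),
      G.rightDerived_map_eq n g _ (InjectiveResolution.desc_commutes g Q P),
      G.rightDerived_map_eq n (f + g)
        (InjectiveResolution.desc f Q P + InjectiveResolution.desc g Q P) (by
          rw [Preadditive.comp_add, InjectiveResolution.desc_commutes,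
            InjectiveResolution.desc_commutes, Functor.map_add, Preadditive.add_comp]),
      Functor.map_add, Preadditive.add_comp, Preadditive.comp_add]

section
variable [HasInjectiveResolutions C] (S : ShortComplex C) (hS : S.ShortExact)

-- `exists_boundary_of_mono` applied to the chosen injective resolutions.
include hS in
lemma mono_rightDerived_one_map [Epi (F.map S.g)] : Mono ((F.rightDerived 1).map S.f) := by
  let I := injectiveResolution S.X₁
  let J := injectiveResolution S.X₂
  let φ := InjectiveResolution.desc S.f J I
  rw [F.rightDerived_map_eq 1 S.f φ (InjectiveResolution.desc_commutes _ _ _)]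
  have : Mono (HomologicalComplex.homologyMap ((F.mapHomologicalComplex _).map φ) 1) := by
    rw [HomologicalComplex.mono_homologyMap_iff_up_to_refinements _ 0 1 2 (by simp) (by simp)]
    intro X x hx y hxy
    have hJ : @Mono C _ S.X₂ (J.cocomplex.X 0) (J.ι.f 0) := inferInstanceAs (Mono (J.ι.f 0))
    exact exists_boundary_of_mono F (w := S.zero) hS I.exact₀ (I.exact_succ 0) J.exact₀
      (InjectiveResolution.desc_commutes_zero S.f J I) (φ.comm 0 1) x hx y hxy
  have : Mono ((F.mapHomologicalComplex _ ⋙ HomologicalComplex.homologyFunctor _ _ 1).map φ) :=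
    this
  infer_instance

-- A class killed in R¹F of the quotient is represented, after a refinement, by a cocycle whose
-- image is a boundary, so that `exists_preimage_of_boundary` applies.
include hS in
lemma exists_preimage_rightDerived_one_map {X : D} (x : X ⟶ (F.rightDerived 1).obj S.X₂)
    (hx : x ≫ (F.rightDerived 1).map S.g = 0) :
    ∃ (X' : D) (π : X' ⟶ X) (_ : Epi π) (y : X' ⟶ (F.rightDerived 1).obj S.X₁),
      π ≫ x = y ≫ (F.rightDerived 1).map S.f := by
  let I := injectiveResolution S.X₁
  let J := injectiveResolution S.X₂
  let K := injectiveResolution S.X₃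
  let φ := InjectiveResolution.desc S.f J I
  let ψ := InjectiveResolution.desc S.g K J
  have hI : @Mono C _ S.X₁ (I.cocomplex.X 0) (I.ι.f 0) := inferInstanceAs (Mono (I.ι.f 0))
  have hJ : @Mono C _ S.X₂ (J.cocomplex.X 0) (J.ι.f 0) := inferInstanceAs (Mono (J.ι.f 0))
  have hK : @Mono C _ S.X₃ (K.cocomplex.X 0) (K.ι.f 0) := inferInstanceAs (Mono (K.ι.f 0))
  let FJ := (F.mapHomologicalComplex (ComplexShape.up ℕ)).obj J.cocomplex
  let FK := (F.mapHomologicalComplex (ComplexShape.up ℕ)).obj K.cocomplex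
  let FI := (F.mapHomologicalComplex (ComplexShape.up ℕ)).obj I.cocomplex
  let Fφ : FI ⟶ FJ := (F.mapHomologicalComplex (ComplexShape.up ℕ)).map φ
  let Fψ : FJ ⟶ FK := (F.mapHomologicalComplex (ComplexShape.up ℕ)).map ψ
  let eI : (F.rightDerived 1).obj S.X₁ ≅ FI.homology 1 := I.isoRightDerivedObj F 1
  let eJ : (F.rightDerived 1).obj S.X₂ ≅ FJ.homology 1 := J.isoRightDerivedObj F 1
  let eK : (F.rightDerived 1).obj S.X₃ ≅ FK.homology 1 := K.isoRightDerivedObj F 1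
  have hf : (F.rightDerived 1).map S.f ≫ eJ.hom = eI.hom ≫ HomologicalComplex.homologyMap Fφ 1 :=
    I.isoRightDerivedObj_hom_naturality S.f J φ
      (InjectiveResolution.desc_commutes_zero S.f J I) F 1
  have hg : (F.rightDerived 1).map S.g ≫ eK.hom = eJ.hom ≫ HomologicalComplex.homologyMap Fψ 1 :=
    J.isoRightDerivedObj_hom_naturality S.g K ψ
      (InjectiveResolution.desc_commutes_zero S.g K J) F 1
  obtain ⟨X', π, _, z, hz, hxz⟩ := FJ.eq_liftCycles_homologyπ_up_to_refinements
    (x ≫ eJ.hom) 2 (by simp)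
  have h1 : (π ≫ x ≫ eJ.hom) ≫ HomologicalComplex.homologyMap Fψ 1 = 0 := by
    rw [Category.assoc, Category.assoc, ← hg, reassoc_of% hx, zero_comp, comp_zero]
  rw [hxz, Category.assoc, HomologicalComplex.homologyπ_naturality, ← Category.assoc,
    HomologicalComplex.liftCycles_comp_cyclesMap] at h1
  rw [FK.liftCycles_comp_homologyπ_eq_zero_iff_up_to_refinements 0 1 2 (by simp) (by simp)] at h1
  obtain ⟨X'', π', _, y, hy⟩ := h1
  obtain ⟨x₁, hx₁, t, ht⟩ : ∃ (x₁ : X'' ⟶ FI.X 1) (_ : x₁ ≫ FI.d 1 2 = 0) (t : X'' ⟶ FJ.X 0),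
      x₁ ≫ Fφ.f 1 = π' ≫ z + t ≫ FJ.d 0 1 := exists_preimage_of_boundary F (w := S.zero) (dI' := I.cocomplex.d 1 2)
    hS I.ι_f_zero_comp_complex_d (I.cocomplex.d_comp_d 0 1 2) J.exact₀ (J.exact_succ 0) K.exact₀
    (InjectiveResolution.desc_commutes_zero S.f J I) (φ.comm 0 1)
    (InjectiveResolution.desc_commutes_zero S.g K J) (ψ.comm 0 1) (π' ≫ z)
    (((Category.assoc π' z (FJ.d 1 2)).trans (congrArg (π' ≫ ·) hz)).trans comp_zero) y
    ((Category.assoc π' z (Fψ.f 1)).trans hy)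
  have h2 : FI.liftCycles x₁ 2 (by simp) hx₁ ≫ FI.homologyπ 1 ≫
      HomologicalComplex.homologyMap Fφ 1 = π' ≫ π ≫ x ≫ eJ.hom := by
    rw [hxz, HomologicalComplex.homologyπ_naturality, ← Category.assoc,
      HomologicalComplex.liftCycles_comp_cyclesMap, ← Category.assoc,
      HomologicalComplex.comp_liftCycles]
    rw [FJ.liftCycles_comp_homologyπ_eq_iff_up_to_refinements 0 1 2 (by simp) (by simp)]
    exact ⟨_, 𝟙 _, inferInstance, t, by rw [Category.id_comp, Category.id_comp]; exact ht⟩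
  refine ⟨X'', π' ≫ π, inferInstance, FI.liftCycles x₁ 2 (by simp) hx₁ ≫ FI.homologyπ 1 ≫
    eI.inv, ?_⟩
  rw [← cancel_mono eJ.hom]
  simp only [Category.assoc, hf, Iso.inv_hom_id_assoc]
  exact h2.symm

include hS in
lemma exact_rightDerived_one_map : (S.map (F.rightDerived 1)).Exact := by
  rw [ShortComplex.exact_iff_exact_up_to_refinements]
  exact fun _ x hx => exists_preimage_rightDerived_one_map F S hS x hx

end
end DerivedExact

/-! ### Left exactness of the first higher direct image on groups -/

section HigherDirectImage
variable {S T : Scheme.{u}} (f : S ⟶ T)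

/-- Sections of étale sheaves over `U`. -/
abbrev sectionsFunctor (U : T.Etale) : EtSh T ⥤ AddCommGrpCat.{u} :=
  sheafToPresheaf T.smallEtaleTopology AddCommGrpCat.{u} ⋙ (evaluation _ _).obj (op U)

lemma epi_of_app_surjective {E F : EtSh T} (φ : E ⟶ F)
    (h : ∀ U : T.Etale, Function.Surjective (φ.hom.app (op U))) : Epi φ := by
  rw [← Sheaf.isLocallySurjective_iff_epi']
  exact ⟨fun {U} s => by
    obtain ⟨t, ht⟩ := h U s
    exact T.smallEtaleTopology.superset_covering
      (fun V f _ => ⟨E.obj.map f.op t, (app_map_elt φ f t).trans (by rw [ht])⟩)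
      (GrothendieckTopology.top_mem _ _)⟩

instance : (R1 f).Additive := by
  unfold R1
  infer_instance

/-- Pushforward keeps the surjection on sections of constant sheaves, so R¹f_* starts with a
monomorphism and is exact in the middle; taking sections over U is left exact and preserves both. -/
lemma leftExactOnGroups_R1 (U : T.Etale) : LeftExactOnGroups
    (constantSheaf S.smallEtaleTopology AddCommGrpCat.{u} ⋙ R1 f ⋙ sectionsFunctor U) := by
  intro A B C _ _ _ i p hi hp h
  have hS := constSC_shortExact S i p hi hp h
  have : Epi ((pushforward f).map (constSC (T := S) i p h).g) :=
    epi_of_app_surjective _ fun V => constMap_surjective p hp ((bc f).obj V)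
  have : Mono ((R1 f).map (constSC (T := S) i p h).f) :=
    mono_rightDerived_one_map (pushforward f) _ hS
  have hex : ((constSC (T := S) i p h).map (R1 f)).Exact :=
    exact_rightDerived_one_map (pushforward f) _ hS
  have : Mono ((constSC (T := S) i p h).map (R1 f)).f := this
  have hex' := hex.map_of_mono_of_preservesKernel (sectionsFunctor U) this inferInstance
  constructor
  · exact (AddCommGrpCat.mono_iff_injective _).1
      (inferInstanceAs (Mono ((sectionsFunctor U).map ((R1 f).map (constSC (T := S) i p h).f))))
  · intro x hx
    exact (ShortComplex.ab_exact_iff _).1 hex' x hx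

end HigherDirectImage

/-! ### Homomorphisms out of a constant sheaf -/

section InternalHom
variable {T : Scheme.{u}} {G : Type u} [AddCommGroup G] {H : EtSh T}

lemma applySection_map {F : EtSh T} {U V W : T.Etale} (α : (internalHom F H).obj.obj (op U))
    (p : V ⟶ U) (k : W ⟶ V) (t : F.obj.obj (op V)) :
    applySection α (k ≫ p) (F.obj.map k.op t) = H.obj.map k.op (applySection α p t) :=
  ConcreteCategory.congr_hom ((homOfSection α).naturality
    (Over.homMk k : Over.mk (k ≫ p) ⟶ Over.mk p).op) t

lemma internalHom_const_ext {U : T.Etale} {α β : (internalHom (constSh T G) H).obj.obj (op U)}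
    (h : ∀ (V : T.Etale) (p : V ⟶ U) (g : G), applySection α p (constSec T G V g) =
      applySection β p (constSec T G V g)) : α = β := by
  have key : ∀ (V : T.Etale) (p : V ⟶ U) (t : (constSh T G).obj.obj (op V)),
      applySection α p t = applySection β p t := by
    intro V p t
    obtain ⟨R, hR, ht⟩ := exists_constSec_local t
    refine sheaf_ext H hR fun W k hk => ?_
    obtain ⟨g, hg⟩ := ht k hk
    rw [← applySection_map, ← applySection_map, hg, h]
  change homOfSection α = homOfSection β
  ext X t
  exact key _ X.unop.hom t

/-- A homomorphism from `G` to the sections of a sheaf over `U` extends to the constant sheaf. -/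
lemma exists_internalHom_const {U : T.Etale} (φ : G →+ H.obj.obj (op U)) :
    ∃ α : (internalHom (constSh T G) H).obj.obj (op U), ∀ (V : T.Etale) (p : V ⟶ U) (g : G),
      applySection α p (constSec T G V g) = H.obj.map p.op (φ g) := by
  -- The predicate says that x is the value at t: wherever t becomes the constant section g, x
  -- becomes φ g. It determines x and holds for constant sections, so values exist by gluing.
  let q (V : T.Etale) (p : V ⟶ U) (t : (constSh T G).obj.obj (op V))
      (x : H.obj.obj (op V)) : Prop :=
    ∀ (W : T.Etale) (k : W ⟶ V) (g : G), (constSh T G).obj.map k.op t = constSec T G W g →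
      H.obj.map k.op x = H.obj.map (k ≫ p).op (φ g)
  have quniq : ∀ V p t x y, q V p t x → q V p t y → x = y := by
    intro V p t x y hx hy
    obtain ⟨R, hR, ht⟩ := exists_constSec_local t
    refine sheaf_ext H hR fun W k hk => ?_
    obtain ⟨g, hg⟩ := ht k hk
    rw [hx W k g hg, hy W k g hg]
  have qconst : ∀ V p g, q V p (constSec T G V g) (H.obj.map p.op (φ g)) := by
    intro V p g W k g' h
    rw [constSec_map] at h
    obtain ⟨R, hR, hg⟩ := constSec_eq_local h
    refine sheaf_ext H hR fun W' l hl => ?_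
    rw [hg l hl, map_comp_elt]
  have qstable : ∀ V p t x (V' : T.Etale) (l : V' ⟶ V), q V p t x →
      q V' (l ≫ p) ((constSh T G).obj.map l.op t) (H.obj.map l.op x) := by
    intro V p t x V' l h W k g hg
    rw [← map_comp_elt, h W (k ≫ l) g (by rw [map_comp_elt, hg]), Category.assoc]
  have qex : ∀ V p t, ∃ x, q V p t x := by
    intro V p t
    obtain ⟨R, hR, ht⟩ := exists_constSec_local t
    obtain ⟨x, hx⟩ := sheaf_glue H hR (fun V' l x => q V' (l ≫ p) ((constSh T G).obj.map l.op t) x)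
      (fun V' V'' l k x h => by
        have := qstable _ _ _ _ _ k h
        rwa [← map_comp_elt, ← Category.assoc] at this)
      (fun V' l _ x y => quniq _ _ _ x y)
      (fun V' l hl => by
        obtain ⟨g, hg⟩ := ht l hl
        rw [hg]
        exact ⟨_, qconst _ _ g⟩)
    refine ⟨x, fun W k g hg => ?_⟩
    refine sheaf_ext H (T.smallEtaleTopology.pullback_stable k hR) fun W' l hl => ?_
    have := hx (l ≫ k) hl W' (𝟙 _) g (by
      rw [map_id_elt, map_comp_elt, hg, constSec_map])
    rw [map_id_elt, Category.id_comp] at this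
    rw [← map_comp_elt, this, ← map_comp_elt, Category.assoc]
  choose x hx using qex
  have hadd : ∀ V p t t', x V p (t + t') = x V p t + x V p t' := by
    intro V p t t'
    obtain ⟨R, hR, ht⟩ := exists_constSec_local t
    obtain ⟨R', hR', ht'⟩ := exists_constSec_local t'
    refine sheaf_ext H (T.smallEtaleTopology.intersection_covering hR hR') fun W k hk => ?_
    obtain ⟨g, hg⟩ := ht k hk.1
    obtain ⟨g', hg'⟩ := ht' k hk.2
    rw [map_add, hx V p t W k g hg, hx V p t' W k g' hg',
      hx V p (t + t') W k (g + g') (by rw [map_add, hg, hg', constSec_add]), map_add, map_add]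
  let α : (Over.forget U).op ⋙ (constSh T G).obj ⟶ (Over.forget U).op ⋙ H.obj :=
    { app X := AddCommGrpCat.ofHom (AddMonoidHom.mk' (x X.unop.left X.unop.hom) (hadd _ _))
      naturality X Y k := by
        ext t
        refine quniq _ Y.unop.hom _ _ _ (hx _ _ _) ?_
        have := qstable _ _ _ _ _ k.unop.left (hx X.unop.left X.unop.hom t)
        rw [Over.w] at this
        exact this }
  exact ⟨α, fun V p g => quniq V p _ _ _ (hx _ _ _) (qconst _ _ _)⟩

end InternalHom

/-! ### The isomorphism of sheaves -/

section HomSheaf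
variable {S T : Scheme.{u}} (f : S ⟶ T)

variable (G : Type u) [AddCommGroup G]

/-- The sheaf homomorphism defined by a section of `R¹f_*(G^∨)` and evaluation. -/
def evalSection {U : T.Etale} (s : ((R1 f).obj (constSh S (Dual G))).obj.obj (op U)) :
    (internalHom (constSh T G) ((R1 f).obj (constSh S QZ.{u}))).obj.obj (op U) :=
  (exists_internalHom_const (evalFunctor (constantSheaf S.smallEtaleTopology AddCommGrpCat.{u} ⋙
    R1 f ⋙ sectionsFunctor U) G s)).choose

lemma applySection_evalSection {U V : T.Etale} (p : V ⟶ U)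
    (s : ((R1 f).obj (constSh S (Dual G))).obj.obj (op U)) (g : G) :
    applySection (evalSection f G s) p (constSec T G V g) =
      ((R1 f).map (constMap S (evalAt g))).hom.app (op V)
        (((R1 f).obj (constSh S (Dual G))).obj.map p.op s) := by
  refine ((exists_internalHom_const (evalFunctor (constantSheaf S.smallEtaleTopology
    AddCommGrpCat.{u} ⋙ R1 f ⋙ sectionsFunctor U) G s)).choose_spec V p g).trans ?_
  exact (app_map_elt ((R1 f).map (constMap S (evalAt g))) p s).symm

lemma applySection_add {F H : EtSh T} {U V : T.Etale} (α β : (internalHom F H).obj.obj (op U))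
    (p : V ⟶ U) (t : F.obj.obj (op V)) :
    applySection (α + β) p t = applySection α p t + applySection β p t := rfl

lemma applySection_restrict {F H : EtSh T} {U V W : T.Etale}
    (α : (internalHom F H).obj.obj (op U)) (l : V ⟶ U)
    (p : W ⟶ V) (t : F.obj.obj (op W)) :
    applySection ((internalHom F H).obj.map l.op α) p t = applySection α (p ≫ l) t := rfl

lemma evalSection_add {U : T.Etale} (s s' : ((R1 f).obj (constSh S (Dual G))).obj.obj (op U)) :
    evalSection f G (s + s') = evalSection f G s + evalSection f G s' :=
  internalHom_const_ext fun V p g => by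
    rw [applySection_add, applySection_evalSection, applySection_evalSection,
      applySection_evalSection, map_add, map_add]

/-- The canonical map `R¹f_*(G^∨) → ℋom(G, R¹f_*(ℚ/ℤ))`. -/
def evalSheafHom : ulift ((R1 f).obj (constSh S (Dual G))) ⟶
    internalHom (constSh T G) ((R1 f).obj (constSh S QZ.{u})) where
  hom :=
    { app U := AddCommGrpCat.ofHom (AddMonoidHom.mk' (fun s => evalSection f G s.down)
        (fun s s' => evalSection_add f G s.down s'.down))
      naturality U U' l := by
        ext s
        refine internalHom_const_ext fun V p g => ?_
        refine (applySection_evalSection f G p _ g).trans ?_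
        refine Eq.trans ?_ (applySection_restrict (evalSection f G s.down) l.unop p _).symm
        rw [applySection_evalSection, map_comp_elt]
        rfl }

/-- A section over U of the internal Hom out of a constant sheaf is determined by its values on
constant sections over U itself, so the abstract evaluation theorem for sections over U suffices. -/
lemma evalSection_bijective [AddGroup.FG G] (U : T.Etale) :
    Function.Bijective (evalSection f G (U := U)) := by
  have hb := evalFunctor_bijective (leftExactOnGroups_R1 f U) G
  constructor
  · intro s s' h
    apply hb.1
    ext g
    have := congrArg (fun α => applySection α (𝟙 U) (constSec T G U g)) h
    simp only [applySection_evalSection, map_id_elt] at this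
    exact this
  · intro α
    obtain ⟨s, hs⟩ := hb.2 (AddMonoidHom.mk' (fun g => applySection α (𝟙 U) (constSec T G U g))
      (fun g g' => by rw [constSec_add]; exact map_add ((homOfSection α).app _).hom _ _))
    refine ⟨s, internalHom_const_ext fun V p g => ?_⟩
    rw [applySection_evalSection, app_map_elt]
    have := DFunLike.congr_fun hs g
    refine (congrArg _ this).trans ?_
    refine (applySection_map α (𝟙 U) p _).symm.trans ?_
    rw [constSec_map, Category.comp_id]

instance [AddGroup.FG G] : IsIso (evalSheafHom f G) := by
  have : IsIso ((sheafToPresheaf _ _).map (evalSheafHom f G)) := by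
    have (U : T.Etaleᵒᵖ) : IsIso (((sheafToPresheaf _ _).map (evalSheafHom f G)).app U) :=
      (ConcreteCategory.isIso_iff_bijective _).2
        ((evalSection_bijective f G U.unop).comp Equiv.ulift.bijective)
    exact NatIso.isIso_of_isIso_app _
  exact isIso_of_reflects_iso _ (sheafToPresheaf _ _)

theorem exists_evalSheafIso {S T : Scheme.{u}} (f : S ⟶ T) :
    ∃ e : ∀ (G : Type u) [AddCommGroup G] [AddGroup.FG G],
          ulift ((R1 f).obj (constSh S (Dual G))) ≅
            internalHom (constSh T G) ((R1 f).obj (constSh S QZ.{u})),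
        (∀ (G : Type u) [AddCommGroup G] [AddGroup.FG G] (U V : T.Etale) (p : V ⟶ U)
          (s : ((R1 f).obj (constSh S (Dual G))).obj.obj (op U)) (g : G),
          applySection ((e G).hom.hom.app (op U) (ULift.up s)) p (constSec T G V g) =
            ((R1 f).map (constMap S (evalAt g))).hom.app (op V)
              (((R1 f).obj (constSh S (Dual G))).obj.map p.op s)) ∧
        (∀ (G G' : Type u) [AddCommGroup G] [AddCommGroup G'] [AddGroup.FG G] [AddGroup.FG G']
          (φ : G →+ G') (U V : T.Etale) (p : V ⟶ U)
          (s : ((R1 f).obj (constSh S (Dual G'))).obj.obj (op U))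
          (t : (constSh T G).obj.obj (op V)),
          applySection ((e G).hom.hom.app (op U)
              (ULift.up (((R1 f).map (constMap S (dualMap φ))).hom.app (op U) s))) p t =
            applySection ((e G').hom.hom.app (op U) (ULift.up s)) p
              ((constMap T φ).hom.app (op V) t)) := by
  refine ⟨fun G _ _ => asIso (evalSheafHom f G), fun G _ _ U V p s g =>
    applySection_evalSection f G p s g, ?_⟩
  intro G G' _ _ _ _ φ U V p s t
  change applySection (evalSection f G _) p t = applySection (evalSection f G' s) p _
  obtain ⟨R, hR, ht⟩ := exists_constSec_local t
  refine sheaf_ext _ hR fun W k hk => ?_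
  obtain ⟨g, hg⟩ := ht k hk
  rw [← applySection_map, ← applySection_map, ← app_map_elt, hg, constMap_constSec,
    applySection_evalSection, applySection_evalSection, ← app_map_elt]
  have : constMap S (evalAt (φ g)) = constMap S (dualMap φ) ≫ constMap S (evalAt g) :=
    constMap_comp (dualMap φ) (evalAt g)
  rw [this, Functor.map_comp]
  rfl

end HomSheaf

/-! ### The étale topology is subcanonical -/

instance : Scheme.etaleTopology.{u}.Subcanonical := by
  -- Étale coverings are fppf coverings, and the fppf topology is subcanonical.
  refine .of_le (K := Scheme.fppfTopology) (Precoverage.toGrothendieck_mono ?_)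
  exact Scheme.precoverage_mono (P := @Etale) (Q := @Flat ⊓ @LocallyOfFinitePresentation)
    fun X Y f hf => ⟨inferInstance, inferInstance⟩

lemma coverPreserving_overForget (P : MorphismProperty Scheme.{u}) [P.IsMultiplicative]
    [P.IsStableUnderBaseChange] (T : Scheme.{u}) :
    CoverPreserving (T.smallGrothendieckTopology (P := P) (Q := P))
      ((Scheme.grothendieckTopology P).over T) (MorphismProperty.Over.forget P ⊤ T) :=
  Functor.coverPreserving_restrictedTopology (MorphismProperty.Over.forget P ⊤ T)
    (Scheme.overGrothendieckTopology P T)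

instance (T : Scheme.{u}) : T.smallEtaleTopology.Subcanonical := by
  have : RepresentablyFlat (Scheme.Etale.forget T) := flat_of_preservesFiniteLimits _
  have : (Scheme.Etale.forget T).IsContinuous T.smallEtaleTopology
      (Scheme.etaleTopology.over T) := by
    rw [Functor.isContinuous_iff_coverPreserving]
    exact coverPreserving_overForget @Etale T
  exact GrothendieckTopology.subcanonical_of_full_of_faithful (Scheme.Etale.forget T) _
    (Scheme.etaleTopology.over T)

/-! ### Points, fibre products and locally constant functions on the small étale site -/

section SmallSite
variable {T : Scheme.{u}}

/-- A morphism in the small étale site, from a morphism of schemes over the base. -/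
abbrev etHom {U V : T.Etale} (f : U.left ⟶ V.left) (h : f ≫ V.hom = U.hom) : U ⟶ V :=
  (Scheme.Etale.forgetFullyFaithful T).preimage (Over.homMk f h)

lemma et_hom_ext {U V : T.Etale} {f g : U ⟶ V} (h : f.left = g.left) : f = g :=
  (Scheme.Etale.forgetFullyFaithful T).map_injective (Over.OverMorphism.ext h)

@[simp] lemma et_w {U V : T.Etale} (f : U ⟶ V) : f.left ≫ V.hom = U.hom :=
  Over.w ((Scheme.Etale.forget T).map f)

lemma et_comp_left {U V W : T.Etale} (f : U ⟶ V) (g : V ⟶ W) : (f ≫ g).left = f.left ≫ g.left :=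
  rfl

lemma et_comp_apply {U V W : T.Etale} (f : U ⟶ V) (g : V ⟶ W) (x : U.left) :
    (f ≫ g).left x = g.left (f.left x) := by
  rw [et_comp_left, Scheme.Hom.comp_apply]

lemma mem_smallEtale_iff {U : T.Etale} (R : Sieve U) : R ∈ T.smallEtaleTopology U ↔
    ∀ x : U.left, ∃ (V : T.Etale) (f : V ⟶ U), R f ∧ ∃ y : V.left, f.left y = x := by
  obtain ⟨ι, Z, g, rfl⟩ := R.exists_eq_ofArrows
  rw [Scheme.ofArrows_mem_smallEtaleTopology_iff]
  constructor
  · intro h x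
    obtain ⟨_, ⟨i, rfl⟩, y, hy⟩ : x ∈ ⋃ i, Set.range (g i).left := by rw [h]; trivial
    exact ⟨Z i, g i, Sieve.ofArrows_mk _ _ i, y, hy⟩
  · refine fun h => Set.eq_univ_of_forall fun x => ?_
    obtain ⟨V, f, ⟨W, k, l, ⟨i⟩, rfl⟩, y, rfl⟩ := h x
    exact Set.mem_iUnion.2 ⟨i, k.left y, (et_comp_apply _ _ _).symm⟩

/-- The fibre product of two étale schemes over a third. -/
abbrev etProd {U V W : T.Etale} (f : V ⟶ U) (g : W ⟶ U) : T.Etale :=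
  Scheme.Etale.mk (pullback.fst f.left g.left ≫ V.hom)

abbrev etFst {U V W : T.Etale} (f : V ⟶ U) (g : W ⟶ U) : etProd f g ⟶ V :=
  etHom (pullback.fst f.left g.left) rfl

abbrev etSnd {U V W : T.Etale} (f : V ⟶ U) (g : W ⟶ U) : etProd f g ⟶ W :=
  etHom (pullback.snd f.left g.left) (by
    change _ = pullback.fst f.left g.left ≫ V.hom
    rw [← et_w g, ← et_w f, pullback.condition_assoc]
    rfl)

lemma et_isPullback {U V W : T.Etale} (f : V ⟶ U) (g : W ⟶ U) :
    IsPullback (etFst f g) (etSnd f g) f g := by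
  refine ⟨⟨et_hom_ext pullback.condition⟩, ⟨PullbackCone.IsLimit.mk _
    (fun s => etHom (pullback.lift s.fst.left s.snd.left
      (by rw [← et_comp_left, s.condition, et_comp_left])) ?_) ?_ ?_ ?_⟩⟩
  · change pullback.lift _ _ _ ≫ pullback.fst _ _ ≫ V.hom = _
    rw [pullback.lift_fst_assoc, et_w]
  · intro s
    exact et_hom_ext (pullback.lift_fst _ _ _)
  · intro s
    exact et_hom_ext (pullback.lift_snd _ _ _)
  · intro s m h1 h2
    refine et_hom_ext (pullback.hom_ext (f := f.left) (g := g.left) ?_ ?_)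
    · exact (congrArg (·.left) h1).trans
        (pullback.lift_fst (f := f.left) (g := g.left) _ _ _).symm
    · exact (congrArg (·.left) h2).trans
        (pullback.lift_snd (f := f.left) (g := g.left) _ _ _).symm

lemma exists_etProd_point {U V W : T.Etale} (f : V ⟶ U) (g : W ⟶ U) (x : V.left) (y : W.left)
    (h : f.left x = g.left y) :
    ∃ z : (etProd f g).left, (etFst f g).left z = x ∧ (etSnd f g).left z = y :=
  Scheme.Pullback.exists_preimage_pullback x y h

/-- An open subscheme of an étale scheme. -/
abbrev etOpen (U : T.Etale) (O : U.left.Opens) : T.Etale := Scheme.Etale.mk (O.ι ≫ U.hom)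

abbrev etOpenι (U : T.Etale) (O : U.left.Opens) : etOpen U O ⟶ U := etHom O.ι rfl

lemma isOpen_range_et {U V : T.Etale} (f : V ⟶ U) : IsOpen (Set.range f.left) :=
  f.left.isOpenMap.isOpen_range

section Empty
variable (E : EtSh T)

/-- The empty sieve covers an empty scheme. -/
lemma section_eq_of_isEmpty {W : T.Etale} [IsEmpty W.left] (x y : E.obj.obj (op W)) : x = y :=
  sheaf_ext E (S := ⊥) ((mem_smallEtale_iff _).2 fun x => isEmptyElim x)
    (fun _ _ h => h.elim)

end Empty

lemma locallyConstant_cover {α : Type*} {U : T.Etale} (l : LocallyConstant U.left α) :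
    ∃ S ∈ T.smallEtaleTopology U, ∀ ⦃V : T.Etale⦄ (f : V ⟶ U), S f →
      ∃ a, ∀ y, l (f.left y) = a := by
  refine ⟨⟨fun V f => ∃ a, ∀ y, l (f.left y) = a, ?_⟩, (mem_smallEtale_iff _).2 fun x => ?_,
    fun V f h => h⟩
  · rintro V V' f ⟨a, ha⟩ g
    exact ⟨a, fun y => by rw [et_comp_apply]; exact ha _⟩
  · let O : U.left.Opens := ⟨l ⁻¹' {l x}, l.isLocallyConstant _⟩
    refine ⟨etOpen U O, etOpenι U O, ⟨l x, fun y => y.2⟩, ⟨x, rfl⟩, rfl⟩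

variable {A : Type u} [AddCommGroup A]

lemma constSec_injective (U : T.Etale) [Nonempty U.left] :
    Function.Injective (constSec T A U) := by
  intro a b h
  obtain ⟨S, hS, hab⟩ := constSec_eq_local h
  obtain ⟨V, f, hf, -⟩ := (mem_smallEtale_iff S).1 hS (Classical.arbitrary _)
  exact hab f hf

/-- A section of a constant sheaf has the locally constant function `l` as its values. -/
def HasValues {U : T.Etale} (c : (constSh T A).obj.obj (op U)) (l : LocallyConstant U.left A) :
    Prop :=
  ∀ (V : T.Etale) (f : V ⟶ U) (a : A), (∀ y, l (f.left y) = a) →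
    (constSh T A).obj.map f.op c = constSec T A V a

/-- Étale maps are open, so values that are constant on an étale neighbourhood are constant on an
open one. Two neighbourhoods of a point give the same value because their fibre product is nonempty.
-/
lemma exists_hasValues {U : T.Etale} (c : (constSh T A).obj.obj (op U)) :
    ∃ l : LocallyConstant U.left A, HasValues c l := by
  obtain ⟨S, hS, hc⟩ := exists_constSec_local c
  rw [mem_smallEtale_iff] at hS
  have h1 : ∀ x : U.left, ∃ a, ∃ (V : T.Etale) (f : V ⟶ U) (y : V.left), f.left y = x ∧
      (constSh T A).obj.map f.op c = constSec T A V a := by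
    intro x
    obtain ⟨V, f, hf, y, hy⟩ := hS x
    obtain ⟨a, ha⟩ := hc f hf
    exact ⟨a, V, f, y, hy, ha⟩
  choose l hl using h1
  have huniq : ∀ (V : T.Etale) (f : V ⟶ U) (y : V.left) (a : A),
      (constSh T A).obj.map f.op c = constSec T A V a → l (f.left y) = a := by
    intro V f y a ha
    obtain ⟨V', f', y', hy', ha'⟩ := hl (f.left y)
    obtain ⟨z, -, -⟩ := exists_etProd_point f' f y' y hy'
    have : Nonempty (etProd f' f).left := ⟨z⟩
    refine constSec_injective (T := T) (etProd f' f) ?_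
    rw [← constSec_map T A (etFst f' f), ← constSec_map T A (etSnd f' f), ← ha, ← ha',
      ← map_comp_elt, ← map_comp_elt, (et_isPullback f' f).w]
  refine ⟨⟨l, (IsLocallyConstant.iff_exists_open l).2 fun x => ?_⟩, ?_⟩
  · obtain ⟨V, f, y, hy, ha⟩ := hl x
    refine ⟨_, isOpen_range_et f, ⟨y, hy⟩, ?_⟩
    rintro _ ⟨y', rfl⟩
    exact huniq V f y' _ ha
  · intro V f a ha
    refine sheaf_ext _ (T.smallEtaleTopology.pullback_stable f ((mem_smallEtale_iff S).2 hS))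
      fun W k hk => ?_
    rcases isEmpty_or_nonempty W.left with hW | ⟨⟨w⟩⟩
    · exact section_eq_of_isEmpty _ _ _
    · obtain ⟨b, hb⟩ := hc _ hk
      have h2 := huniq W _ w b hb
      have h3 := ha (k.left w)
      rw [et_comp_apply] at h2
      rw [← map_comp_elt, hb, constSec_map, ← h2, ← h3]
      rfl

lemma exists_section_of_locallyConstant {U : T.Etale} (l : LocallyConstant U.left A) :
    ∃ c : (constSh T A).obj.obj (op U), HasValues c l := by
  obtain ⟨S, hS, hl⟩ := locallyConstant_cover l
  obtain ⟨c, hc⟩ := sheaf_glue (constSh T A) hS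
    (fun V f x => ∀ (W : T.Etale) (k : W ⟶ V) a, (∀ y, l ((k ≫ f).left y) = a) →
      (constSh T A).obj.map k.op x = constSec T A W a)
    (fun V V' f g x h W k a ha => by
      rw [← map_comp_elt]
      exact h W (k ≫ g) a (by simpa using ha))
    (fun V f hf x y hx hy => by
      obtain ⟨a, ha⟩ := hl f hf
      have h1 := hx V (𝟙 V) a (by simpa using ha)
      have h2 := hy V (𝟙 V) a (by simpa using ha)
      rw [map_id_elt] at h1 h2
      rw [h1, h2])
    (fun V f hf => by
      obtain ⟨a, ha⟩ := hl f hf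
      refine ⟨constSec T A V a, fun W k b hb => ?_⟩
      rw [constSec_map]
      rcases isEmpty_or_nonempty W.left with hW | ⟨⟨w⟩⟩
      · exact section_eq_of_isEmpty _ _ _
      · rw [← hb w, et_comp_apply, ha])
  refine ⟨c, fun V f a ha => sheaf_ext _ (T.smallEtaleTopology.pullback_stable f hS)
    fun W k hk => ?_⟩
  have := hc (k ≫ f) hk W (𝟙 W) a (fun y => by
    rw [Category.id_comp, et_comp_apply, ha])
  rw [map_id_elt] at this
  rw [← map_comp_elt, this, constSec_map]

/-- A locally constant function on a connected space is constant. -/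
lemma exists_eq_constSec_of_connected (U : T.Etale) [ConnectedSpace U.left]
    (c : (constSh T A).obj.obj (op U)) : ∃ a, c = constSec T A U a := by
  obtain ⟨l, hl⟩ := exists_hasValues c
  refine ⟨l (Classical.arbitrary _), ?_⟩
  have := hl U (𝟙 U) (l (Classical.arbitrary _)) (fun y =>
    l.isLocallyConstant.apply_eq_of_isPreconnected isPreconnected_univ trivial trivial)
  rwa [map_id_elt] at this

end SmallSite

/-! ### A connected torsor gives an injective homomorphism -/

section Injective
variable {T : Scheme.{u}} {G : Type u} [AddCommGroup G]

lemma eq_zero_of_dual_apply_eq_zero {g : G} (h : ∀ a : Dual G, a g = 0) : g = 0 := by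
  by_contra hg
  obtain ⟨c, hc⟩ := CharacterModule.exists_character_apply_ne_zero_of_ne_zero hg
  exact hc (congrArg ULift.down (h ((AddEquiv.ulift.symm : _ ≃+ QZ.{u}).toAddMonoidHom.comp c)))

/-- If ev_g kills the extension class, ev_g extends to r : E → ℚ/ℤ. On the tautological section over
Y the value of r is constant by connectedness, hence unchanged by translation, while translation by
a adds a(g). Thus every character vanishes at g. -/
theorem evalHom_injective_of_connected (x : H1 T (Dual G)) (P : Torsor T (Dual G))
    (hP : P.HasClass x) [ConnectedSpace P.Y.left] : Function.Injective (evalHom T G x) := by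
  obtain ⟨E, i, p, w, h, φ, rfl, hact, -, -⟩ := hP
  refine (injective_iff_map_eq_zero _).2 fun g hg => eq_zero_of_dual_apply_eq_zero fun a => ?_
  obtain ⟨r', hr'⟩ := Ext.contravariant_sequence_exact₁ h _ (Ext.mk₀ (constMap T (evalAt g)))
    (add_zero 1) hg
  obtain ⟨r, rfl⟩ := (Ext.mk₀_bijective _ _).2 r'
  rw [Ext.mk₀_comp_mk₀] at hr'
  replace hr' : i ≫ r = constMap T (evalAt g) := (Ext.mk₀_bijective _ _).1 hr'
  let s : E.obj.obj (op P.Y) := φ.app (op P.Y) (𝟙 P.Y)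
  obtain ⟨c, hc⟩ := exists_eq_constSec_of_connected P.Y (r.hom.app (op P.Y) s)
  -- Pulling the tautological section back along the action of a adds the constant section a.
  have h1 : E.obj.map (P.act a).op s = i.hom.app (op P.Y) (constSec T _ P.Y a) + s := by
    rw [← hact]
    have := ConcreteCategory.congr_hom (φ.naturality (P.act a).op) (𝟙 P.Y)
    refine this.symm.trans ?_
    simp
  have h2 := congrArg (r.hom.app (op P.Y)) h1
  have h3 : r.hom.app (op P.Y) (i.hom.app (op P.Y) (constSec T _ P.Y a)) =
      constSec T QZ.{u} P.Y (a g) := by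
    refine Eq.trans ?_ (constMap_constSec (evalAt g) P.Y a)
    rw [← hr']
    rfl
  rw [map_add, h3, app_map_elt, hc, constSec_map] at h2
  exact constSec_injective (T := T) P.Y (by simpa using h2)

end Injective

/-! ### Disjoint unions of étale schemes -/

section Coproducts
variable {T : Scheme.{u}}

instance : IsZariskiLocalAtSource (@Etale.{u}) :=
  HasRingHomProperty.instIsZariskiLocalAtSource (Q := RingHom.Etale)

/-- The disjoint union of a family of étale schemes. -/
abbrev etSigma {ι : Type u} (Z : ι → T.Etale) : T.Etale :=
  have : Etale (Sigma.desc fun i => (Z i).hom) :=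
    IsZariskiLocalAtSource.sigmaDesc (P := @Etale) fun i => (Z i).prop
  Scheme.Etale.mk (Sigma.desc fun i => (Z i).hom)

abbrev etSigmaι {ι : Type u} (Z : ι → T.Etale) (i : ι) : Z i ⟶ etSigma Z :=
  etHom (Sigma.ι (fun i => (Z i).left) i) (Sigma.ι_desc _ _)

/-- The morphism out of a disjoint union given by morphisms out of its pieces. -/
abbrev etSigmaDesc {ι : Type u} (Z : ι → T.Etale) {U : T.Etale} (f : ∀ i, Z i ⟶ U) :
    etSigma Z ⟶ U :=
  etHom (Sigma.desc fun i => (f i).left) (Sigma.hom_ext _ _ fun i => by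
    exact (Sigma.ι_desc_assoc _ _ _).trans ((et_w (f i)).trans
      (Sigma.ι_desc (fun i => (Z i).hom) i).symm))

@[simp] lemma etSigmaι_desc {ι : Type u} (Z : ι → T.Etale) {U : T.Etale}
    (f : ∀ i, Z i ⟶ U) (i : ι) : etSigmaι Z i ≫ etSigmaDesc Z f = f i :=
  et_hom_ext (Sigma.ι_desc _ _)

lemma exists_etSigmaι_eq {ι : Type u} (Z : ι → T.Etale) (x : (etSigma Z).left) :
    ∃ i y, (etSigmaι Z i).left y = x := by
  obtain ⟨⟨i, y⟩, rfl⟩ := (sigmaMk fun i => (Z i).left).surjective x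
  exact ⟨i, y, (sigmaMk_mk _ _ _).symm⟩

instance {ι : Type u} (Z : ι → T.Etale) (i : ι) : Mono (etSigmaι Z i) where
  right_cancellation _ _ h := et_hom_ext ((cancel_mono (Sigma.ι (fun i => (Z i).left) i)).1
    (congrArg (·.left) h))

lemma etSigma_isEmpty {ι : Type u} (Z : ι → T.Etale) {i j : ι} (hij : i ≠ j) {W : T.Etale}
    (f : W ⟶ Z i) (g : W ⟶ Z j) (h : f ≫ etSigmaι Z i = g ≫ etSigmaι Z j) : IsEmpty W.left :=
  isEmpty_of_commSq_sigmaι_of_ne (g := fun i => (Z i).left) (a := f.left) (b := g.left)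
    ⟨congrArg (·.left) h⟩ hij

lemma etSigma_cover {ι : Type u} (Z : ι → T.Etale) :
    Sieve.ofArrows Z (etSigmaι Z) ∈ T.smallEtaleTopology (etSigma Z) := by
  refine (mem_smallEtale_iff _).2 fun x => ?_
  obtain ⟨i, y, hy⟩ := exists_etSigmaι_eq Z x
  exact ⟨Z i, etSigmaι Z i, Sieve.ofArrows_mk _ _ _, y, hy⟩

lemma map_comp_apply {C : Type*} [Category* C] (P : Cᵒᵖ ⥤ Type*) {U V W : C} (f : V ⟶ U)
    (g : W ⟶ V) (x : P.obj (op U)) : P.map (g ≫ f).op x = P.map g.op (P.map f.op x) := by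
  rw [op_comp, Functor.map_comp]
  rfl

lemma map_id_apply {C : Type*} [Category* C] (P : Cᵒᵖ ⥤ Type*) {U : C} (x : P.obj (op U)) :
    P.map (𝟙 U).op x = x := by
  rw [op_id, CategoryTheory.Functor.map_id]
  rfl

lemma eq_of_isEmpty {P : (T.Etale)ᵒᵖ ⥤ Type*} (hP : Presieve.IsSheaf T.smallEtaleTopology P)
    {W : T.Etale} [IsEmpty W.left] (x y : P.obj (op W)) : x = y :=
  (hP ⊥ ((mem_smallEtale_iff _).2 fun x => isEmptyElim x)).isSeparatedFor.ext
    fun _ _ h => h.elim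

lemma exists_section_etSigma {P : (T.Etale)ᵒᵖ ⥤ Type*}
    (hP : Presieve.IsSheaf T.smallEtaleTopology P) {ι : Type u} (Z : ι → T.Etale)
    (s : ∀ i, P.obj (op (Z i))) :
    ∃ t : P.obj (op (etSigma Z)), ∀ i, P.map (etSigmaι Z i).op t = s i := by
  obtain ⟨t, ht⟩ := exists_glue hP (etSigma_cover Z)
    (fun V f x => ∀ (W : T.Etale) (k : W ⟶ V) (i : ι) (l : W ⟶ Z i), k ≫ f = l ≫ etSigmaι Z i →
      P.map k.op x = P.map l.op (s i))
    (fun V V' f g x h W k i l hl => by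
      rw [← map_comp_apply]
      exact h W (k ≫ g) i l (by rw [← hl, Category.assoc]))
    (by
      rintro V _ ⟨_, l, _, ⟨i⟩, rfl⟩ x y hx hy
      have h1 := hx V (𝟙 V) i l (Category.id_comp _)
      have h2 := hy V (𝟙 V) i l (Category.id_comp _)
      rw [map_id_apply] at h1 h2
      rw [h1, h2])
    (by
      rintro V _ ⟨_, l, _, ⟨i⟩, rfl⟩
      refine ⟨P.map l.op (s i), fun W k j m h => ?_⟩
      rw [← map_comp_apply]
      by_cases hij : i = j
      · subst hij
        rw [← Category.assoc, cancel_mono] at h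
        rw [h]
      -- An object mapping to two different pieces is empty, so any two sections over it agree.
      · have := etSigma_isEmpty Z hij (k ≫ l) m (by rw [Category.assoc, h])
        exact eq_of_isEmpty hP _ _)
  refine ⟨t, fun i => ?_⟩
  have := ht (etSigmaι Z i) (Sieve.ofArrows_mk _ _ _) (Z i) (𝟙 _) i (𝟙 _) rfl
  rwa [map_id_apply, map_id_apply] at this

end Coproducts

/-! ### Descent of sections and local lifting -/

section Descent
variable {T : Scheme.{u}}

lemma singleton_mem_smallEtale {U V : T.Etale} (f : U ⟶ V) [Surjective f.left] :
    Sieve.generate (Presieve.singleton f) ∈ T.smallEtaleTopology V :=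
  (mem_smallEtale_iff _).2 fun x => by
    obtain ⟨y, hy⟩ := f.left.surjective x
    exact ⟨U, f, Sieve.le_generate _ _ _ (Presieve.singleton_self f), y, hy⟩

/-- Descent of sections along an étale surjection. -/
lemma exists_descent {P : (T.Etale)ᵒᵖ ⥤ Type*} (hP : Presieve.IsSheaf T.smallEtaleTopology P)
    {U V : T.Etale} (f : U ⟶ V) [Surjective f.left] (s : P.obj (op U))
    (h : ∀ (W : T.Etale) (k k' : W ⟶ U), k ≫ f = k' ≫ f → P.map k.op s = P.map k'.op s) :
    ∃ t : P.obj (op V), P.map f.op t = s := by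
  obtain ⟨t, ht⟩ := exists_glue hP (singleton_mem_smallEtale f)
    (fun W g x => ∀ (W' : T.Etale) (l : W' ⟶ W) (k : W' ⟶ U), k ≫ f = l ≫ g →
      P.map l.op x = P.map k.op s)
    (fun W W' g m x hx W'' l k hk => by
      rw [← hx W'' (l ≫ m) k (by rw [hk, Category.assoc]), op_comp, Functor.map_comp]
      rfl)
    (by
      rintro W _ ⟨_, k, _, ⟨⟩, rfl⟩ x y hx hy
      have h1 := hx W (𝟙 W) k (Category.id_comp _).symm
      have h2 := hy W (𝟙 W) k (Category.id_comp _).symm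
      rw [op_id, CategoryTheory.Functor.map_id] at h1 h2
      exact h1.trans h2.symm)
    (by
      rintro W _ ⟨_, k, _, ⟨⟩, rfl⟩
      refine ⟨P.map k.op s, fun W' l k' hk => ?_⟩
      rw [h W' k' (l ≫ k) (by rw [hk, Category.assoc]), op_comp, Functor.map_comp]
      rfl)
  refine ⟨t, ?_⟩
  have := ht f (Sieve.le_generate _ _ _ (Presieve.singleton_self f)) U (𝟙 U) (𝟙 U) rfl
  rw [op_id, CategoryTheory.Functor.map_id] at this
  exact this

lemma exists_local_lift {E F : EtSh T} (p : E ⟶ F) [Epi p] {U : T.Etale}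
    (s : F.obj.obj (op U)) : ∃ R ∈ T.smallEtaleTopology U, ∀ ⦃V : T.Etale⦄ (f : V ⟶ U), R f →
      ∃ t, p.hom.app (op V) t = F.obj.map f.op s := by
  have : Sheaf.IsLocallySurjective p := (Sheaf.isLocallySurjective_iff_epi' _ p).2 inferInstance
  exact ⟨_, Presheaf.imageSieve_mem T.smallEtaleTopology p.hom s, fun V f hf => hf⟩

/-- Over a quasi-compact base, sections lift along epimorphisms of sheaves after an affine étale
covering. -/
lemma exists_affine_lift {E F : EtSh T} (p : E ⟶ F) [Epi p] {V : T.Etale} [CompactSpace V.left]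
    (s : F.obj.obj (op V)) : ∃ (U : T.Etale) (f : U ⟶ V), IsAffine U.left ∧ Surjective f.left ∧
      ∃ t, p.hom.app (op U) t = F.obj.map f.op s := by
  obtain ⟨R, hR, ht⟩ := exists_local_lift p s
  rw [mem_smallEtale_iff] at hR
  have h1 : ∀ x : V.left, ∃ (Z : T.Etale) (f : Z ⟶ V), R f ∧ IsAffine Z.left ∧
      x ∈ Set.range f.left := by
    intro x
    obtain ⟨W, f, hf, y, hy⟩ := hR x
    obtain ⟨O, hO, hy', -⟩ := exists_isAffineOpen_mem_and_subset (x := y) (U := ⊤) trivial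
    exact ⟨etOpen W O, etOpenι W O ≫ f, R.downward_closed hf _, hO, ⟨y, hy'⟩, hy⟩
  choose Z f hf hZ hx using h1
  obtain ⟨t, htop⟩ := CompactSpace.elim_nhds_subcover (fun x => Set.range (f x).left)
    (fun x => (isOpen_range_et (f x)).mem_nhds (hx x))
  choose σ hσ using fun i : t => ht _ (hf i)
  let g := etSigmaDesc (fun i : t => Z i) (fun i => f i)
  obtain ⟨τ, hτ⟩ := exists_section_etSigma (isSheaf_forget E) (fun i : t => Z i) σ
  replace hτ : ∀ i : t, E.obj.map (etSigmaι (fun i : t => Z i) i).op τ = σ i := hτ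
  refine ⟨etSigma fun i : t => Z i, g, inferInstanceAs (IsAffine (∐ fun i : t => (Z i).left)),
    ⟨fun x => ?_⟩, τ, sheaf_ext F (etSigma_cover _) ?_⟩
  · have : x ∈ ⋃ y ∈ t, Set.range (f y).left := by rw [htop]; trivial
    simp only [Set.mem_iUnion] at this
    obtain ⟨y, hy, z, rfl⟩ := this
    exact ⟨(etSigmaι (fun i : t => Z i) ⟨y, hy⟩).left z, by
      rw [← et_comp_apply, etSigmaι_desc]⟩
  · rintro W _ ⟨_, l, _, ⟨i⟩, rfl⟩
    rw [map_comp_elt, ← app_map_elt, hτ, hσ, map_comp_elt F _ l, ← map_comp_elt F g,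
      etSigmaι_desc]

end Descent

/-! ### Boundary classes and torsion of degree one cohomology -/

section Boundary
variable {T : Scheme.{u}}

/-- A degree one class is the boundary of a morphism to the quotient of an injective sheaf. -/
lemma exists_boundary {A : EtSh T} {Z : EtSh T} (x : Ext.{u} Z A 1) :
    ∃ (I Q : EtSh T) (j : A ⟶ I) (q : I ⟶ Q) (w : j ≫ q = 0)
      (h : (ShortComplex.mk j q w).ShortExact) (_ : Injective I) (γ : Z ⟶ Q),
      (Ext.mk₀ γ).comp h.extClass (zero_add 1) = x := by
  have h : (ShortComplex.mk (Injective.ι A) (cokernel.π _) (cokernel.condition _)).ShortExact :=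
    ShortComplex.ShortExact.mk' (ShortComplex.exact_cokernel _) inferInstance inferInstance
  obtain ⟨y, hy⟩ := Ext.covariant_sequence_exact₁ Z h x (Ext.eq_zero_of_injective _) (zero_add 1)
  obtain ⟨γ, rfl⟩ := (Ext.mk₀_bijective _ _).2 y
  exact ⟨_, _, _, _, _, h, inferInstance, γ, hy⟩

lemma boundary_eq_zero {S : ShortComplex (EtSh T)} (h : S.ShortExact)
    (γ : constSh T (ULift.{u} ℤ) ⟶ S.X₃) (s : S.X₂.obj.obj (op (Scheme.Etale.mk (𝟙 T))))
    (hs : S.g.hom.app _ s = γ.hom.app _ (constSec T (ULift.{u} ℤ) _ ⟨1⟩)) :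
    (Ext.mk₀ γ).comp h.extClass (zero_add 1) = (0 : Ext.{u} _ _ 1) := by
  obtain ⟨σ, rfl⟩ := exists_lift_of_globalSection S.g γ s hs
  rw [← Ext.mk₀_comp_mk₀_assoc, h.comp_extClass, Ext.comp_zero]

lemma exists_preimage_section {S : ShortComplex (EtSh T)} (h : S.ShortExact) {U : T.Etale}
    (s : S.X₂.obj.obj (op U)) (hs : S.g.hom.app (op U) s = 0) :
    ∃ t, S.f.hom.app (op U) t = s := by
  have := h.mono_f
  have hex := h.exact.map_of_mono_of_preservesKernel (sectionsFunctor U) this inferInstance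
  exact (ShortComplex.ab_exact_iff _).1 hex s hs

lemma section_injective {E F : EtSh T} (i : E ⟶ F) [Mono i] (U : T.Etale) :
    Function.Injective (i.hom.app (op U)) :=
  (AddCommGrpCat.mono_iff_injective _).1
    (inferInstanceAs (Mono ((sectionsFunctor U).map i)))

/-- A locally constant function on a compact space takes finitely many values, and the product of
their orders kills them all. -/
lemma exists_nsmul_eq_zero_of_compact {A : Type u} [AddCommGroup A]
    (hA : ∀ a : A, IsOfFinAddOrder a) {U : T.Etale} [CompactSpace U.left]
    (c : (constSh T A).obj.obj (op U)) : ∃ n : ℕ, 0 < n ∧ n • c = 0 := by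
  obtain ⟨l, hl⟩ := exists_hasValues c
  have hfin : (Set.range l).Finite := l.range_finite
  obtain ⟨n, hn, hl0⟩ : ∃ n : ℕ, 0 < n ∧ ∀ x, n • l x = 0 := by
    refine ⟨∏ a ∈ hfin.toFinset, addOrderOf a,
      Finset.prod_pos fun a _ => (hA a).addOrderOf_pos, fun x => ?_⟩
    obtain ⟨m, hm⟩ := Finset.dvd_prod_of_mem addOrderOf (hfin.mem_toFinset.2 ⟨x, rfl⟩)
    rw [hm, mul_comm, mul_nsmul', addOrderOf_nsmul_eq_zero, nsmul_zero]
  refine ⟨n, hn, ?_⟩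
  obtain ⟨S, hS, h⟩ := locallyConstant_cover l
  refine sheaf_ext _ hS fun V f hf => ?_
  obtain ⟨a, ha⟩ := h f hf
  rw [map_nsmul, hl V f a ha, map_zero, ← constSec_nsmul]
  rcases isEmpty_or_nonempty V.left with hV | ⟨⟨v⟩⟩
  · exact section_eq_of_isEmpty _ _ _
  · rw [← ha v, hl0, constSec_zero]

lemma isOfFinAddOrder_qz (q : QZ.{u}) : IsOfFinAddOrder q := by
  obtain ⟨⟨x⟩⟩ := q
  refine isOfFinAddOrder_iff_nsmul_eq_zero.2 ⟨x.den, x.den_pos, ULift.ext _ _ ?_⟩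
  change x.den • (x : AddCircle (1 : ℚ)) = 0
  rw [← AddCircle.coe_nsmul, AddCircle.coe_eq_zero_iff]
  exact ⟨x.num, by simp [mul_comm]⟩

lemma compactSpace_etProd {U V : T.Etale} (f : U ⟶ V) [CompactSpace U.left]
    [QuasiSeparatedSpace V.left] : CompactSpace (etProd f f).left := by
  have h : QuasiCompact f.left := inferInstance
  have : QuasiCompact (pullback.fst f.left f.left) :=
    (inferInstance : MorphismProperty.IsStableUnderBaseChange (@QuasiCompact.{u})).of_isPullback
      (IsPullback.of_hasPullback f.left f.left).flip h
  exact @QuasiCompact.compactSpace_of_compactSpace _ _ (pullback.fst f.left f.left) this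
    inferInstance

/-- Over a quasi-compact and quasi-separated scheme the group `H¹(T, ℚ/ℤ)` is torsion. -/
theorem isOfFinAddOrder_H1 [CompactSpace T] [QuasiSeparatedSpace T] {A : Type u} [AddCommGroup A]
    (hA : ∀ a : A, IsOfFinAddOrder a) (x : H1 T A) :
    IsOfFinAddOrder x := by
  obtain ⟨I, Q, j, q, w, h, -, γ, rfl⟩ := exists_boundary x
  have : Epi q := h.epi_g
  let t := Scheme.Etale.mk (𝟙 T)
  have : CompactSpace t.left := inferInstanceAs (CompactSpace T)
  -- The class is the obstruction to lifting γ(1) to a global section. It lifts over an affine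
  -- covering U, and the two pullbacks of the lift to U ×_T U differ by a section c of the constant
  -- sheaf. Quasi-separatedness makes U ×_T U compact, so some n > 0 kills c and n times the lift
  -- descends.
  obtain ⟨U, f, hU, hf, s, hs⟩ := exists_affine_lift q (V := t)
    (γ.hom.app _ (constSec T (ULift.{u} ℤ) t ⟨1⟩))
  have : QuasiSeparatedSpace t.left := inferInstanceAs (QuasiSeparatedSpace T)
  have := compactSpace_etProd f
  obtain ⟨c, hc⟩ := exists_preimage_section h
    (I.obj.map (etFst f f).op s - I.obj.map (etSnd f f).op s) (by
      change q.hom.app _ _ = _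
      rw [map_sub, app_map_elt, app_map_elt, hs, ← map_comp_elt, ← map_comp_elt,
        (et_isPullback f f).w, sub_self])
  obtain ⟨n, hn, hnc⟩ := exists_nsmul_eq_zero_of_compact hA c
  refine isOfFinAddOrder_iff_nsmul_eq_zero.2 ⟨n, hn, ?_⟩
  have hns : n • I.obj.map (etFst f f).op s = n • I.obj.map (etSnd f f).op s := by
    rw [← sub_eq_zero, ← nsmul_sub, ← hc]
    change n • j.hom.app _ c = 0
    rw [← map_nsmul, hnc, map_zero]
  obtain ⟨σ, hσ⟩ := exists_descent (isSheaf_forget I) f (n • s) (fun W k k' hk => by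
    obtain ⟨l, rfl, rfl⟩ : ∃ l, l ≫ etFst f f = k ∧ l ≫ etSnd f f = k' :=
      ⟨_, (et_isPullback f f).lift_fst k k' hk, (et_isPullback f f).lift_snd k k' hk⟩
    change I.obj.map (l ≫ etFst f f).op (n • s) = I.obj.map (l ≫ etSnd f f).op (n • s)
    rw [map_comp_elt, map_comp_elt, map_nsmul (I.obj.map (etFst f f).op).hom,
      map_nsmul (I.obj.map (etSnd f f).op).hom]
    exact congrArg _ hns)
  change I.obj.map f.op σ = n • s at hσ
  have := boundary_eq_zero h (n • γ) σ (sheaf_ext _ (singleton_mem_smallEtale f) (by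
    rintro W _ ⟨_, k, _, ⟨⟩, rfl⟩
    change Q.obj.map _ (q.hom.app _ σ) = Q.obj.map _ (n • γ.hom.app _ _)
    rw [map_nsmul, map_comp_elt, map_comp_elt, ← app_map_elt, hσ, map_nsmul, hs, map_nsmul]))
  rw [← this]
  have h3 : Ext.mk₀ (n • γ) = n • Ext.mk₀ γ := map_nsmul Ext.addEquiv₀.symm n γ
  rw [h3]
  exact (map_nsmul (((Ext.bilinearComp _ _ _ 0 1 1 (zero_add 1)).flip h.extClass)) n
    (Ext.mk₀ γ)).symm

end Boundary

/-! ### Principal sheaves over a base on which they have a section -/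

section Representability
variable {T : Scheme.{u}}

/-- A sheaf of types on the small étale site on which a group acts simply transitively, locally. -/
structure PrincipalSheaf (T : Scheme.{u}) (A : Type u) where
  /-- The underlying presheaf of types. -/
  F : (T.Etale)ᵒᵖ ⥤ Type u
  isSheaf : Presieve.IsSheaf T.smallEtaleTopology F
  /-- The action of the group. -/
  act : A → (F ⟶ F)
  exists_act : ∀ {U : T.Etale} (s t : F.obj (op U)), ∃ S ∈ T.smallEtaleTopology U,
    ∀ ⦃V : T.Etale⦄ (f : V ⟶ U), S f → ∃ a, F.map f.op t = (act a).app _ (F.map f.op s)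
  act_injective : ∀ {U : T.Etale} [Nonempty U.left] (s : F.obj (op U)) (a b : A),
    (act a).app _ s = (act b).app _ s → a = b
  exists_affine : ∀ (V : T.Etale) [CompactSpace V.left], ∃ (U : T.Etale) (f : U ⟶ V),
    IsAffine U.left ∧ Surjective f.left ∧ Nonempty (F.obj (op U))

/-- `Y → V` with the section `σ` represents the restriction of `F` to schemes over `V`. -/
def RepresentsOver (F : (T.Etale)ᵒᵖ ⥤ Type u) {V Y : T.Etale} (v : Y ⟶ V) (σ : F.obj (op Y)) :
    Prop :=
  ∀ (W : T.Etale) (k : W ⟶ V) (t : F.obj (op W)), ∃! y : W ⟶ Y, y ≫ v = k ∧ F.map y.op σ = t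

lemma RepresentsOver.ext {F : (T.Etale)ᵒᵖ ⥤ Type u} {V Y : T.Etale} {v : Y ⟶ V}
    {σ : F.obj (op Y)} (h : RepresentsOver F v σ) {W : T.Etale} {x y : W ⟶ Y}
    (h1 : x ≫ v = y ≫ v) (h2 : F.map x.op σ = F.map y.op σ) : x = y :=
  (h W (y ≫ v) (F.map y.op σ)).unique ⟨h1, h2⟩ ⟨rfl, rfl⟩

lemma RepresentsOver.exists_lift {F : (T.Etale)ᵒᵖ ⥤ Type u} {V Y : T.Etale} {v : Y ⟶ V}
    {σ : F.obj (op Y)} (h : RepresentsOver F v σ) {W : T.Etale} (k : W ⟶ V)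
    (t : F.obj (op W)) : ∃ y : W ⟶ Y, y ≫ v = k ∧ F.map y.op σ = t :=
  (h W k t).exists

lemma RepresentsOver.mk' {F : (T.Etale)ᵒᵖ ⥤ Type u} {V Y : T.Etale} {v : Y ⟶ V}
    {σ : F.obj (op Y)} (h1 : ∀ (W : T.Etale) (x y : W ⟶ Y), x ≫ v = y ≫ v →
      F.map x.op σ = F.map y.op σ → x = y)
    (h2 : ∀ (W : T.Etale) (k : W ⟶ V) (t : F.obj (op W)),
      ∃ y : W ⟶ Y, y ≫ v = k ∧ F.map y.op σ = t) : RepresentsOver F v σ := by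
  intro W k t
  obtain ⟨y, hy, hyt⟩ := h2 W k t
  exact ⟨y, ⟨hy, hyt⟩, fun z hz => h1 W z y (hz.1.trans hy.symm) (hz.2.trans hyt.symm)⟩

lemma RepresentsOver.of_iso {F : (T.Etale)ᵒᵖ ⥤ Type u} {V Y V' Y' : T.Etale} {v : Y ⟶ V}
    {σ : F.obj (op Y)} (h : RepresentsOver F v σ) (e : Y' ≅ Y) (e' : V ≅ V') :
    RepresentsOver F (e.hom ≫ v ≫ e'.hom) (F.map e.hom.op σ) := by
  refine .mk' (fun W x y h1 h2 => ?_) (fun W k t => ?_)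
  · rw [← cancel_mono e.hom]
    refine h.ext ?_ ?_
    · rw [← cancel_mono e'.hom]
      simpa only [Category.assoc] using h1
    · rw [map_comp_apply, map_comp_apply, h2]
  · obtain ⟨y, hy, hyt⟩ := h.exists_lift (k ≫ e'.inv) t
    refine ⟨y ≫ e.inv, ?_, ?_⟩
    · simp [reassoc_of% hy]
    · rw [← map_comp_apply, Category.assoc, e.inv_hom_id, Category.comp_id, hyt]

lemma hom_separated {Y W : T.Etale} {S : Sieve W} (hS : S ∈ T.smallEtaleTopology W)
    {x y : W ⟶ Y} (h : ∀ ⦃V : T.Etale⦄ (f : V ⟶ W), S f → f ≫ x = f ≫ y) : x = y :=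
  (GrothendieckTopology.Subcanonical.isSheaf_of_isRepresentable (yoneda.obj Y) S
    hS).isSeparatedFor.ext h

lemma eq_of_cover {F : (T.Etale)ᵒᵖ ⥤ Type u} (hF : Presieve.IsSheaf T.smallEtaleTopology F)
    {W : T.Etale} {S : Sieve W} (hS : S ∈ T.smallEtaleTopology W)
    {x y : F.obj (op W)} (h : ∀ ⦃V : T.Etale⦄ (f : V ⟶ W), S f → F.map f.op x = F.map f.op y) :
    x = y :=
  (hF S hS).isSeparatedFor.ext h

lemma hom_eq_of_isEmpty {Y W : T.Etale} [IsEmpty W.left] (x y : W ⟶ Y) : x = y :=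
  et_hom_ext (isInitialOfIsEmpty.hom_ext _ _)

/-- Over a base on which a principal sheaf has a section it is represented by a disjoint union
of copies of the base. -/
lemma exists_representsOver_of_section {A : Type u} (P : PrincipalSheaf T A) {U : T.Etale}
    (s : P.F.obj (op U)) :
    ∃ τ : P.F.obj (op (etSigma fun _ : A => U)),
      (∀ a, P.F.map (etSigmaι (fun _ : A => U) a).op τ = (P.act a).app _ s) ∧
      RepresentsOver P.F (etSigmaDesc (fun _ : A => U) fun _ => 𝟙 U) τ := by
  obtain ⟨τ, hτ⟩ := exists_section_etSigma P.isSheaf (fun _ : A => U)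
    (fun a => (P.act a).app _ s)
  have hact : ∀ {V : T.Etale} (l : V ⟶ U) (a : A),
      P.F.map (l ≫ etSigmaι (fun _ : A => U) a).op τ = (P.act a).app _ (P.F.map l.op s) := by
    intro V l a
    rw [map_comp_apply, hτ]
    exact (ConcreteCategory.congr_hom ((P.act a).naturality l.op) s).symm
  have huniq : ∀ (W : T.Etale) (x y : W ⟶ etSigma fun _ : A => U),
      x ≫ etSigmaDesc (fun _ : A => U) (fun _ => 𝟙 U) =
        y ≫ etSigmaDesc (fun _ : A => U) (fun _ => 𝟙 U) →
      P.F.map x.op τ = P.F.map y.op τ → x = y := by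
    intro W x y h1 h2
    refine hom_separated (T.smallEtaleTopology.intersection_covering
      (T.smallEtaleTopology.pullback_stable x (etSigma_cover _))
      (T.smallEtaleTopology.pullback_stable y (etSigma_cover _))) ?_
    rintro V f ⟨⟨_, l, _, ⟨a⟩, hl⟩, ⟨_, l', _, ⟨b⟩, hl'⟩⟩
    have h3 : l = l' := by
      have h4 := congrArg (f ≫ ·) h1
      simp only [← Category.assoc] at h4
      rw [← hl, ← hl'] at h4
      simpa using h4
    subst h3
    rcases isEmpty_or_nonempty V.left with hV | hV
    · exact hom_eq_of_isEmpty _ _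
    · have h5 := congrArg (P.F.map f.op) h2
      rw [← map_comp_apply, ← map_comp_apply, ← hl, ← hl', hact, hact] at h5
      obtain rfl := P.act_injective _ _ _ h5
      rw [← hl, hl']
  refine ⟨τ, hτ, .mk' huniq fun W k t => ?_⟩
  -- Locally t is a translate of s by some a, which prescribes the copy of U to map to; uniqueness
  -- glues the local maps.
  obtain ⟨S, hS, ha⟩ := P.exists_act (P.F.map k.op s) t
  obtain ⟨x, hx⟩ := exists_glue (P := yoneda.obj (etSigma fun _ : A => U))
    (GrothendieckTopology.Subcanonical.isSheaf_of_isRepresentable _) hS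
    (fun V f x => x ≫ etSigmaDesc (fun _ : A => U) (fun _ => 𝟙 U) = f ≫ k ∧
      P.F.map x.op τ = P.F.map f.op t)
    (fun V V' f g x h => ⟨(Category.assoc _ _ _).trans ((congrArg (g ≫ ·) h.1).trans
      (Category.assoc _ _ _).symm), by
        rw [map_comp_apply, ← h.2]
        exact map_comp_apply P.F _ _ _⟩)
    (fun V f _ x y hx hy => huniq _ _ _ (hx.1.trans hy.1.symm) (hx.2.trans hy.2.symm))
    (fun V f hf => by
      obtain ⟨a, ha⟩ := ha f hf
      refine ⟨(f ≫ k) ≫ etSigmaι (fun _ : A => U) a, ?_, ?_⟩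
      · rw [Category.assoc, etSigmaι_desc, Category.comp_id]
      · rw [hact, ha, map_comp_apply])
  refine ⟨x, hom_separated hS fun V f hf => ?_, eq_of_cover P.isSheaf hS fun V f hf => ?_⟩
  · exact (Category.assoc _ _ _).symm.trans (hx f hf).1
  · rw [← (hx f hf).2]
    exact (map_comp_apply P.F _ _ _).symm

end Representability

/-! ### Descent of algebras along flat ring maps -/

section RingDescent
open scoped TensorProduct
variable {R S M : Type u} [CommRing R] [CommRing S] [CommRing M] [Algebra R S] [Algebra R M]
  [Algebra S M] [IsScalarTower R S M]

/-- The invariants of a descent datum on an algebra descend it. -/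
lemma isPushout_equalizer [Module.Flat R S] (ρ : M →ₐ[R] S ⊗[R] M)
    (hs : ∀ s, ρ (algebraMap S M s) = s ⊗ₜ 1)
    (hc : ∀ m, Algebra.TensorProduct.productMap (IsScalarTower.toAlgHom R S M)
      (AlgHom.id R M) (ρ m) = m)
    (ha : ∀ m, Algebra.TensorProduct.map (AlgHom.id R S) ρ (ρ m) =
      Algebra.TensorProduct.map (AlgHom.id R S) Algebra.TensorProduct.includeRight (ρ m)) :
    Algebra.IsPushout R S (AlgHom.equalizer ρ Algebra.TensorProduct.includeRight) M := by
  let B := AlgHom.equalizer ρ (Algebra.TensorProduct.includeRight (R := R) (A := S) (B := M))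
  let ι : S ⊗[R] B →ₗ[R] S ⊗[R] M := B.val.toLinearMap.lTensor S
  let d : M →ₗ[R] S ⊗[R] M := ρ.toLinearMap -
    (Algebra.TensorProduct.includeRight (R := R) (A := S) (B := M)).toLinearMap
  -- By flatness, tensoring with S preserves the kernel B of ρ(m) - 1 ⊗ m. Coassociativity places
  -- ρ(m) in S ⊗ B, and ρ then inverts the multiplication map S ⊗ B → M.
  have hex : Function.Exact ι (d.lTensor S) := by
    refine Module.Flat.lTensor_exact S fun m => ?_
    constructor
    · intro h
      exact ⟨⟨m, sub_eq_zero.1 h⟩, rfl⟩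
    · rintro ⟨b, rfl⟩
      exact sub_eq_zero.2 b.2
  have hι : Function.Injective ι :=
    Module.Flat.lTensor_preserves_injective_linearMap _ Subtype.val_injective
  let μ : S ⊗[R] M →ₗ[R] M := (Algebra.TensorProduct.productMap (IsScalarTower.toAlgHom R S M)
      (AlgHom.id R M)).toLinearMap
  have hμρ : ∀ z, ρ (μ (ι z)) = ι z := by
    intro z
    induction z with
    | zero => simp
    | add x y hx hy => rw [map_add, map_add, map_add, hx, hy]
    | tmul s b =>
      have hb : ρ b.1 = 1 ⊗ₜ b.1 := b.2
      have h1 : ι (s ⊗ₜ b) = s ⊗ₜ b.1 := rfl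
      have h2 : μ (s ⊗ₜ b.1) = algebraMap S M s * b.1 :=
        Algebra.TensorProduct.productMap_apply_tmul _ _ _ _
      rw [h1, h2, map_mul, hs, hb, Algebra.TensorProduct.tmul_mul_tmul, mul_one, one_mul]
  have hbij : Function.Bijective (fun z => μ (ι z)) := by
    constructor
    · intro x y h
      refine hι ?_
      rw [← hμρ x, ← hμρ y]
      exact congrArg ρ h
    · intro m
      have h0 : d.lTensor S (ρ m) = 0 := by
        have h1 : d.lTensor S = ρ.toLinearMap.lTensor S -
          (Algebra.TensorProduct.includeRight (R := R) (A := S) (B := M)).toLinearMap.lTensor S :=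
          LinearMap.lTensor_sub _ _
        rw [h1, LinearMap.sub_apply, sub_eq_zero]
        exact ha m
      obtain ⟨z, hz⟩ := (hex _).1 h0
      exact ⟨z, by dsimp only; rw [hz]; exact hc m⟩
  refine ⟨?_⟩
  change Function.Bijective _
  convert hbij using 1
  ext z
  induction z with
  | zero => simp
  | add x y hx hy => simp only [map_add] at *; rw [hx, hy]
  | tmul s b =>
    refine Eq.trans ?_ (Algebra.TensorProduct.productMap_apply_tmul _ _ s b.1).symm
    exact Algebra.smul_def s b.1

end RingDescent
-- Spectra of étale algebras in the small étale site
section SpecDescent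
open scoped TensorProduct
variable {T : Scheme.{u}} {R : Type u} [CommRing R] (a : Spec (CommRingCat.of R) ⟶ T) [Etale a]

lemma etale_SpecMap_algebraMap (R N : Type u) [CommRing R] [CommRing N] [Algebra R N]
    [Algebra.Etale R N] : Etale (Spec.map (CommRingCat.ofHom (algebraMap R N))) :=
  (HasRingHomProperty.Spec_iff (P := @Etale)).2 (RingHom.etale_algebraMap.2 inferInstance)

/-- The spectrum of an étale algebra over an affine étale scheme, as an étale scheme. -/
def etSpec (N : Type u) [CommRing N] [Algebra R N] [Algebra.Etale R N] : T.Etale :=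
  have := etale_SpecMap_algebraMap R N
  Scheme.Etale.mk (Spec.map (CommRingCat.ofHom (algebraMap R N)) ≫ a)

variable {N N' N'' : Type u} [CommRing N] [Algebra R N] [Algebra.Etale R N] [CommRing N']
  [Algebra R N'] [Algebra.Etale R N'] [CommRing N''] [Algebra R N''] [Algebra.Etale R N'']

/-- The morphism of spectra of étale algebras given by an algebra homomorphism. -/
def etSpecMap (g : N →ₐ[R] N') : etSpec a N' ⟶ etSpec a N :=
  etHom (Spec.map (CommRingCat.ofHom g.toRingHom)) (by
    change _ ≫ Spec.map _ ≫ a = Spec.map _ ≫ a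
    rw [← Spec.map_comp_assoc, ← CommRingCat.ofHom_comp, AlgHom.toRingHom_eq_coe,
      AlgHom.comp_algebraMap])

lemma etSpecMap_comp (g : N →ₐ[R] N') (g' : N' →ₐ[R] N'') :
    etSpecMap a (g'.comp g) = etSpecMap a g' ≫ etSpecMap a g :=
  et_hom_ext (Spec.map_comp (CommRingCat.ofHom g.toRingHom) (CommRingCat.ofHom g'.toRingHom))

lemma etSpecMap_injective : Function.Injective (etSpecMap a : (N →ₐ[R] N') → _) := by
  intro g g' h
  have h1 : Spec.map (CommRingCat.ofHom g.toRingHom) = Spec.map (CommRingCat.ofHom g'.toRingHom) :=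
    congrArg (·.left) h
  have h2 := congrArg CommRingCat.Hom.hom (Spec.map_injective h1)
  exact AlgHom.ext fun x => congr($h2 x)

/-- The structure morphism of the spectrum of an étale algebra. -/
abbrev etSpecStr (N : Type u) [CommRing N] [Algebra R N] [Algebra.Etale R N] :
    etSpec a N ⟶ etSpec a R := etSpecMap a (Algebra.ofId R N)

lemma etSpecMap_str (g : N →ₐ[R] N') : etSpecMap a g ≫ etSpecStr a N = etSpecStr a N' := by
  rw [← etSpecMap_comp]
  congr 1
  ext

lemma exists_etSpecMap_eq (y : etSpec a N' ⟶ etSpec a N)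
    (hy : y ≫ etSpecStr a N = etSpecStr a N') : ∃ g, y = etSpecMap a g := by
  obtain ⟨φ, hφ⟩ := Spec.map_surjective (show Spec (CommRingCat.of N') ⟶ Spec (CommRingCat.of N)
    from y.left)
  have h1 : Spec.map φ ≫ Spec.map (CommRingCat.ofHom (algebraMap R N)) =
      Spec.map (CommRingCat.ofHom (algebraMap R N')) := by
    rw [hφ]
    exact congrArg (·.left) hy
  rw [← Spec.map_comp] at h1
  have h2 := congrArg CommRingCat.Hom.hom (Spec.map_injective h1)
  refine ⟨⟨φ.hom, fun r => congr($h2 r)⟩, et_hom_ext hφ.symm⟩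

lemma etSpec_isPullback {S B M : Type u} [CommRing S] [CommRing B] [CommRing M] [Algebra R S]
    [Algebra R B] [Algebra R M] [Algebra S M] [Algebra B M] [IsScalarTower R S M]
    [IsScalarTower R B M] [Algebra.Etale R S] [Algebra.Etale R B] [Algebra.Etale R M]
    [Algebra.IsPushout R S B M] :
    IsPullback (etSpecMap a (IsScalarTower.toAlgHom R S M))
      (etSpecMap a (IsScalarTower.toAlgHom R B M)) (etSpecStr a S) (etSpecStr a B) := by
  have h := isPullback_SpecMap_of_isPushout _ _ _ _ (CommRingCat.isPushout_of_isPushout R S B M)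
  have : ReflectsLimit (cospan (etSpecStr a S) (etSpecStr a B))
    (Scheme.Etale.forget T ⋙ Over.forget T) :=
    reflectsLimit_of_reflectsIsomorphisms _ _
  exact IsPullback.of_map (Scheme.Etale.forget T ⋙ Over.forget T)
    ((etSpecMap_str a _).trans (etSpecMap_str a _).symm) h

end SpecDescent

/-! ### Descent of representing objects -/

section EffectiveDescent
variable {T : Scheme.{u}} {F : (T.Etale)ᵒᵖ ⥤ Type u}

lemma isPullback_left {P X Y Z : T.Etale} {p : P ⟶ X} {q : P ⟶ Y} {f : X ⟶ Z} {g : Y ⟶ Z}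
    (sq : IsPullback p q f g) : IsPullback p.left q.left f.left g.left :=
  sq.map (Scheme.Etale.forget T ⋙ Over.forget T)

lemma surjective_of_isPullback {P X Y Z : T.Etale} {p : P ⟶ X} {q : P ⟶ Y} {f : X ⟶ Z} {g : Y ⟶ Z}
    (sq : IsPullback p q f g) [Surjective f.left] : Surjective q.left := by
  refine ⟨fun y => ?_⟩
  obtain ⟨x, hx⟩ := f.left.surjective (g.left y)
  obtain ⟨w, -, hw⟩ := exists_of_isPullback (isPullback_left sq) x y hx
  exact ⟨w, hw⟩

/-- Representability descends along étale surjections, once the representing object does. -/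
lemma exists_representsOver_of_isPullback (hF : Presieve.IsSheaf T.smallEtaleTopology F)
    {X Y U V : T.Etale} {u : X ⟶ U} {h : X ⟶ Y} {f : U ⟶ V} {v : Y ⟶ V}
    (sq : IsPullback u h f v) [Surjective f.left] {τ : F.obj (op X)}
    (hX : RepresentsOver F u τ)
    (hr : ∀ (W : T.Etale) (x x' : W ⟶ X), x ≫ u ≫ f = x' ≫ u ≫ f →
      F.map x.op τ = F.map x'.op τ → x ≫ h = x' ≫ h) :
    ∃ σ : F.obj (op Y), RepresentsOver F v σ := by
  have := surjective_of_isPullback sq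
  -- To compare τ along k and k' with the same image in Y, take the point x of X over k' carrying
  -- the section pulled back along k. Its image in Y is the common one by `hr`, so x = k' by the
  -- pullback property.
  obtain ⟨σ, hσ⟩ := exists_descent hF h τ (fun W k k' hk => by
    obtain ⟨x, hx, hxτ⟩ := hX.exists_lift (k' ≫ u) (F.map k.op τ)
    have h1 : x ≫ h = k ≫ h := hr _ _ _ (by
      rw [reassoc_of% hx, sq.w, reassoc_of% hk]) hxτ
    have h2 : x = k' := sq.hom_ext hx (h1.trans hk)
    rw [← hxτ, h2])
  have key : ∀ (W : T.Etale) (y y' : W ⟶ Y), y ≫ v = y' ≫ v →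
      F.map y.op σ = F.map y'.op σ → y = y' := by
    intro W y y' h1 h2
    let w := etFst (y ≫ v) f
    let k' := etSnd (y ≫ v) f
    have hw : w ≫ y ≫ v = k' ≫ f := (et_isPullback (y ≫ v) f).w
    have := surjective_of_isPullback (et_isPullback (y ≫ v) f).flip
    have h3 : sq.lift k' (w ≫ y) (by rw [← hw, Category.assoc]) =
        sq.lift k' (w ≫ y') (by rw [Category.assoc, ← h1, hw]) := by
      refine hX.ext (by rw [sq.lift_fst, sq.lift_fst]) ?_
      rw [← hσ, ← map_comp_apply, ← map_comp_apply, sq.lift_snd, sq.lift_snd,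
        map_comp_apply, map_comp_apply, h2]
    refine hom_separated (singleton_mem_smallEtale w) ?_
    rintro Z _ ⟨_, l, _, ⟨⟩, rfl⟩
    have h4 := congrArg (· ≫ h) h3
    simp only [sq.lift_snd] at h4
    rw [Category.assoc, Category.assoc, h4]
  refine ⟨σ, .mk' key fun W k t => ?_⟩
  let w := etFst k f
  let k' := etSnd k f
  have hw : w ≫ k = k' ≫ f := (et_isPullback k f).w
  have := surjective_of_isPullback (et_isPullback k f).flip
  obtain ⟨x, hx, hxt⟩ := hX.exists_lift k' (F.map w.op t)
  -- Over the covering W ×_V U the section t is classified by a map to X; its composite with h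
  -- descends to W because maps to Y are determined by their base point and section.
  obtain ⟨y, hy⟩ := exists_descent (P := yoneda.obj Y)
    (GrothendieckTopology.Subcanonical.isSheaf_of_isRepresentable _) w (x ≫ h)
    (fun Z l l' hl => key Z (l ≫ x ≫ h) (l' ≫ x ≫ h) (by
        simp only [Category.assoc, ← sq.w, reassoc_of% hx]
        rw [← hw, reassoc_of% hl]) (by
        rw [map_comp_apply, map_comp_apply F (x ≫ h), map_comp_apply, hσ, hxt,
          ← map_comp_apply, ← map_comp_apply, hl]))
  replace hy : w ≫ y = x ≫ h := hy
  refine ⟨y, hom_separated (singleton_mem_smallEtale w) ?_,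
    eq_of_cover hF (singleton_mem_smallEtale w) ?_⟩
  · rintro Z _ ⟨_, l, _, ⟨⟩, rfl⟩
    rw [Category.assoc, Category.assoc, reassoc_of% hy, ← sq.w, reassoc_of% hx, hw]
  · rintro Z _ ⟨_, l, _, ⟨⟩, rfl⟩
    rw [map_comp_apply, map_comp_apply, ← map_comp_apply F y w, hy, map_comp_apply, hσ, hxt]

open scoped TensorProduct

lemma etale_tensor (R S M : Type u) [CommRing R] [CommRing S] [CommRing M] [Algebra R S]
    [Algebra R M] [Algebra.Etale R S] [Algebra.Etale R M] : Algebra.Etale R (S ⊗[R] M) :=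
  Algebra.Etale.comp R S (S ⊗[R] M)

attribute [local instance] etale_tensor

variable {R S M : Type u} [CommRing R] (a : Spec (CommRingCat.of R) ⟶ T) [Etale a]
    [CommRing S] [CommRing M] [Algebra R S] [Algebra R M] [Algebra.Etale R S] [Algebra.Etale R M]

lemma etSpec_isPullback_tensor :
    IsPullback (etSpecMap a (Algebra.TensorProduct.includeLeft : S →ₐ[R] S ⊗[R] M))
      (etSpecMap a (Algebra.TensorProduct.includeRight : M →ₐ[R] S ⊗[R] M))
      (etSpecStr a S) (etSpecStr a M) := by
  have h := isPullback_SpecMap_of_isPushout _ _ _ _ (CommRingCat.isPushout_tensorProduct R S M)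
  have : ReflectsLimit (cospan (etSpecStr a S) (etSpecStr a M))
    (Scheme.Etale.forget T ⋙ Over.forget T) :=
    reflectsLimit_of_reflectsIsomorphisms _ _
  exact IsPullback.of_map (Scheme.Etale.forget T ⋙ Over.forget T)
    ((etSpecMap_str a _).trans (etSpecMap_str a _).symm) h

variable [Algebra S M] [IsScalarTower R S M]

/-- The descent datum on a representing object. -/
lemma exists_coaction {τ : F.obj (op (etSpec a M))}
    (hX : RepresentsOver F (etSpecMap a (IsScalarTower.toAlgHom R S M)) τ) :
    ∃ ρ : M →ₐ[R] S ⊗[R] M,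
      etSpecMap a ρ ≫ etSpecMap a (IsScalarTower.toAlgHom R S M) =
        etSpecMap a Algebra.TensorProduct.includeLeft ∧
      F.map (etSpecMap a ρ).op τ = F.map (etSpecMap a
        (Algebra.TensorProduct.includeRight : M →ₐ[R] S ⊗[R] M)).op τ := by
  -- A point of Spec (S ⊗ M) is a point of Spec S together with a point of Spec M; r keeps the first
  -- as base and the section carried by the second.
  obtain ⟨r, hr1, hr2⟩ := hX.exists_lift
    (etSpecMap a (Algebra.TensorProduct.includeLeft : S →ₐ[R] S ⊗[R] M))
    (F.map (etSpecMap a (Algebra.TensorProduct.includeRight : M →ₐ[R] S ⊗[R] M)).op τ)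
  obtain ⟨ρ, rfl⟩ := exists_etSpecMap_eq a r (by
    rw [← etSpecMap_str a (IsScalarTower.toAlgHom R S M), reassoc_of% hr1, etSpecMap_str])
  exact ⟨ρ, hr1, hr2⟩

variable {τ : F.obj (op (etSpec a M))}
    (hX : RepresentsOver F (etSpecMap a (IsScalarTower.toAlgHom R S M)) τ) {ρ : M →ₐ[R] S ⊗[R] M}
    (hr1 : etSpecMap a ρ ≫ etSpecMap a (IsScalarTower.toAlgHom R S M) =
        etSpecMap a Algebra.TensorProduct.includeLeft)
    (hr2 : F.map (etSpecMap a ρ).op τ = F.map (etSpecMap a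
        (Algebra.TensorProduct.includeRight : M →ₐ[R] S ⊗[R] M)).op τ)

include hX hr1 hr2

/-- Morphisms into Spec M agree once their projections to Spec S and the pullbacks of τ agree; both
identities are checked this way. -/
lemma coaction_counit : (Algebra.TensorProduct.productMap (IsScalarTower.toAlgHom R S M)
    (AlgHom.id R M)).comp ρ = AlgHom.id R M := by
  refine etSpecMap_injective a (hX.ext ?_ ?_)
  · rw [etSpecMap_comp, Category.assoc, hr1, ← etSpecMap_comp, ← etSpecMap_comp]
    congr 1
    ext s
    simp
  · rw [etSpecMap_comp, map_comp_apply, hr2, ← map_comp_apply, ← etSpecMap_comp,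
      Algebra.TensorProduct.productMap_right]

lemma coaction_assoc :
    (Algebra.TensorProduct.map (AlgHom.id R S) ρ).comp ρ =
      (Algebra.TensorProduct.map (AlgHom.id R S)
        (Algebra.TensorProduct.includeRight : M →ₐ[R] S ⊗[R] M)).comp ρ := by
  refine etSpecMap_injective a (hX.ext ?_ ?_)
  · rw [etSpecMap_comp, etSpecMap_comp, Category.assoc, Category.assoc, hr1, ← etSpecMap_comp,
      ← etSpecMap_comp]
    congr 1
    ext s
    simp
  · rw [etSpecMap_comp, etSpecMap_comp, map_comp_apply, map_comp_apply, hr2, ← map_comp_apply,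
      ← map_comp_apply, ← etSpecMap_comp, ← etSpecMap_comp,
      Algebra.TensorProduct.map_comp_includeRight, Algebra.TensorProduct.map_comp_includeRight,
      etSpecMap_comp, etSpecMap_comp, map_comp_apply, map_comp_apply, hr2]

/-- Points x and x' with the same base point in Spec R and the same section are related by the
descent datum: the pair of the S-component of x' and x is a point l of Spec (S ⊗ M), and ρ carries l
to x'. Functions invariant under ρ cannot separate x from x'. -/
lemma coaction_comp_eq {B : Type u} [CommRing B] [Algebra R B] [Algebra.Etale R B]
    (i : B →ₐ[R] M) (hi : ρ.comp i = Algebra.TensorProduct.includeRight.comp i) (W : T.Etale)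
    (x x' : W ⟶ etSpec a M)
    (h1 : x ≫ etSpecMap a (IsScalarTower.toAlgHom R S M) ≫ etSpecStr a S =
      x' ≫ etSpecMap a (IsScalarTower.toAlgHom R S M) ≫ etSpecStr a S)
    (h2 : F.map x.op τ = F.map x'.op τ) : x ≫ etSpecMap a i = x' ≫ etSpecMap a i := by
  have hrh : etSpecMap a ρ ≫ etSpecMap a i =
      etSpecMap a Algebra.TensorProduct.includeRight ≫ etSpecMap a i := by
    rw [← etSpecMap_comp, ← etSpecMap_comp, hi]
  rw [etSpecMap_str] at h1
  obtain ⟨l, hl1, hl2⟩ : ∃ l : W ⟶ etSpec a (S ⊗[R] M),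
      l ≫ etSpecMap a Algebra.TensorProduct.includeLeft =
        x' ≫ etSpecMap a (IsScalarTower.toAlgHom R S M) ∧
      l ≫ etSpecMap a Algebra.TensorProduct.includeRight = x :=
    (etSpec_isPullback_tensor a).exists_lift _ _ (by rw [Category.assoc, etSpecMap_str, h1])
  have h3 : l ≫ etSpecMap a ρ = x' := by
    refine hX.ext ?_ ?_
    · rw [Category.assoc, hr1, hl1]
    · rw [map_comp_apply, hr2, ← map_comp_apply, hl2, h2]
  rw [← h3, Category.assoc, hrh, ← Category.assoc, hl2]

-- The invariants of the coaction form an R-algebra B with S ⊗ B isomorphic to M. It is étale over R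
-- because étaleness descends along the faithfully flat map R → S, and its spectrum represents the
-- sheaf.
omit hr1 hr2 in
lemma exists_representsOver_of_etSpec (hF : Presieve.IsSheaf T.smallEtaleTopology F)
    [Algebra.Etale S M] [Module.FaithfullyFlat R S] :
    ∃ (Y : T.Etale) (v : Y ⟶ etSpec a R) (σ : F.obj (op Y)), RepresentsOver F v σ := by
  obtain ⟨ρ, hr1, hr2⟩ := exists_coaction a hX
  have hs : ρ.comp (IsScalarTower.toAlgHom R S M) = Algebra.TensorProduct.includeLeft :=
    etSpecMap_injective a (by rw [etSpecMap_comp, hr1])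
  have hc := coaction_counit a hX hr1 hr2
  have ha := coaction_assoc a hX hr1 hr2
  have hB : Algebra.IsPushout R S (AlgHom.equalizer ρ Algebra.TensorProduct.includeRight) M :=
    isPushout_equalizer ρ (fun s => congr($hs s)) (fun m => congr($hc m)) (fun m => congr($ha m))
  have : Algebra.Etale S (S ⊗[R] (AlgHom.equalizer ρ Algebra.TensorProduct.includeRight)) :=
    .of_equiv (Algebra.IsPushout.equiv R S _ M).symm
  have : Algebra.Etale R (AlgHom.equalizer ρ Algebra.TensorProduct.includeRight) :=
    Algebra.Etale.of_etale_tensorProduct_of_faithfullyFlat (T := S)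
  have hsurj : Surjective (etSpecStr a S).left :=
    ((flat_and_surjective_SpecMap_iff (CommRingCat.ofHom (algebraMap R S))).2
      ((RingHom.faithfullyFlat_algebraMap_iff).2 inferInstance)).2
  obtain ⟨σ, hσ⟩ := exists_representsOver_of_isPullback hF (etSpec_isPullback a
    (B := AlgHom.equalizer ρ Algebra.TensorProduct.includeRight)) hX
    (coaction_comp_eq a hX hr1 hr2 _ (AlgHom.ext fun b => b.2))
  exact ⟨_, _, σ, hσ⟩

end EffectiveDescent

/-! ### Representability over affine étale schemes -/

section AffineRepresentability
variable {T : Scheme.{u}}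

/-- An isomorphism in the small étale site from an isomorphism of schemes over the base. -/
abbrev etIso {U V : T.Etale} (e : U.left ≅ V.left) (h : e.hom ≫ V.hom = U.hom) : U ≅ V where
  hom := etHom e.hom h
  inv := etHom e.inv (by rw [← h, e.inv_hom_id_assoc])
  hom_inv_id := et_hom_ext e.hom_inv_id
  inv_hom_id := et_hom_ext e.inv_hom_id

/-- An affine étale scheme is the spectrum of its global sections. -/
abbrev specΓ (V : T.Etale) [IsAffine V.left] : Spec (CommRingCat.of Γ(V.left, ⊤)) ⟶ T :=
  V.left.isoSpec.inv ≫ V.hom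

lemma etale_appTop {U V : T.Etale} [IsAffine V.left] [IsAffine U.left] (f : U ⟶ V) :
    f.left.appTop.hom.Etale :=
  HasRingHomProperty.appTop (P := @Etale) f.left inferInstance

/-- An affine étale scheme over an affine étale scheme is the spectrum of an étale algebra. -/
def etSpecIso {U V : T.Etale} [IsAffine V.left] [IsAffine U.left] (f : U ⟶ V)
    [Algebra Γ(V.left, ⊤) Γ(U.left, ⊤)] [Algebra.Etale Γ(V.left, ⊤) Γ(U.left, ⊤)]
    (h : algebraMap Γ(V.left, ⊤) Γ(U.left, ⊤) = f.left.appTop.hom) :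
    etSpec (specΓ V) Γ(U.left, ⊤) ≅ U :=
  etIso U.left.isoSpec.symm (by
    change U.left.isoSpec.inv ≫ U.hom = Spec.map (CommRingCat.ofHom (algebraMap _ _)) ≫ _
    rw [h, ← et_w f]
    exact (Scheme.isoSpec_inv_naturality_assoc f.left V.hom).symm)

lemma exists_representsOver_affine {A : Type u} [Finite A] (P : PrincipalSheaf T A) (V : T.Etale)
    [IsAffine V.left] :
    ∃ (Y : T.Etale) (v : Y ⟶ V) (σ : P.F.obj (op Y)), RepresentsOver P.F v σ := by
  obtain ⟨U, f, hU, hf, ⟨s⟩⟩ := P.exists_affine V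
  obtain ⟨τ, -, hτ⟩ := exists_representsOver_of_section P s
  let X := etSigma fun _ : A => U
  let u : X ⟶ U := etSigmaDesc (fun _ : A => U) fun _ => 𝟙 U
  -- Finiteness of A is used here: a finite disjoint union of affine schemes is affine, so ring
  -- descent applies.
  have hX : IsAffine X.left := inferInstanceAs (IsAffine (∐ fun _ : A => U.left))
  let := f.left.appTop.hom.toAlgebra
  let := u.left.appTop.hom.toAlgebra
  let := (u ≫ f).left.appTop.hom.toAlgebra
  have : IsScalarTower Γ(V.left, ⊤) Γ(U.left, ⊤) Γ(X.left, ⊤) := .of_algebraMap_eq' (by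
    change (u ≫ f).left.appTop.hom = u.left.appTop.hom.comp f.left.appTop.hom
    rw [← CommRingCat.hom_comp, ← Scheme.Hom.comp_appTop, et_comp_left])
  have : Algebra.Etale Γ(V.left, ⊤) Γ(U.left, ⊤) := etale_appTop f
  have : Algebra.Etale Γ(U.left, ⊤) Γ(X.left, ⊤) := etale_appTop u
  have : Algebra.Etale Γ(V.left, ⊤) Γ(X.left, ⊤) := etale_appTop (u ≫ f)
  have : Module.FaithfullyFlat Γ(V.left, ⊤) Γ(U.left, ⊤) :=
    (Flat.flat_and_surjective_iff_faithfullyFlat_of_isAffine f.left).1 ⟨inferInstance, hf⟩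
  let eU := etSpecIso f rfl
  let eX := etSpecIso (u ≫ f) rfl
  have hS := hτ.of_iso eX eU.symm
  have hu : eX.hom ≫ u ≫ eU.inv = etSpecMap (specΓ V)
      (IsScalarTower.toAlgHom Γ(V.left, ⊤) Γ(U.left, ⊤) Γ(X.left, ⊤)) := by
    rw [← Category.assoc, Iso.comp_inv_eq]
    exact et_hom_ext (Scheme.isoSpec_inv_naturality u.left).symm
  change RepresentsOver P.F (eX.hom ≫ u ≫ eU.inv) _ at hS
  rw [hu] at hS
  obtain ⟨Y, v, σ, h⟩ := exists_representsOver_of_etSpec (specΓ V) hS P.isSheaf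
  have hV : algebraMap Γ(V.left, ⊤) Γ(V.left, ⊤) = (𝟙 V : V ⟶ V).left.appTop.hom := by
    change RingHom.id _ = (𝟙 V.left : V.left ⟶ V.left).appTop.hom
    simp
  exact ⟨Y, _, _, h.of_iso (Iso.refl Y) (etSpecIso (𝟙 V) hV)⟩

end AffineRepresentability

/-! ### Gluing the representing objects over affine opens of the base -/

section Gluing
variable {T : Scheme.{u}}

/-- An affine open of the base, as an étale scheme over the base. -/
abbrev affO (U : T.affineOpens) : T.Etale := Scheme.Etale.mk U.1.ι

/-- The inclusion of affine opens. -/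
abbrev affHom {U V : T.affineOpens} (h : U ≤ V) : affO U ⟶ affO V :=
  etHom (T.homOfLE h) (T.homOfLE_ι h)

lemma affO_hom_ext {U : T.affineOpens} {W : T.Etale} (k k' : W ⟶ affO U) : k = k' :=
  et_hom_ext ((cancel_mono U.1.ι).1 ((et_w k).trans (et_w k').symm))

lemma affO_cover {W : T.Etale} {U₁ U₂ : T.affineOpens} (k₁ : W ⟶ affO U₁) (k₂ : W ⟶ affO U₂) :
    ∃ S ∈ T.smallEtaleTopology W, ∀ ⦃V : T.Etale⦄ (f : V ⟶ W), S f →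
      ∃ U : T.affineOpens, U ≤ U₁ ∧ U ≤ U₂ ∧ Nonempty (V ⟶ affO U) := by
  refine ⟨⟨fun V f => ∃ U : T.affineOpens, U ≤ U₁ ∧ U ≤ U₂ ∧ Nonempty (V ⟶ affO U), ?_⟩,
    (mem_smallEtale_iff _).2 fun x => ?_, fun V f h => h⟩
  · rintro V V' f ⟨U, h₁, h₂, ⟨k⟩⟩ g
    exact ⟨U, h₁, h₂, ⟨g ≫ k⟩⟩
  · have hx₁ : W.hom x ∈ U₁.1 := by
      rw [← et_w k₁]
      exact (k₁.left x).2
    have hx₂ : W.hom x ∈ U₂.1 := by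
      rw [← et_w k₂]
      exact (k₂.left x).2
    obtain ⟨O, hO, hxO, hO'⟩ := exists_isAffineOpen_mem_and_subset
      (show W.hom x ∈ U₁.1 ⊓ U₂.1 from ⟨hx₁, hx₂⟩)
    refine ⟨etOpen W (W.hom ⁻¹ᵁ O), etOpenι _ _, ⟨⟨O, hO⟩, fun y hy => (hO' hy).1,
      fun y hy => (hO' hy).2, ⟨etHom (W.hom ∣_ O) (morphismRestrict_ι _ _)⟩⟩, ⟨x, hxO⟩, rfl⟩

lemma exists_affO_cover (W : T.Etale) :
    ∃ S ∈ T.smallEtaleTopology W, ∀ ⦃V : T.Etale⦄ (f : V ⟶ W), S f →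
      ∃ U : T.affineOpens, Nonempty (V ⟶ affO U) := by
  refine ⟨⟨fun V f => ∃ U : T.affineOpens, Nonempty (V ⟶ affO U), ?_⟩,
    (mem_smallEtale_iff _).2 fun x => ?_, fun V f h => h⟩
  · rintro V V' f ⟨U, ⟨k⟩⟩ g
    exact ⟨U, ⟨g ≫ k⟩⟩
  · obtain ⟨O, hO, hxO, -⟩ := exists_isAffineOpen_mem_and_subset
      (show W.hom x ∈ (⊤ : T.Opens) from trivial)
    exact ⟨etOpen W (W.hom ⁻¹ᵁ O), etOpenι _ _, ⟨⟨O, hO⟩,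
      ⟨etHom (W.hom ∣_ O) (morphismRestrict_ι _ _)⟩⟩, ⟨x, hxO⟩, rfl⟩

variable {F : (T.Etale)ᵒᵖ ⥤ Type u} {Y : T.affineOpens → T.Etale} {v : ∀ U, Y U ⟶ affO U}
  {σ : ∀ U, F.obj (op (Y U))} (h : ∀ U, RepresentsOver F (v U) (σ U))

include h in
/-- The transition maps between representing objects over affine opens. -/
def affTrans {U V : T.affineOpens} (hUV : U ≤ V) : Y U ⟶ Y V :=
  ((h V).exists_lift (v U ≫ affHom hUV) (σ U)).choose

lemma affTrans_comp {U V : T.affineOpens} (hUV : U ≤ V) :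
    affTrans h hUV ≫ v V = v U ≫ affHom hUV :=
  ((h V).exists_lift (v U ≫ affHom hUV) (σ U)).choose_spec.1

lemma map_affTrans {U V : T.affineOpens} (hUV : U ≤ V) :
    F.map (affTrans h hUV).op (σ V) = σ U :=
  ((h V).exists_lift (v U ≫ affHom hUV) (σ U)).choose_spec.2

/-- Restricting to a smaller affine open of the base replaces a representing object by its
restriction, which is the equifibered condition of a relative gluing datum. -/
lemma isPullback_affTrans {U V : T.affineOpens} (hUV : U ≤ V) :
    IsPullback (affTrans h hUV) (v U) (v V) (affHom hUV) := by
  have h1 (s : PullbackCone (v V) (affHom hUV)) := (h U).exists_lift s.snd (F.map s.fst.op (σ V))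
  choose l hl hl' using h1
  refine ⟨⟨affTrans_comp h hUV⟩, ⟨PullbackCone.IsLimit.mk _ l (fun s => ?_) hl
    fun s m hm hm' => ?_⟩⟩
  · refine (h V).ext (affO_hom_ext _ _) ?_
    rw [map_comp_apply, map_affTrans, hl']
  · refine (h U).ext (hm'.trans (hl s).symm) ?_
    rw [hl', ← hm, map_comp_apply, map_affTrans]

/-- The representing objects over the affine opens as a diagram. -/
def affFunctor : T.affineOpens ⥤ T.Etale where
  obj := Y
  map f := affTrans h (leOfHom f)
  map_id U := (h U).ext (affO_hom_ext _ _) (by rw [map_affTrans, map_id_apply])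
  map_comp f g := (h _).ext (affO_hom_ext _ _) (by
    rw [map_comp_apply, map_affTrans, map_affTrans, map_affTrans])

/-- The relative gluing datum of the representing objects over the affine opens. -/
def affGluing : T.directedAffineCover.RelativeGluingData where
  functor := affFunctor h ⋙ Scheme.Etale.forget T ⋙ Over.forget T
  natTrans :=
    { app U := (v U).left
      naturality _ _ f := congrArg (·.left) (affTrans_comp h (leOfHom f)) }
  equifibered _ _ f := isPullback_left (isPullback_affTrans h (leOfHom f))

instance : Quiver.IsThin T.directedAffineCover.I₀ := inferInstanceAs (Quiver.IsThin T.affineOpens)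

instance : Small.{u} T.directedAffineCover.I₀ := inferInstanceAs (Small.{u} T.affineOpens)

instance : Etale (affGluing h).toBase := by
  refine (IsZariskiLocalAtSource.iff_of_openCover (affGluing h).cover).2 fun U => ?_
  change Etale (colimit.ι (affGluing h).functor U ≫ (affGluing h).toBase)
  rw [(affGluing h).ι_toBase U]
  change Etale ((v U).left ≫ (affO U).hom)
  rw [et_w]
  infer_instance

/-- The étale scheme glued from the representing objects over the affine opens. -/
def affGlued : T.Etale := Scheme.Etale.mk (affGluing h).toBase

/-- The inclusion of a representing object over an affine open. -/
def affι (U : T.affineOpens) : Y U ⟶ affGlued h :=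
  etHom (colimit.ι (affGluing h).functor U) (((affGluing h).ι_toBase U).trans (et_w (v U)))

lemma affTrans_affι {U V : T.affineOpens} (hUV : U ≤ V) :
    affTrans h hUV ≫ affι h V = affι h U :=
  et_hom_ext (colimit.w (affGluing h).functor (homOfLE hUV))

instance (U : T.affineOpens) : IsOpenImmersion (affι h U).left :=
  (affGluing h).cover.map_prop U

lemma affι_mono {U : T.affineOpens} {W : T.Etale} {x y : W ⟶ Y U}
    (hxy : x ≫ affι h U = y ≫ affι h U) : x = y :=
  et_hom_ext ((cancel_mono (affι h U).left).1 (congrArg (·.left) hxy))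

lemma exists_affι_lift {U : T.affineOpens} {W : T.Etale} (k : W ⟶ affO U) (x : W ⟶ affGlued h) :
    ∃ y : W ⟶ Y U, y ≫ affι h U = x := by
  have sq := (affGluing h).isPullback_natTrans_ι_toBase U
  have hk : k.left ≫ (T.directedAffineCover).f U = x.left ≫ (affGluing h).toBase :=
    (et_w k).trans (et_w x).symm
  refine ⟨etHom (sq.lift k.left x.left hk) ?_, et_hom_ext (sq.lift_snd _ _ _)⟩
  rw [← et_w (affι h U)]
  exact (sq.lift_snd_assoc _ _ _ _).trans (et_w x)

lemma affι_cover : Sieve.ofArrows Y (affι h) ∈ T.smallEtaleTopology (affGlued h) := by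
  refine (mem_smallEtale_iff _).2 fun x => ?_
  obtain ⟨y, hy⟩ := (affGluing h).cover.covers x
  exact ⟨_, affι h _, Sieve.ofArrows_mk _ _ _, y, hy⟩

/-- The intersection of two affine opens need not be affine, so the comparison is made locally over
smaller affine opens inside it, where both maps come from the same representing object. -/
lemma map_eq_of_affι (hF : Presieve.IsSheaf T.smallEtaleTopology F) {U₁ U₂ : T.affineOpens}
    {W : T.Etale} (k₁ : W ⟶ Y U₁) (k₂ : W ⟶ Y U₂) (hk : k₁ ≫ affι h U₁ = k₂ ≫ affι h U₂) :
    F.map k₁.op (σ U₁) = F.map k₂.op (σ U₂) := by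
  obtain ⟨S, hS, hU⟩ := affO_cover (k₁ ≫ v U₁) (k₂ ≫ v U₂)
  refine eq_of_cover hF hS fun V f hf => ?_
  obtain ⟨U, h₁, h₂, ⟨l⟩⟩ := hU f hf
  obtain ⟨m₁, hm₁, -⟩ := ((isPullback_affTrans h h₁).exists_lift (f ≫ k₁) l (affO_hom_ext _ _))
  obtain ⟨m₂, hm₂, -⟩ := ((isPullback_affTrans h h₂).exists_lift (f ≫ k₂) l (affO_hom_ext _ _))
  have hm : m₁ = m₂ := by
    refine affι_mono h ?_
    have e₁ : m₁ ≫ affι h U = f ≫ k₁ ≫ affι h U₁ := by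
      rw [← affTrans_affι h h₁, reassoc_of% hm₁]
    have e₂ : m₂ ≫ affι h U = f ≫ k₂ ≫ affι h U₂ := by
      rw [← affTrans_affι h h₂, reassoc_of% hm₂]
    rw [e₁, e₂, hk]
  rw [← map_comp_apply, ← map_comp_apply, ← hm₁, ← hm₂, map_comp_apply, map_comp_apply,
    map_affTrans, map_affTrans, hm]

lemma exists_section_affGlued (hF : Presieve.IsSheaf T.smallEtaleTopology F) :
    ∃ s : F.obj (op (affGlued h)), ∀ U, F.map (affι h U).op s = σ U := by
  obtain ⟨s, hs⟩ := exists_glue hF (affι_cover h)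
    (fun V f x => ∃ U, ∃ k : V ⟶ Y U, k ≫ affι h U = f ∧ x = F.map k.op (σ U))
    (fun V V' f g x ⟨U, k, hk, hx⟩ => ⟨U, g ≫ k, by rw [Category.assoc, hk], by
      rw [hx, map_comp_apply]⟩)
    (fun V f _ x y ⟨U, k, hk, hx⟩ ⟨U', k', hk', hy⟩ => by
      rw [hx, hy, map_eq_of_affι h hF k k' (hk.trans hk'.symm)])
    (fun V f hf => by
      obtain ⟨_, l, _, ⟨U⟩, hl⟩ := hf
      exact ⟨F.map l.op (σ U), U, l, hl, rfl⟩)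
  refine ⟨s, fun U => ?_⟩
  obtain ⟨U', k, hk, hx⟩ := hs (affι h U) (Sieve.ofArrows_mk Y (affι h) U)
  rw [hx, map_eq_of_affι h hF k (𝟙 _) (hk.trans (Category.id_comp _).symm), map_id_apply]

/-- A principal sheaf under a finite group is representable. -/
lemma exists_representable {A : Type u} [Finite A] (P : PrincipalSheaf T A) :
    ∃ (Y : T.Etale) (σ : P.F.obj (op Y)), ∀ (W : T.Etale) (t : P.F.obj (op W)),
      ∃! y : W ⟶ Y, P.F.map y.op σ = t := by
  have h0 (U : T.affineOpens) : ∃ (Y : T.Etale) (v : Y ⟶ affO U) (σ : P.F.obj (op Y)),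
      RepresentsOver P.F v σ := by
    have : IsAffine (affO U).left := U.2
    exact exists_representsOver_affine P _
  choose Y v σ h using h0
  obtain ⟨s, hs⟩ := exists_section_affGlued h P.isSheaf
  have huniq : ∀ (W : T.Etale) (x y : W ⟶ affGlued h),
      P.F.map x.op s = P.F.map y.op s → x = y := by
    intro W x y hxy
    obtain ⟨S, hS, hU⟩ := exists_affO_cover W
    refine hom_separated hS fun V f hf => ?_
    obtain ⟨U, ⟨k⟩⟩ := hU f hf
    obtain ⟨x', hx⟩ := exists_affι_lift h k (f ≫ x)
    obtain ⟨y', hy⟩ := exists_affι_lift h k (f ≫ y)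
    rw [← hx, ← hy, (h U).ext (affO_hom_ext (x' ≫ v U) (y' ≫ v U)) ?_]
    rw [← hs, ← map_comp_apply, ← map_comp_apply, hx, hy, map_comp_apply, map_comp_apply, hxy]
  refine ⟨affGlued h, s, fun W t => ?_⟩
  obtain ⟨S, hS, hU⟩ := exists_affO_cover W
  obtain ⟨x, hx⟩ := exists_glue (P := yoneda.obj (affGlued h))
    (GrothendieckTopology.Subcanonical.isSheaf_of_isRepresentable _) hS
    (fun V f x => P.F.map x.op s = P.F.map f.op t)
    (fun V V' f g x hx => by
      rw [map_comp_apply, ← hx]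
      exact map_comp_apply P.F _ _ _)
    (fun V f _ x y hx hy => huniq _ _ _ (hx.trans hy.symm))
    (fun V f hf => by
      obtain ⟨U, ⟨k⟩⟩ := hU f hf
      obtain ⟨y, -, hy⟩ := (h U).exists_lift k (P.F.map f.op t)
      exact ⟨y ≫ affι h U, by rw [map_comp_apply, hs, hy]⟩)
  have hxt : P.F.map x.op s = t := eq_of_cover P.isSheaf hS fun V f hf => by
    rw [← hx f hf]
    exact (map_comp_apply P.F _ _ _).symm
  exact ⟨x, hxt, fun y hy => huniq _ _ _ (hy.trans hxt.symm)⟩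

end Gluing

/-- Pulling the extension back along γ gives a morphism of short exact sequences that is the
identity on the kernel, and naturality of the extension class computes the result. -/
lemma exists_pullback_extension {T : Scheme.{u}} {S : ShortComplex (EtSh T)} (h : S.ShortExact)
    {Z : EtSh T} (γ : Z ⟶ S.X₃) :
    ∃ (E : EtSh T) (i : S.X₁ ⟶ E) (p : E ⟶ Z) (w : i ≫ p = 0)
      (h' : (ShortComplex.mk i p w).ShortExact),
      h'.extClass = (Ext.mk₀ γ).comp h.extClass (zero_add 1) := by
  have := h.mono_f
  have := h.epi_g
  let i : S.X₁ ⟶ pullback S.g γ := pullback.lift S.f 0 (by simp)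
  have hi : i ≫ pullback.fst S.g γ = S.f := pullback.lift_fst _ _ _
  have w : i ≫ pullback.snd S.g γ = 0 := pullback.lift_snd _ _ _
  have : Mono i := by
    have : Mono (i ≫ pullback.fst S.g γ) := by rw [hi]; infer_instance
    exact mono_of_mono i (pullback.fst S.g γ)
  have hk : IsLimit (KernelFork.ofι i w) := KernelFork.IsLimit.ofι' i w fun {W} k hk =>
    ⟨h.fIsKernel.lift (KernelFork.ofι (k ≫ pullback.fst S.g γ) (by
      rw [Category.assoc, pullback.condition, reassoc_of% hk, zero_comp])), by
      refine pullback.hom_ext ?_ ?_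
      · rw [Category.assoc, hi]
        exact h.fIsKernel.fac _ WalkingParallelPair.zero
      · rw [Category.assoc, w, comp_zero, hk]⟩
  have h' : (ShortComplex.mk i (pullback.snd S.g γ) w).ShortExact :=
    .mk' (ShortComplex.exact_of_f_is_kernel _ hk) inferInstance inferInstance
  refine ⟨_, i, _, w, h', ?_⟩
  let φ : ShortComplex.mk i (pullback.snd S.g γ) w ⟶ S :=
    { τ₁ := 𝟙 _, τ₂ := pullback.fst _ _, τ₃ := γ
      comm₁₂ := (Category.id_comp _).trans hi.symm, comm₂₃ := pullback.condition }
  rw [← ShortComplex.ShortExact.extClass_naturality h' h φ]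
  exact (Ext.comp_mk₀_id _).symm

/-! ### The fibre over 1 of an extension of ℤ -/

section TorsorSheaf
variable {T : Scheme.{u}} {A : Type u} [AddCommGroup A] {E : EtSh T} {i : constSh T A ⟶ E}
  {p : E ⟶ constSh T (ULift.{u} ℤ)} {w : i ≫ p = 0}

/-- The sheaf of sections of an extension of `ℤ` which lie over `1`. -/
def fibreOne (p : E ⟶ constSh T (ULift.{u} ℤ)) : (T.Etale)ᵒᵖ ⥤ Type u where
  obj U := {s : E.obj.obj U // p.hom.app U s = constSec T (ULift.{u} ℤ) U.unop ⟨1⟩}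
  map {U V} f := ↾fun s => ⟨E.obj.map f s.1, by
    have h1 := app_map_elt p f.unop s.1
    rw [s.2] at h1
    exact h1.trans (constSec_map _ _ _ _)⟩
  map_id U := by
    refine ConcreteCategory.hom_ext _ _ fun s => ?_
    exact Subtype.ext (map_id_elt E s.1)
  map_comp {U V W} f g := by
    refine ConcreteCategory.hom_ext _ _ fun s => ?_
    exact Subtype.ext (map_comp_elt E f.unop g.unop s.1)

lemma fibreOne_map {U V : T.Etale} (f : V ⟶ U) (s : (fibreOne p).obj (op U)) :
    ((fibreOne p).map f.op s).1 = E.obj.map f.op s.1 := rfl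

lemma isSheaf_fibreOne : Presieve.IsSheaf T.smallEtaleTopology (fibreOne p) := by
  intro U S hS x hx
  obtain ⟨t, ht, htu⟩ := isSheaf_forget E S hS (fun V f hf => (x f hf).1)
    (fun V₁ V₂ Z g₁ g₂ f₁ f₂ h₁ h₂ h => congrArg Subtype.val (hx g₁ g₂ h₁ h₂ h))
  have ht' : p.hom.app (op U) t = constSec T (ULift.{u} ℤ) U ⟨1⟩ := by
    refine sheaf_ext _ hS fun V f hf => ?_
    have h1 : E.obj.map f.op t = (x f hf).1 := ht f hf
    rw [← app_map_elt, h1, constSec_map]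
    exact (x f hf).2
  refine ⟨⟨t, ht'⟩, fun V f hf => Subtype.ext (ht f hf), fun s hs => Subtype.ext ?_⟩
  exact htu s.1 fun V f hf => congrArg Subtype.val (hs f hf)

lemma app_of_comp_eq_zero (w : i ≫ p = 0) {U : T.Etale} (c : (constSh T A).obj.obj (op U)) :
    p.hom.app (op U) (i.hom.app (op U) c) = 0 := by
  have h1 : (i ≫ p).hom.app (op U) c = 0 := by
    rw [w]
    rfl
  exact h1

/-- The action of `A` on the sheaf of sections over `1` of an extension of `ℤ` by `A`. -/
def fibreOneAct (w : i ≫ p = 0) (a : A) : fibreOne p ⟶ fibreOne p where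
  app U := ↾fun s => ⟨i.hom.app U (constSec T A U.unop a) + s.1, by
    have h1 := app_of_comp_eq_zero w (constSec T A U.unop a)
    rw [map_add, s.2]
    exact (congrArg (· + _) h1).trans (zero_add _)⟩
  naturality {U V} f := by
    ext s
    refine Subtype.ext ?_
    change i.hom.app V _ + E.obj.map f s.1 = E.obj.map f (i.hom.app U _ + s.1)
    rw [map_add]
    refine congrArg (· + _) ?_
    have h1 := app_map_elt i f.unop (constSec T A U.unop a)
    rw [constSec_map] at h1
    exact h1

lemma fibreOneAct_app (w : i ≫ p = 0) (a : A) {U : T.Etale} (s : (fibreOne p).obj (op U)) :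
    ((fibreOneAct w a).app (op U) s).1 = i.hom.app (op U) (constSec T A U a) + s.1 := rfl

/-- The torsor of sections over `1` of an extension of `ℤ` by a constant sheaf. -/
def principalSheaf (h : (ShortComplex.mk i p w).ShortExact) : PrincipalSheaf T A where
  F := fibreOne p
  isSheaf := isSheaf_fibreOne
  act := fibreOneAct w
  exists_act {U} s t := by
    obtain ⟨c, hc⟩ := exists_preimage_section h (t.1 - s.1) (by
      rw [map_sub]
      exact sub_eq_zero.2 (t.2.trans s.2.symm))
    obtain ⟨S, hS, ha⟩ := exists_constSec_local c
    refine ⟨S, hS, fun V f hf => ?_⟩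
    obtain ⟨a, ha⟩ := ha f hf
    refine ⟨a, Subtype.ext ?_⟩
    rw [fibreOneAct_app, fibreOne_map, fibreOne_map, ← ha, app_map_elt]
    rw [show i.hom.app (op U) c = t.1 - s.1 from hc, map_sub, sub_add_cancel]
  act_injective {U} _ s a b hab := by
    have := h.mono_f
    have h1 := congrArg Subtype.val hab
    rw [fibreOneAct_app, fibreOneAct_app, add_left_inj] at h1
    exact constSec_injective U (section_injective (ShortComplex.mk i p w).f U h1)
  exists_affine V _ := by
    have : Epi p := h.epi_g
    obtain ⟨U, f, hU, hf, t, ht⟩ := exists_affine_lift p (constSec T (ULift.{u} ℤ) V ⟨1⟩)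
    exact ⟨U, f, hU, hf, ⟨t, ht.trans (constSec_map _ _ _ _)⟩⟩

/-- The section 1 lifts to E étale-locally around every point of T, and each local lift is a map to
Y. -/
lemma surjective_of_representable (h : (ShortComplex.mk i p w).ShortExact) {Y : T.Etale}
    {σ : (fibreOne p).obj (op Y)}
    (hσ : ∀ (W : T.Etale) (t : (fibreOne p).obj (op W)), ∃! y : W ⟶ Y, (fibreOne p).map y.op σ = t) :
    Surjective Y.hom := by
  have : Epi p := h.epi_g
  refine ⟨fun x => ?_⟩
  obtain ⟨R, hR, ht⟩ := exists_local_lift p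
    (constSec T (ULift.{u} ℤ) (Scheme.Etale.mk (𝟙 T)) ⟨1⟩)
  obtain ⟨V, f, hf, v, hv⟩ := (mem_smallEtale_iff R).1 hR x
  obtain ⟨t, ht⟩ := ht f hf
  obtain ⟨y, -, -⟩ := hσ V ⟨t, ht.trans (constSec_map _ _ _ _)⟩
  refine ⟨y.left v, ?_⟩
  rw [← Scheme.Hom.comp_apply, et_w, ← et_w f, Scheme.Hom.comp_apply, hv]
  rfl

end TorsorSheaf

/-! ### The torsor structure on a representing object -/

section OfPrincipal
variable {T : Scheme.{u}} {A : Type u} (P : PrincipalSheaf T A) {Y : T.Etale}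
  {σ : P.F.obj (op Y)}
  (hσ : ∀ (W : T.Etale) (t : P.F.obj (op W)), ∃! y : W ⟶ Y, P.F.map y.op σ = t)

include hσ in
/-- The action on an object representing a principal sheaf. -/
def reprAct (a : A) : Y ⟶ Y := (hσ Y ((P.act a).app _ σ)).choose

lemma map_reprAct (a : A) : P.F.map (reprAct P hσ a).op σ = (P.act a).app _ σ :=
  (hσ Y ((P.act a).app _ σ)).choose_spec.1

lemma map_comp_reprAct (a : A) {U : T.Etale} (y : U ⟶ Y) :
    P.F.map (y ≫ reprAct P hσ a).op σ = (P.act a).app _ (P.F.map y.op σ) := by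
  rw [map_comp_apply, map_reprAct]
  exact (ConcreteCategory.congr_hom ((P.act a).naturality y.op) σ).symm

include hσ in
lemma repr_ext {W : T.Etale} {x y : W ⟶ Y} (h : P.F.map x.op σ = P.F.map y.op σ) : x = y :=
  (hσ W _).unique h rfl

/-- The disjoint union of copies of Y and the fibre product of Y with itself both represent the
sheaf over Y: the first by simple transitivity, as Y carries the section σ, and the second by the
universal property of Y. -/
lemma isIso_reprAct : IsIso (Sigma.desc (fun a : A => pullback.lift (f := Y.hom) (g := Y.hom)
    (𝟙 Y.left) (reprAct P hσ a).left
    ((Category.id_comp _).trans (Over.w ((Scheme.Etale.forget T).map (reprAct P hσ a))).symm)) :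
      ∐ (fun _ : A => Y.left) ⟶ pullback Y.hom Y.hom) := by
  obtain ⟨τ, hτ, hr⟩ := exists_representsOver_of_section P σ
  set g := Sigma.desc (fun a : A => pullback.lift (f := Y.hom) (g := Y.hom)
    (𝟙 Y.left) (reprAct P hσ a).left
    ((Category.id_comp _).trans (Over.w ((Scheme.Etale.forget T).map (reprAct P hσ a))).symm))
  let W : T.Etale := Scheme.Etale.mk (pullback.fst Y.hom Y.hom ≫ Y.hom)
  let y₁ : W ⟶ Y := etHom (pullback.fst Y.hom Y.hom) rfl
  let y₂ : W ⟶ Y := etHom (pullback.snd Y.hom Y.hom) pullback.condition.symm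
  let X := etSigma fun _ : A => Y
  let π : X ⟶ Y := etSigmaDesc (fun _ : A => Y) fun _ => 𝟙 Y
  let m : X ⟶ Y := etSigmaDesc (fun _ : A => Y) (reprAct P hσ)
  have hg₁ : g ≫ pullback.fst Y.hom Y.hom = π.left := Sigma.hom_ext _ _ fun a => by
    rw [Sigma.ι_desc_assoc, pullback.lift_fst]
    exact (Sigma.ι_desc (fun _ : A => 𝟙 Y.left) a).symm
  have hg₂ : g ≫ pullback.snd Y.hom Y.hom = m.left := Sigma.hom_ext _ _ fun a => by
    rw [Sigma.ι_desc_assoc, pullback.lift_snd]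
    exact (Sigma.ι_desc (fun a : A => (reprAct P hσ a).left) a).symm
  let g' : X ⟶ W := etHom g (by
    exact (Category.assoc _ _ _).symm.trans ((congrArg (· ≫ Y.hom) hg₁).trans (et_w π)))
  have e₁ : g' ≫ y₁ = π := et_hom_ext hg₁
  have e₂ : g' ≫ y₂ = m := et_hom_ext hg₂
  have hm : P.F.map (etSigmaDesc (fun _ : A => Y) (reprAct P hσ)).op σ = τ := by
    refine eq_of_cover P.isSheaf (etSigma_cover fun _ : A => Y) ?_
    rintro V _ ⟨_, l, _, ⟨a⟩, rfl⟩
    refine (map_comp_apply P.F _ _ _).trans (.trans (congrArg _ ?_)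
      (map_comp_apply P.F _ _ _).symm)
    rw [hτ, ← map_comp_apply, etSigmaι_desc, map_reprAct]
  obtain ⟨x, hx, hxτ⟩ := hr.exists_lift y₁ (P.F.map y₂.op σ)
  have hxm : x ≫ m = y₂ := repr_ext P hσ (by rw [map_comp_apply, hm, hxτ])
  have h1 : g' ≫ x = 𝟙 X := by
    refine hr.ext ?_ ?_
    · rw [Category.assoc, Category.id_comp]
      exact (congrArg (g' ≫ ·) hx).trans e₁
    · rw [map_comp_apply, hxτ, ← map_comp_apply, e₂, hm, map_id_apply]
  have h2 : x ≫ g' = 𝟙 W := by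
    refine et_hom_ext (pullback.hom_ext ?_ ?_)
    · have : (x ≫ g') ≫ y₁ = 𝟙 W ≫ y₁ := by
        rw [Category.assoc, e₁, Category.id_comp]
        exact hx
      exact congrArg (·.left) this
    · have : (x ≫ g') ≫ y₂ = 𝟙 W ≫ y₂ := by
        rw [Category.assoc, e₂, Category.id_comp, hxm]
      exact congrArg (·.left) this
  exact ⟨x.left, congrArg (·.left) h1, congrArg (·.left) h2⟩

end OfPrincipal

/-- Every class is represented by a torsor, under a finite group. -/
theorem exists_torsor {T : Scheme.{u}} {A : Type u} [AddCommGroup A] [Finite A] (x : H1 T A) :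
    ∃ P : Torsor T A, P.HasClass x := by
  obtain ⟨I, Q, j, q, w₀, h₀, -, γ, rfl⟩ := exists_boundary x
  obtain ⟨E, i, p, w, h, hx⟩ := exists_pullback_extension h₀ γ
  obtain ⟨Y, σ, hσ⟩ := exists_representable (principalSheaf h)
  have key : ∀ (U : T.Etale) (y : U ⟶ Y) (a : A), E.obj.map (y ≫ reprAct _ hσ a).op σ.1 =
      i.hom.app (op U) (constSec T A U a) + E.obj.map y.op σ.1 := fun U y a =>
    congrArg Subtype.val (map_comp_reprAct _ hσ a y)
  let P : Torsor T A :=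
    { Y := Y
      act := reprAct _ hσ
      act_zero := repr_ext _ hσ (Subtype.ext (by
        have h1 := key Y (𝟙 Y) 0
        rw [Category.id_comp, constSec_zero, map_zero, zero_add] at h1
        exact h1))
      act_add a b := repr_ext _ hσ (Subtype.ext (by
        have h1 := key Y (𝟙 Y) (a + b)
        have h2 := key Y (𝟙 Y) a
        have h3 := key Y (𝟙 Y ≫ reprAct _ hσ a) b
        rw [Category.id_comp] at h1 h2 h3
        rw [h2, ← add_assoc, ← map_add, ← constSec_add, add_comm b, ← h1] at h3
        exact h3.symm))
      surjective := surjective_of_representable h hσ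
      isIso := isIso_reprAct _ hσ }
  refine ⟨P, E, i, p, w, h, yonedaEquiv.symm σ.1, hx, fun U y a => key U y a,
    fun U y y' hy => repr_ext _ hσ (Subtype.ext hy), fun U s => ⟨fun hs => ?_, ?_⟩⟩
  · obtain ⟨y, hy, -⟩ := hσ U ⟨s, hs⟩
    exact ⟨y, congrArg Subtype.val hy⟩
  · rintro ⟨y, rfl⟩
    exact ((fibreOne p).map y.op σ).2

/-! ### Characters of finite groups -/

section FiniteDuality

/-- The chain ℚ/ℤ → ℝ/ℤ → unit circle → ℂ; it turns characters of a finite group into complex ones,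
whose number is bounded by the order of the group. -/
lemma exists_addChar_injective : ∃ χ : AddChar QZ.{u} ℂ, Function.Injective χ := by
  let c : ℚ →+ ℝ := (Rat.castHom ℝ).toAddMonoidHom
  have hc : AddSubgroup.zmultiples (1 : ℚ) = (AddSubgroup.zmultiples (1 : ℝ)).comap c := by
    ext x
    simp only [AddSubgroup.mem_zmultiples_iff, AddSubgroup.mem_comap]
    refine exists_congr fun n => ?_
    change _ ↔ n • (1 : ℝ) = (x : ℝ)
    simp only [zsmul_eq_mul, mul_one]
    exact_mod_cast Iff.rfl
  let m : AddCircle (1 : ℚ) →+ AddCircle (1 : ℝ) := QuotientAddGroup.map _ _ c hc.le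
  have hm : Function.Injective m := by
    refine (injective_iff_map_eq_zero m).2 fun x hx => ?_
    obtain ⟨x, rfl⟩ := QuotientAddGroup.mk_surjective x
    refine (QuotientAddGroup.eq_zero_iff x).2 ?_
    rw [hc]
    exact (QuotientAddGroup.eq_zero_iff (c x)).1 hx
  let m' : QZ.{u} →+ AddCircle (1 : ℝ) := m.comp (AddEquiv.ulift : QZ.{u} ≃+ _).toAddMonoidHom
  refine ⟨(Circle.coeHom.compAddChar AddCircle.toCircle_addChar).compAddMonoidHom m', ?_⟩
  exact Circle.coe_injective.comp ((AddCircle.injective_toCircle one_ne_zero).comp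
    (hm.comp ULift.down_injective))

variable {K : Type u} [AddCommGroup K] [Finite K]

omit [Finite K] in
variable (K) in
lemma exists_dual_injective : ∃ χ : Dual K → AddChar K ℂ, Function.Injective χ := by
  obtain ⟨χ, hχ⟩ := exists_addChar_injective.{u}
  exact ⟨fun a => χ.compAddMonoidHom a, fun a b h =>
    AddMonoidHom.ext fun k => hχ (DFunLike.congr_fun h k)⟩

instance : Finite (Dual K) := by
  have := Fintype.ofFinite K
  obtain ⟨χ, hχ⟩ := exists_dual_injective K
  exact .of_injective _ hχ

variable (K) in
lemma card_dual_le : Nat.card (Dual K) ≤ Nat.card K := by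
  have := Fintype.ofFinite K
  obtain ⟨χ, hχ⟩ := exists_dual_injective K
  refine (Nat.card_le_card_of_injective _ hχ).trans ?_
  rw [Nat.card_eq_fintype_card, Nat.card_eq_fintype_card]
  exact AddChar.card_addChar_le K ℂ

/-- A proper subgroup of the dual of a finite group kills a nonzero element. -/
lemma exists_ne_zero_of_ne_top {H : AddSubgroup (Dual K)} (hH : H ≠ ⊤) :
    ∃ k : K, k ≠ 0 ∧ ∀ a ∈ H, a k = 0 := by
  by_contra! hcon
  let ε : K →+ Dual H := AddMonoidHom.flip (AddSubgroup.subtype H)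
  have hε : Function.Injective ε := (injective_iff_map_eq_zero ε).2 fun k hk => by
    by_contra hk0
    obtain ⟨a, ha, hak⟩ := hcon k hk0
    exact hak (DFunLike.congr_fun hk ⟨a, ha⟩)
  -- If no nonzero element is killed by H, then |K| ≤ |H^∨| ≤ |H| < |K^∨| ≤ |K|.
  have h1 := (Nat.card_le_card_of_injective ε hε).trans (card_dual_le H)
  have h2 : Nat.card H < Nat.card (Dual K) := by
    have h3 := AddSubgroup.card_le_card_addGroup H
    refine lt_of_le_of_ne h3 fun h4 => hH (AddSubgroup.eq_top_of_card_eq _ h4)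
  exact absurd (card_dual_le K) (not_le.2 (h1.trans_lt h2))

end FiniteDuality

lemma finite_of_injective_of_torsion {G M : Type*} [AddCommGroup G] [AddGroup.FG G]
    [AddCommGroup M] (f : G →+ M) (hf : Function.Injective f)
    (hM : ∀ m : M, IsOfFinAddOrder m) : Finite G :=
  AddCommGroup.finite_of_fg_isAddTorsion G
    fun g => (hf.isOfFinAddOrder_iff (f := f)).1 (hM (f g))

/-! ### Local transitivity of the action on a torsor -/

section Trivialization
variable {T : Scheme.{u}} {A : Type u} [AddCommGroup A] (P : Torsor T A)
  {E : EtSh T} {i : constSh T A ⟶ E} {p : E ⟶ constSh T (ULift.{u} ℤ)} {w : i ≫ p = 0}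
  (h : (ShortComplex.mk i p w).ShortExact)
  (φ : yoneda.obj P.Y ⟶ E.obj ⋙ forget AddCommGrpCat.{u})
  (hact : ∀ (U : T.Etale) (y : U ⟶ P.Y) (a : A),
    (φ.app (op U) (y ≫ P.act a) : E.obj.obj (op U)) =
      i.hom.app (op U) (constSec T A U a) + (φ.app (op U) y : E.obj.obj (op U)))
  (hinj : ∀ U : T.Etale, Function.Injective (φ.app (op U)))
  (hsurj : ∀ (U : T.Etale) (s : E.obj.obj (op U)),
    p.hom.app (op U) s = constSec T (ULift.{u} ℤ) U ⟨1⟩ ↔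
      ∃ y : U ⟶ P.Y, φ.app (op U) y = s)

lemma app_yoneda_comp {Y : T.Etale} (φ : yoneda.obj Y ⟶ E.obj ⋙ forget AddCommGrpCat.{u})
    {U V : T.Etale} (f : V ⟶ U) (y : U ⟶ Y) :
    (φ.app (op V) (f ≫ y) : E.obj.obj (op V)) =
      E.obj.map f.op (φ.app (op U) y : E.obj.obj (op U)) :=
  ConcreteCategory.congr_hom (φ.naturality f.op) y

include h hact hinj hsurj in
lemma exists_act_local {W : T.Etale} (k k' : W ⟶ P.Y) :
    ∃ S ∈ T.smallEtaleTopology W, ∀ ⦃V : T.Etale⦄ (f : V ⟶ W), S f →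
      ∃ a, f ≫ k' = (f ≫ k) ≫ P.act a := by
  let s : E.obj.obj (op W) := φ.app (op W) k
  let s' : E.obj.obj (op W) := φ.app (op W) k'
  have h1 : p.hom.app (op W) s = _ := (hsurj W _).2 ⟨k, rfl⟩
  have h2 : p.hom.app (op W) s' = _ := (hsurj W _).2 ⟨k', rfl⟩
  obtain ⟨c, hc⟩ := exists_preimage_section h (s' - s) (by
    rw [map_sub]
    exact sub_eq_zero.2 (h2.trans h1.symm))
  obtain ⟨S, hS, ha⟩ := exists_constSec_local c
  refine ⟨S, hS, fun V f hf => ?_⟩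
  obtain ⟨a, ha⟩ := ha f hf
  refine ⟨a, hinj V ?_⟩
  refine Eq.trans ?_ (hact V (f ≫ k) a).symm
  rw [← ha, app_map_elt, app_yoneda_comp, app_yoneda_comp]
  change E.obj.map f.op s' = _ + E.obj.map f.op s
  rw [show i.hom.app (op W) c = s' - s from hc, map_sub, sub_add_cancel]

end Trivialization

/-- A torsor is a simply transitive action locally on the base. -/
lemma Torsor.HasClass.exists_act_local {T : Scheme.{u}} {A : Type u} [AddCommGroup A]
    {P : Torsor T A} {x : H1 T A} (hP : P.HasClass x) {W : T.Etale} (k k' : W ⟶ P.Y) :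
    ∃ S ∈ T.smallEtaleTopology W, ∀ ⦃V : T.Etale⦄ (f : V ⟶ W), S f →
      ∃ a, f ≫ k' = (f ≫ k) ≫ P.act a := by
  obtain ⟨E, i, p, w, h, φ, -, hact, hinj, hsurj⟩ := hP
  exact EtaleTorsor.exists_act_local P h φ hact hinj hsurj k k'

/-! ### Fibres of a torsor and invariant clopen subsets -/

section Fibres
variable {T : Scheme.{u}} {A : Type u} [AddCommGroup A] {P : Torsor T A} {x : H1 T A}

lemma Torsor.act_add_apply (P : Torsor T A) (a b : A) (y : P.Y.left) :
    (P.act (a + b)).left y = (P.act b).left ((P.act a).left y) := by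
  rw [P.act_add, et_comp_apply]

lemma Torsor.act_zero_apply (P : Torsor T A) (y : P.Y.left) : (P.act 0).left y = y := by
  rw [P.act_zero]
  rfl

/-- The structure morphism of an étale scheme, as a morphism to the terminal object. -/
abbrev etStr (U : T.Etale) : U ⟶ Scheme.Etale.mk (𝟙 T) := etHom U.hom (Category.comp_id _)

/-- Two points with the same image lift to one point of Y ×_T Y, where the two projections differ
locally by a group element. -/
lemma Torsor.HasClass.exists_act_eq (hP : P.HasClass x) (y y' : P.Y.left)
    (hy : P.Y.hom y = P.Y.hom y') : ∃ a, (P.act a).left y = y' := by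
  obtain ⟨z, rfl, rfl⟩ := exists_etProd_point (etStr P.Y) (etStr P.Y) y y' hy
  obtain ⟨S, hS, ha⟩ := hP.exists_act_local (etFst (etStr P.Y) (etStr P.Y))
    (etSnd (etStr P.Y) (etStr P.Y))
  obtain ⟨V, f, hf, v, rfl⟩ := (mem_smallEtale_iff S).1 hS z
  obtain ⟨a, ha⟩ := ha f hf
  refine ⟨a, ?_⟩
  rw [← et_comp_apply, ← et_comp_apply, ← et_comp_apply, ha, Category.assoc]

/-- Over a connected base, a nonempty clopen subset of a torsor that is stable under the group is
everything. -/
lemma Torsor.HasClass.eq_univ_of_act [ConnectedSpace T] (hP : P.HasClass x) {O : Set P.Y.left}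
    (hO : IsClopen O) (hne : O.Nonempty) (hact : ∀ a y, y ∈ O → (P.act a).left y ∈ O) :
    O = Set.univ := by
  have hT : PreconnectedSpace ((Functor.fromPUnit T).obj P.Y.right) :=
    inferInstanceAs (PreconnectedSpace T)
  have hop : IsOpenMap P.Y.hom := P.Y.hom.isOpenMap
  -- The group is transitive on fibres, so an invariant set and its complement have disjoint images;
  -- both are open, as Y → T is étale.
  have hcompl : (P.Y.hom '' O)ᶜ = P.Y.hom '' Oᶜ := by
    ext t
    constructor
    · intro ht
      obtain ⟨y, rfl⟩ := P.surjective.surj t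
      exact ⟨y, fun hy => ht ⟨y, hy, rfl⟩, rfl⟩
    · rintro ⟨y, hy, rfl⟩ ⟨y', hy', hyy'⟩
      obtain ⟨a, rfl⟩ := hP.exists_act_eq y' y hyy'
      exact hy (hact a y' hy')
  have hcl : IsClopen (P.Y.hom '' O) :=
    ⟨⟨by rw [hcompl]; exact hop _ hO.compl.isOpen⟩, hop _ hO.isOpen⟩
  have huniv := hcl.eq_univ (hne.image _)
  have : P.Y.hom '' Oᶜ = ∅ := by rw [← hcompl, huniv, Set.compl_univ]
  exact Set.compl_empty_iff.1 (Set.image_eq_empty.1 this)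

end Fibres

/-! ### An equivariant locally constant function trivializes the class -/

section Vanishing
variable {T : Scheme.{u}} {G : Type u} [AddCommGroup G] {P : Torsor T (Dual G)} {x : H1 T (Dual G)}

/-- If evaluation at `g` trivializes the torsor up to a locally constant function, the image of the
class under evaluation at `g` vanishes. -/
theorem Torsor.HasClass.evalHom_eq_zero (hP : P.HasClass x) (g : G)
    (l : LocallyConstant P.Y.left QZ.{u}) (hl : ∀ a y, l ((P.act a).left y) = a g + l y) :
    evalHom T G x g = 0 := by
  have hloc {W : T.Etale} (k k' : W ⟶ P.Y) := hP.exists_act_local k k'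
  obtain ⟨E, i, p, w, h, φ, rfl, hact, hinj, hsurj⟩ := hP
  have := h.mono_f
  have : Mono i := h.mono_f
  have : Epi p := h.epi_g
  let ev := constMap T (evalAt g)
  let j := Injective.ι (constSh T QZ.{u})
  let q := cokernel.π j
  have h' : (ShortComplex.mk j q (cokernel.condition j)).ShortExact :=
    ShortComplex.ShortExact.mk' (ShortComplex.exact_cokernel _) inferInstance inferInstance
  let ψ := Injective.factorThru (ev ≫ j) i
  have hψ : i ≫ ψ = ev ≫ j := Injective.comp_factorThru _ _
  have hψq : i ≫ ψ ≫ q = 0 := by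
    rw [reassoc_of% hψ, cokernel.condition, comp_zero]
  let γ : constSh T (ULift.{u} ℤ) ⟶ cokernel j :=
    h.gIsCokernel.desc (CokernelCofork.ofπ (ψ ≫ q) hψq)
  have hγ : p ≫ γ = ψ ≫ q :=
    h.gIsCokernel.fac (CokernelCofork.ofπ (ψ ≫ q) hψq) WalkingParallelPair.one
  let Φ : ShortComplex.mk i p w ⟶ ShortComplex.mk j q (cokernel.condition j) :=
    { τ₁ := ev, τ₂ := ψ, τ₃ := γ, comm₁₂ := hψ.symm, comm₂₃ := hγ.symm }
  have hnat := ShortComplex.ShortExact.extClass_naturality h h' Φ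
  change h.extClass.comp (Ext.mk₀ ev) (add_zero 1) = 0
  refine hnat.trans ?_
  obtain ⟨c, hc⟩ := exists_section_of_locallyConstant l
  let σ : E.obj.obj (op P.Y) := φ.app (op P.Y) (𝟙 P.Y)
  have hσ {U : T.Etale} (y : U ⟶ P.Y) : (φ.app (op U) y : E.obj.obj (op U)) = E.obj.map y.op σ := by
    rw [← app_yoneda_comp, Category.comp_id]
  let e := (Injective.under (constSh T QZ.{u})).obj
  -- Translation by a changes both terms by a(g), so the difference is invariant and descends to T.
  -- Since j(c) dies in the cokernel, the descended section lifts γ(1), and the boundary vanishes.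
  let u : e.obj (op P.Y) := ψ.hom.app (op P.Y) σ - j.hom.app (op P.Y) c
  have hu {U : T.Etale} (y : U ⟶ P.Y) : e.map y.op u =
      ψ.hom.app (op U) (E.obj.map y.op σ) -
        j.hom.app (op U) ((constSh T QZ.{u}).obj.map y.op c) := by
    rw [map_sub, app_map_elt, app_map_elt]
  have hinv {U : T.Etale} (y : U ⟶ P.Y) (a : Dual G) :
      e.map (y ≫ P.act a).op u = e.map y.op u := by
    rw [hu, hu, ← hσ, ← hσ, hact, map_add]
    have h1 : ψ.hom.app (op U) (i.hom.app (op U) (constSec T (Dual G) U a)) =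
        j.hom.app (op U) (constSec T QZ.{u} U (a g)) := by
      have h2 : (i ≫ ψ).hom.app (op U) (constSec T (Dual G) U a) =
          (ev ≫ j).hom.app (op U) (constSec T (Dual G) U a) := by rw [hψ]
      refine h2.trans ?_
      change j.hom.app (op U) (ev.hom.app (op U) _) = _
      rw [constMap_constSec]
      rfl
    have h3 : (constSh T QZ.{u}).obj.map (y ≫ P.act a).op c =
        constSec T QZ.{u} U (a g) + (constSh T QZ.{u}).obj.map y.op c := by
      obtain ⟨S, hS, hb⟩ := locallyConstant_cover (l.comap ⟨y.left, y.left.continuous⟩)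
      refine sheaf_ext _ hS fun V f hf => ?_
      obtain ⟨b, hb⟩ := hb f hf
      have hb' : ∀ v, l ((f ≫ y).left v) = b := fun v => by
        rw [et_comp_apply]
        exact hb v
      have hab : ∀ v, l ((f ≫ y ≫ P.act a).left v) = a g + b := fun v => by
        rw [← Category.assoc, et_comp_apply, hl, hb']
      rw [map_add, ← map_comp_elt, ← map_comp_elt, constSec_map, hc V _ _ hab, hc V _ _ hb',
        constSec_add]
    rw [h1, h3, map_add, add_sub_add_left_eq_sub]
  have hsurjY : Surjective (etStr P.Y).left := P.surjective
  obtain ⟨s, hs⟩ := exists_descent (isSheaf_forget (Injective.under (constSh T QZ.{u})))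
    (etStr P.Y) u (fun W k k' _ => by
      obtain ⟨S, hS, ha⟩ := hloc k k'
      refine sheaf_ext (Injective.under (constSh T QZ.{u})) hS fun V f hf => ?_
      obtain ⟨a, ha⟩ := ha f hf
      refine (map_comp_elt _ k f u).symm.trans (Eq.trans ?_ (map_comp_elt _ k' f u))
      rw [ha]
      exact (hinv _ _).symm)
  refine boundary_eq_zero h' γ s ?_
  refine sheaf_ext _ (singleton_mem_smallEtale (etStr P.Y)) ?_
  rintro V _ ⟨_, y, _, ⟨⟩, rfl⟩
  have h1 : p.hom.app (op P.Y) σ = constSec T (ULift.{u} ℤ) P.Y ⟨1⟩ := (hsurj _ _).2 ⟨_, rfl⟩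
  have h2 : q.hom.app (op P.Y) (ψ.hom.app (op P.Y) σ) =
      γ.hom.app (op P.Y) (p.hom.app (op P.Y) σ) := by
    change (ψ ≫ q).hom.app (op P.Y) σ = (p ≫ γ).hom.app (op P.Y) σ
    rw [hγ]
  have h3 : q.hom.app (op P.Y) (j.hom.app (op P.Y) c) = 0 := by
    change (j ≫ q).hom.app (op P.Y) c = 0
    rw [cokernel.condition]
    rfl
  have h4 : q.hom.app (op P.Y) u = γ.hom.app (op P.Y) (constSec T (ULift.{u} ℤ) P.Y ⟨1⟩) := by
    rw [map_sub, h2, h3, sub_zero, h1]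
  have h5 := app_map_elt q (etStr P.Y) s
  rw [show e.map (etStr P.Y).op s = u from hs, h4] at h5
  have h6 := app_map_elt γ (etStr P.Y) (constSec T (ULift.{u} ℤ) _ ⟨1⟩)
  rw [constSec_map] at h6
  refine (map_comp_elt _ _ _ _).trans (.trans (congrArg _ ?_) (map_comp_elt _ _ _ _).symm)
  exact h5.symm.trans h6

end Vanishing

/-! ### An injective homomorphism gives a connected torsor -/

section Connectedness
variable {T : Scheme.{u}} {A : Type u} [AddCommGroup A]

/-- The group elements which move a point of a torsor into a given set. -/
def Torsor.hits (P : Torsor T A) (Z : Set P.Y.left) (y : P.Y.left) : Set A :=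
  {a | (P.act a).left y ∈ Z}

lemma Torsor.hits_act (P : Torsor T A) (Z : Set P.Y.left) (b : A) (y : P.Y.left) :
    P.hits Z ((P.act b).left y) = {a | b + a ∈ P.hits Z y} := by
  ext a
  change (P.act a).left ((P.act b).left y) ∈ Z ↔ (P.act (b + a)).left y ∈ Z
  rw [P.act_add_apply]

lemma Torsor.isLocallyConstant_hits [Finite A] (P : Torsor T A) {Z : Set P.Y.left}
    (hZ : IsClopen Z) : IsLocallyConstant (P.hits Z) := by
  refine IsLocallyConstant.iff_isOpen_fiber.2 fun C => ?_
  have : P.hits Z ⁻¹' {C} = ⋂ a : A, {y | (P.act a).left y ∈ Z ↔ a ∈ C} := by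
    ext y
    simp only [Set.mem_preimage, Set.mem_singleton_iff, Set.mem_iInter, Set.mem_ofPred_eq]
    exact Set.ext_iff
  rw [this]
  refine isOpen_iInter_of_finite fun a => ?_
  have hcl : IsClopen ((P.act a).left ⁻¹' Z) := hZ.preimage (P.act a).left.continuous
  by_cases ha : a ∈ C
  · simp only [ha, iff_true]
    exact hcl.isOpen
  · simp only [ha, iff_false]
    exact hcl.compl.isOpen

/-- Over a connected base, the sets of group elements moving a point into a clopen set are
translates of each other. -/
lemma Torsor.HasClass.exists_hits_eq [ConnectedSpace T] [Finite A] {P : Torsor T A} {x : H1 T A}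
    (hP : P.HasClass x) {Z : Set P.Y.left} (hZ : IsClopen Z) (y₀ y : P.Y.left) :
    ∃ c, P.hits Z y = {a | c + a ∈ P.hits Z y₀} := by
  -- The points whose set of group elements is a translate of the one at y₀ form a clopen subset
  -- stable under the group.
  let C : Set (Set A) := {B | ∃ c, B = {a | c + a ∈ P.hits Z y₀}}
  have hl := P.isLocallyConstant_hits hZ
  have h1 := hP.eq_univ_of_act (O := P.hits Z ⁻¹' C)
    ⟨⟨hl Cᶜ⟩, hl C⟩ ⟨y₀, 0, by simp⟩ (by
      rintro b y ⟨c, hc⟩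
      refine ⟨c + b, ?_⟩
      rw [P.hits_act, hc]
      simp [add_assoc])
  exact (Set.ext_iff.1 h1 y).2 trivial

/-- The translations preserving a subset of a commutative group. -/
def translationStabilizer (B : Set A) : AddSubgroup A where
  carrier := {c | ∀ a, c + a ∈ B ↔ a ∈ B}
  zero_mem' a := by rw [zero_add]
  add_mem' {c d} hc hd a := by rw [add_assoc, hc, hd]
  neg_mem' {c} hc a := by rw [← hc, add_neg_cancel_left]

variable {G : Type u} [AddCommGroup G] [Finite G]

/-- A torsor under a finite dual group over a connected base is connected if the corresponding
homomorphism is injective. -/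
theorem Torsor.HasClass.connectedSpace [ConnectedSpace T] {P : Torsor T (Dual G)}
    {x : H1 T (Dual G)} (hP : P.HasClass x) (hinj : Function.Injective (evalHom T G x)) :
    ConnectedSpace P.Y.left := by
  have : Nonempty P.Y.left := by
    obtain ⟨y, -⟩ := P.surjective.surj (Classical.arbitrary T)
    exact ⟨y⟩
  have : PreconnectedSpace P.Y.left := preconnectedSpace_iff_clopen.2 fun Z hZ => by
    by_contra! hcon
    obtain ⟨⟨y₀, hy₀⟩, hne⟩ := hcon
    obtain ⟨y₁, hy₁⟩ := (Set.ne_univ_iff_exists_notMem Z).1 hne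
    set B := P.hits Z y₀ with hB
    have hB₀ : (0 : Dual G) ∈ B := by
      change (P.act 0).left y₀ ∈ Z
      rwa [P.act_zero_apply]
    -- If all translations preserved B, the sets attached to y₀ and y₁ would coincide; but 0 lies in
    -- the first and not in the second, as y₀ ∈ Z and y₁ ∉ Z.
    have hH : translationStabilizer B ≠ ⊤ := by
      intro h
      obtain ⟨c, hc⟩ := hP.exists_hits_eq hZ y₀ y₁
      have h1 : (0 : Dual G) ∈ P.hits Z y₁ := by
        rw [hc]
        have h2 : c ∈ translationStabilizer B := h ▸ trivial
        exact (h2 0).2 hB₀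
      change (P.act 0).left y₁ ∈ Z at h1
      rw [P.act_zero_apply] at h1
      exact hy₁ h1
    obtain ⟨g, hg, hHg⟩ := exists_ne_zero_of_ne_top hH
    classical
    -- A translate of B determines its parameter c up to the stabilizer, which g annihilates, so
    -- c(g) is well defined. The value 0 on other sets plays no role, since every set that occurs is
    -- a translate of B.
    let v : Set (Dual G) → QZ.{u} := fun C =>
      if h : ∃ c : Dual G, C = {a | c + a ∈ B} then h.choose g else 0
    have hv : ∀ c : Dual G, v {a | c + a ∈ B} = c g := by
      intro c
      have h : ∃ c', {a | c + a ∈ B} = {a | c' + a ∈ B} := ⟨c, rfl⟩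
      have h1 : c - h.choose ∈ translationStabilizer B := fun a => by
        have h2 := Set.ext_iff.1 h.choose_spec (a - h.choose)
        simp only [Set.mem_ofPred_eq, add_sub_cancel] at h2
        rw [← h2]
        exact iff_of_eq (congrArg (· ∈ B) (by abel))
      have h3 : c g - h.choose g = 0 := hHg _ h1
      change (if h : _ then _ else _) = _
      rw [dif_pos h]
      exact (sub_eq_zero.1 h3).symm
    let l : LocallyConstant P.Y.left QZ.{u} :=
      ⟨fun y => v (P.hits Z y), (P.isLocallyConstant_hits hZ).comp v⟩
    have hl : ∀ (a : Dual G) (y : P.Y.left), l ((P.act a).left y) = a g + l y := by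
      intro a y
      obtain ⟨c, hc⟩ := hP.exists_hits_eq hZ y₀ y
      change v (P.hits Z ((P.act a).left y)) = a g + v (P.hits Z y)
      have h1 : P.hits Z ((P.act a).left y) = {b | (c + a) + b ∈ B} := by
        rw [P.hits_act, hc]
        simp [add_assoc, hB]
      rw [h1, hc, hv, hv, add_comm]
      rfl
    exact hg (hinj ((hP.evalHom_eq_zero g l hl).trans (map_zero _).symm))
  exact ⟨inferInstance⟩

end Connectedness

theorem exists_connected_torsor {T : Scheme.{u}} [ConnectedSpace T] {G : Type u} [AddCommGroup G]
    [AddGroup.FG G] (x : H1 T (Dual G))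
    (hfin : Finite G ∨ (CompactSpace T ∧ QuasiSeparatedSpace T) ∨
      ∀ y : H1 T QZ.{u}, IsOfFinAddOrder y)
    (hinj : Function.Injective (evalHom T G x)) :
    ∃ P : Torsor T (Dual G), P.HasClass x ∧ ConnectedSpace P.Y.left := by
  -- In every case G is finite: apart from the first, it is finitely generated and embeds into a
  -- torsion group.
  have : Finite G := by
    rcases hfin with h | ⟨_, _⟩ | h
    · exact h
    · exact finite_of_injective_of_torsion _ hinj (isOfFinAddOrder_H1 isOfFinAddOrder_qz)
    · exact finite_of_injective_of_torsion _ hinj h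
  obtain ⟨P, hP⟩ := exists_torsor x
  exact ⟨P, hP, hP.connectedSpace hinj⟩

end EtaleTorsor

end

open EtaleTorsor in
theorem mainTheorem5 :
    -- the canonical map in degree one is an isomorphism, natural in `T` and in `G`
    (∀ (T : Scheme.{u}) (G : Type u) [AddCommGroup G] [AddGroup.FG G],
      Function.Bijective (evalHom T G)) ∧
    (∀ (S T : Scheme.{u}) (f : S ⟶ T) (G : Type u) [AddCommGroup G] [AddGroup.FG G]
      (x : H1 T (Dual G)) (g : G),
      evalHom S G (H1pull f (Dual G) x) g = H1pull f QZ.{u} (evalHom T G x g)) ∧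
    (∀ (T : Scheme.{u}) (G G' : Type u) [AddCommGroup G] [AddCommGroup G'] [AddGroup.FG G]
      [AddGroup.FG G'] (φ : G →+ G') (x : H1 T (Dual G')),
      evalHom T G (Sheaf.H.map (constMap T (dualMap φ)) 1 x) = (evalHom T G' x).comp φ) ∧
    -- connected torsors and injective homomorphisms
    (∀ (T : Scheme.{u}) [ConnectedSpace T] (G : Type u) [AddCommGroup G] [AddGroup.FG G]
      (x : H1 T (Dual G)),
      ((∃ P : Torsor T (Dual G), P.HasClass x ∧ ConnectedSpace P.Y.left) →
        Function.Injective (evalHom T G x)) ∧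
      ((Finite G ∨ (CompactSpace T ∧ QuasiSeparatedSpace T) ∨
          ∀ y : H1 T QZ.{u}, IsOfFinAddOrder y) →
        Function.Injective (evalHom T G x) →
        ∃ P : Torsor T (Dual G), P.HasClass x ∧ ConnectedSpace P.Y.left)) ∧
    -- the isomorphism of sheaves induced by evaluation, natural in `G`
    (∀ (S T : Scheme.{u}) (f : S ⟶ T),
      ∃ e : ∀ (G : Type u) [AddCommGroup G] [AddGroup.FG G],
          ulift ((R1 f).obj (constSh S (Dual G))) ≅
            internalHom (constSh T G) ((R1 f).obj (constSh S QZ.{u})),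
        (∀ (G : Type u) [AddCommGroup G] [AddGroup.FG G] (U V : T.Etale) (p : V ⟶ U)
          (s : ((R1 f).obj (constSh S (Dual G))).obj.obj (op U)) (g : G),
          applySection ((e G).hom.hom.app (op U) (ULift.up s)) p (constSec T G V g) =
            ((R1 f).map (constMap S (evalAt g))).hom.app (op V)
              (((R1 f).obj (constSh S (Dual G))).obj.map p.op s)) ∧
        (∀ (G G' : Type u) [AddCommGroup G] [AddCommGroup G'] [AddGroup.FG G] [AddGroup.FG G']
          (φ : G →+ G') (U V : T.Etale) (p : V ⟶ U)
          (s : ((R1 f).obj (constSh S (Dual G'))).obj.obj (op U))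
          (t : (constSh T G).obj.obj (op V)),
          applySection ((e G).hom.hom.app (op U)
              (ULift.up (((R1 f).map (constMap S (dualMap φ))).hom.app (op U) s))) p t =
            applySection ((e G').hom.hom.app (op U) (ULift.up s)) p
              ((constMap T φ).hom.app (op V) t))) := by  exact ⟨fun T G _ _ => evalHom_bijective T G, fun S T f G _ _ x g => evalHom_naturality f G x g,
    fun T G G' _ _ _ _ φ x => evalHom_dualMap T G G' φ x,
    fun T _ G _ _ x => ⟨fun ⟨P, hP, _⟩ => evalHom_injective_of_connected x P hP,
      exists_connected_torsor x⟩,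
    fun S T f => exists_evalSheafIso f⟩
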